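/- Let $\mathcal B$ be a compact smooth manifold with boundary, $\dim\mathcal B=n+1$, $n\ge 1$, with interior $\mathbb B^\circ$. Let a collar neighbourhood of the boundary be identified with $[0,1)\times\partial\mathcal B$, with coordinates $(x,y)$, and let $g$ be a smooth Riemannian metric on $\mathbb B^\circ$ which on $(0,1)\times\partial\mathcal B$ has the form $$g=dx^2+x^2h(x),$$ where $h(x)$, $x\in[0,1)$, is a family of Riemannian metrics on $\partial\mathcal B$ that is smooth up to $x=0$. Write $\mathbb B=(\mathcal B,g)$ and let $\mu_g$ be the Riemannian measure of $g$. Let $H^1(\mathbb B)$ be the completion of the space $C_c^\infty(\mathbb B^\circ)$ of complex-valued smooth functions with compact support in $\mathbb B^\circ$ with respect to the inner product $$(u,v)_{H^1(\mathbb B)}=\int_{\mathbb B}u\overline v\,d\mu_g+\int_{\mathbb B}\langle\nabla u,\overline{\nabla v}\rangle\,d\mu_g .$$ Let $L^p(\mathbb B)=L^p(\mathbb B^\circ,\mu_g)$ (complex-valued functions). Let $\mathsf x:\mathcal B\to[0,1]$ be any function that is smooth and positive on $\mathbb B^\circ$ and satisfies $\mathsf x(x,y)=x$ on $[0,\delta)\times\partial\mathcal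 B$ for some $\delta\in(0,1]$, and for $a\in\mathbb R$ let $\mathsf x^{a}L^p(\mathbb B)=\{u:\int_{\mathbb B}|\mathsf x^{-a}u|^p\,d\mu_g<\infty\}$ with the norm $\|\mathsf x^{-a}u\|_{L^p(\mathbb B)}$. Write $H^1(\mathbb B)\hookrightarrow X$ if the identity on $C_c^\infty(\mathbb B^\circ)$ extends to an injective continuous linear map $H^1(\mathbb B)\to X$. Then: (i) If $\dim\mathbb B\in\{2,3\}$, then $H^1(\mathbb B)\hookrightarrow L^4(\mathbb B)$. (ii) If $\dim\mathbb B=2$, then $H^1(\mathbb B)\hookrightarrow L^6(\mathbb B)$. (iii) If $\dim\mathbb B=3$ and $\alpha>0$, then $H^1(\mathbb B)\hookrightarrow \mathsf x^{-\alpha}L^6(\mathbb B)$. -/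

import Mathlib

open Set Filter Topology MeasureTheory Bundle Manifold
open scoped ContDiff ENNReal Matrix

/-- A compact manifold `B` of dimension `n + 1` with boundary `Y`, together with a conically
degenerate Riemannian metric: a collar neighbourhood `[0, 1) × Y` of the boundary and a
Riemannian metric `g` on the interior of `B` that equals `dx² + x² h(x)` on `(0, 1) × Y`,
where `h(x)`, `x ∈ [0, 1)`, is a smooth family of Riemannian metrics on `Y`
(smooth up to `x = 0`). The values of `g` outside the interior are not used, and neither are
the values of `h` and `collar` outside `[0, 1)` and `[0, 1) × Y`. -/
structure ConicManifold (n : ℕ) (Y B : Type*)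
    [TopologicalSpace Y] [ChartedSpace (EuclideanSpace ℝ (Fin n)) Y] [IsManifold (𝓡 n) ∞ Y]
    [TopologicalSpace B] [ChartedSpace (EuclideanHalfSpace (n + 1)) B]
    [IsManifold (𝓡∂ (n + 1)) ∞ B] where
  /-- the collar, a diffeomorphism from `[0, 1) × Y` onto an open subset of `B` -/
  collar : PartialEquiv (ℝ × Y) B
  collar_source : collar.source = Ico 0 1 ×ˢ univ
  isOpen_collar_target : IsOpen collar.target
  contMDiffOn_collar :
    ContMDiffOn (𝓘(ℝ, ℝ).prod (𝓡 n)) (𝓡∂ (n + 1)) ∞ collar collar.source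
  contMDiffOn_collar_symm :
    ContMDiffOn (𝓡∂ (n + 1)) (𝓘(ℝ, ℝ).prod (𝓡 n)) ∞ collar.symm collar.target
  /-- the collar maps `{0} × Y` onto the boundary of `B` -/
  collar_image_zero : collar '' ({0} ×ˢ univ) = (𝓡∂ (n + 1)).boundary B
  /-- the metric on the interior of `B` -/
  g (z : B) : TangentSpace (𝓡∂ (n + 1)) z →L[ℝ] TangentSpace (𝓡∂ (n + 1)) z →L[ℝ] ℝ
  g_symm : ∀ z ∈ (𝓡∂ (n + 1)).interior B, ∀ v w, g z v w = g z w v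
  g_pos : ∀ z ∈ (𝓡∂ (n + 1)).interior B, ∀ v, v ≠ 0 → 0 < g z v v
  contMDiffOn_g :
    ContMDiffOn (𝓡∂ (n + 1)) ((𝓡∂ (n + 1)).prod 𝓘(ℝ, EuclideanSpace ℝ (Fin (n + 1)) →L[ℝ]
        EuclideanSpace ℝ (Fin (n + 1)) →L[ℝ] ℝ)) ∞
      (fun z ↦ TotalSpace.mk' (EuclideanSpace ℝ (Fin (n + 1)) →L[ℝ]
        EuclideanSpace ℝ (Fin (n + 1)) →L[ℝ] ℝ) z (g z))
      ((𝓡∂ (n + 1)).interior B)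
  /-- the family `h(x)`, `x ∈ [0, 1)`, of metrics on the boundary -/
  h (x : ℝ) (y : Y) : TangentSpace (𝓡 n) y →L[ℝ] TangentSpace (𝓡 n) y →L[ℝ] ℝ
  h_symm : ∀ x ∈ Ico (0 : ℝ) 1, ∀ y v w, h x y v w = h x y w v
  h_pos : ∀ x ∈ Ico (0 : ℝ) 1, ∀ y v, v ≠ 0 → 0 < h x y v v
  contMDiffOn_h :
    ContMDiffOn (𝓘(ℝ, ℝ).prod (𝓡 n)) ((𝓡 n).prod 𝓘(ℝ, EuclideanSpace ℝ (Fin n) →L[ℝ]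
        EuclideanSpace ℝ (Fin n) →L[ℝ] ℝ)) ∞
      (fun p : ℝ × Y ↦ TotalSpace.mk' (EuclideanSpace ℝ (Fin n) →L[ℝ]
        EuclideanSpace ℝ (Fin n) →L[ℝ] ℝ)
        (E := fun y : Y ↦ TangentSpace (𝓡 n) y →L[ℝ] TangentSpace (𝓡 n) y →L[ℝ] ℝ)
        p.2 (h p.1 p.2))
      (Ico 0 1 ×ˢ univ)
  /-- on the collar, `g = dx² + x² h(x)` -/
  g_collar : ∀ x ∈ Ioo (0 : ℝ) 1, ∀ (y : Y) (a b : ℝ) (v w : TangentSpace (𝓡 n) y),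
    g (collar (x, y))
        (mfderiv (𝓘(ℝ, ℝ).prod (𝓡 n)) (𝓡∂ (n + 1)) collar (x, y) (a, v))
        (mfderiv (𝓘(ℝ, ℝ).prod (𝓡 n)) (𝓡∂ (n + 1)) collar (x, y) (b, w))
      = a * b + x ^ 2 * h x y v w

namespace ConicManifold

variable {n : ℕ} {Y B : Type*}
  [TopologicalSpace Y] [ChartedSpace (EuclideanSpace ℝ (Fin n)) Y] [IsManifold (𝓡 n) ∞ Y]
  [TopologicalSpace B] [ChartedSpace (EuclideanHalfSpace (n + 1)) B]
  [IsManifold (𝓡∂ (n + 1)) ∞ B]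

/-- The coordinate vector field `∂ᵢ` of the chart of `B` centred at `c`, at the point `z`. -/
noncomputable def coordVec (c z : B) (i : Fin (n + 1)) : TangentSpace (𝓡∂ (n + 1)) z :=
  (trivializationAt (EuclideanSpace ℝ (Fin (n + 1))) (TangentSpace (𝓡∂ (n + 1))) c).symmL ℝ z
    (EuclideanSpace.single i 1)

/-- The coefficients `gᵢⱼ = g(∂ᵢ, ∂ⱼ)` of the metric in the chart centred at `c`, at `z`. -/
noncomputable def gram (𝔹 : ConicManifold n Y B) (c z : B) :
    Matrix (Fin (n + 1)) (Fin (n + 1)) ℝ :=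
  Matrix.of fun i j ↦ 𝔹.g z (coordVec c z i) (coordVec c z j)

/-- The measure `√(det gᵢⱼ) dp` on the part of the interior that is covered by the chart
centred at `c`. -/
noncomputable def chartVolume [MeasurableSpace B] (𝔹 : ConicManifold n Y B) (c : B) : Measure B :=
  (((volume : Measure (EuclideanSpace ℝ (Fin (n + 1)))).restrict
      (extChartAt (𝓡∂ (n + 1)) c ''
        ((extChartAt (𝓡∂ (n + 1)) c).source ∩ (𝓡∂ (n + 1)).interior B))).withDensity
      fun p ↦ ENNReal.ofReal
        √(𝔹.gram c ((extChartAt (𝓡∂ (n + 1)) c).symm p)).det).map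
    (extChartAt (𝓡∂ (n + 1)) c).symm

/-- The Riemannian measure `dμ_g` on the interior of `B`, as a measure on `B` for which the
boundary is a null set: the least measure that dominates `√(det gᵢⱼ) dp` in every chart
(in fact it restricts to that measure in every chart, see `restrict_vol`). -/
noncomputable def vol [MeasurableSpace B] (𝔹 : ConicManifold n Y B) : Measure B :=
  ⨆ c : B, 𝔹.chartVolume c

/-- The partial derivative `∂ᵢu` at `z` in the chart centred at `c`. -/
noncomputable def partialDeriv (u : B → ℂ) (c z : B) (i : Fin (n + 1)) : ℂ :=
  mfderiv (𝓡∂ (n + 1)) 𝓘(ℝ, ℂ) u z (coordVec c z i)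

/-- `⟨∇u, \overline{∇v}⟩ = ∑ gⁱʲ ∂ᵢu \overline{∂ⱼv}` for complex-valued functions, computed at
each point `z` in the chart centred at `z`. -/
noncomputable def gradInner (𝔹 : ConicManifold n Y B) (u v : B → ℂ) (z : B) : ℂ :=
  ∑ i, ∑ j, (((𝔹.gram z z)⁻¹ i j : ℝ) : ℂ) *
    partialDeriv u z z i * (starRingEnd ℂ) (partialDeriv v z z j)

/-! ### Change of charts -/

theorem coordVec_change {c d z : B} (hc : z ∈ (extChartAt (𝓡∂ (n + 1)) c).source)
    (hd : z ∈ (extChartAt (𝓡∂ (n + 1)) d).source) (i : Fin (n + 1)) :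
    coordVec c z i = ∑ k, (tangentCoordChange (𝓡∂ (n + 1)) c d z (EuclideanSpace.single i 1)) k •
      coordVec d z k := by
  have hc' : z ∈ (chartAt (EuclideanHalfSpace (n + 1)) c).source := by simpa using hc
  have hd' : z ∈ (chartAt (EuclideanHalfSpace (n + 1)) d).source := by simpa using hd
  have hz : z ∈ (extChartAt (𝓡∂ (n + 1)) z).source := mem_extChartAt_source z
  unfold coordVec
  simp only [← map_smul, ← map_sum]
  rw [TangentBundle.symmL_trivializationAt_eq_core hc',
    TangentBundle.symmL_trivializationAt_eq_core hd']
  have := tangentCoordChange_comp (I := 𝓡∂ (n + 1)) (w := c) (x := d) (y := z) (z := z)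
    (v := EuclideanSpace.single i 1) ⟨⟨hc, hd⟩, hz⟩
  have e : tangentCoordChange (𝓡∂ (n + 1)) c d z (EuclideanSpace.single i 1) =
      ∑ k, (tangentCoordChange (𝓡∂ (n + 1)) c d z (EuclideanSpace.single i 1)) k •
        (EuclideanSpace.single k 1 : EuclideanSpace ℝ (Fin (n + 1))) := by
    ext k
    simp [Finset.sum_apply, Pi.single_apply]
  exact this.symm.trans (congrArg (tangentCoordChange (𝓡∂ (n + 1)) d z z) e)

/-- The Jacobian matrix at `z` of the change of charts from `c` to `d`. -/
noncomputable def jac (n : ℕ) {B : Type*} [TopologicalSpace B]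
    [ChartedSpace (EuclideanHalfSpace (n + 1)) B] [IsManifold (𝓡∂ (n + 1)) ∞ B] (c d z : B) :
    Matrix (Fin (n + 1)) (Fin (n + 1)) ℝ :=
  Matrix.of fun k i ↦ (tangentCoordChange (𝓡∂ (n + 1)) c d z (EuclideanSpace.single i 1)) k

theorem det_jac (c d z : B) :
    (jac n c d z).det = (tangentCoordChange (𝓡∂ (n + 1)) c d z).det := by
  have h := LinearMap.det_toMatrix (EuclideanSpace.basisFun (Fin (n + 1)) ℝ).toBasis
    (tangentCoordChange (𝓡∂ (n + 1)) c d z : EuclideanSpace ℝ (Fin (n + 1)) →ₗ[ℝ]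
      EuclideanSpace ℝ (Fin (n + 1)))
  rw [ContinuousLinearMap.det, ← h]
  congr 1

theorem isUnit_det_jac {c d z : B} (hc : z ∈ (extChartAt (𝓡∂ (n + 1)) c).source)
    (hd : z ∈ (extChartAt (𝓡∂ (n + 1)) d).source) : IsUnit (jac n c d z).det := by
  have h : (tangentCoordChange (𝓡∂ (n + 1)) d c z).comp (tangentCoordChange (𝓡∂ (n + 1)) c d z)
      = ContinuousLinearMap.id ℝ _ := by
    ext1 v
    rw [ContinuousLinearMap.comp_apply, tangentCoordChange_comp ⟨⟨hc, hd⟩, hc⟩,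
      tangentCoordChange_self hc]
    rfl
  have h2 : (tangentCoordChange (𝓡∂ (n + 1)) d c z).det *
      (tangentCoordChange (𝓡∂ (n + 1)) c d z).det = 1 := by
    have := congrArg ContinuousLinearMap.det h
    simpa [ContinuousLinearMap.det, LinearMap.det_comp] using this
  rw [det_jac]
  exact IsUnit.of_mul_eq_one_right _ h2

theorem gram_change (𝔹 : ConicManifold n Y B) {c d z : B}
    (hc : z ∈ (extChartAt (𝓡∂ (n + 1)) c).source)
    (hd : z ∈ (extChartAt (𝓡∂ (n + 1)) d).source) :
    𝔹.gram c z = (jac n c d z)ᵀ * 𝔹.gram d z * jac n c d z := by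
  ext i j
  simp only [gram, Matrix.mul_apply, Matrix.of_apply, Matrix.transpose_apply, Finset.sum_mul]
  rw [coordVec_change hc hd i, coordVec_change hc hd j]
  simp only [map_sum, map_smul, sum_apply, smul_apply,
    smul_eq_mul, Finset.mul_sum, jac, Matrix.of_apply]
  refine Finset.sum_congr rfl fun k _ ↦ ?_
  refine Finset.sum_congr rfl fun l _ ↦ ?_
  ring

theorem partialDeriv_change (u : B → ℂ) {c d z : B}
    (hc : z ∈ (extChartAt (𝓡∂ (n + 1)) c).source)
    (hd : z ∈ (extChartAt (𝓡∂ (n + 1)) d).source) (i : Fin (n + 1)) :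
    partialDeriv u c z i = ∑ k, (jac n c d z k i : ℂ) * partialDeriv u d z k := by
  unfold partialDeriv
  rw [coordVec_change hc hd i, map_sum]
  refine Finset.sum_congr rfl fun k _ ↦ ?_
  rw [map_smul]
  exact Complex.real_smul


/-! ### Continuity in charts and positivity -/

theorem contMDiffOn_coordVec (c : B) (i : Fin (n + 1)) :
    ContMDiffOn (𝓡∂ (n + 1)) (𝓡∂ (n + 1)).tangent ∞
      (fun z ↦ (⟨z, coordVec c z i⟩ : TangentBundle (𝓡∂ (n + 1)) B))
      (extChartAt (𝓡∂ (n + 1)) c).source := by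
  have h := (trivializationAt (EuclideanSpace ℝ (Fin (n + 1)))
    (TangentSpace (𝓡∂ (n + 1)) : B → Type _) c).contMDiffOn_localFrame_baseSet
    (I := 𝓡∂ (n + 1)) (n := ∞) (EuclideanSpace.basisFun (Fin (n + 1)) ℝ).toBasis i
  rw [TangentBundle.trivializationAt_baseSet, ← extChartAt_source (𝓡∂ (n + 1))] at h
  refine h.congr fun z hz ↦ ?_
  have hz' : z ∈ (trivializationAt (EuclideanSpace ℝ (Fin (n + 1)))
    (TangentSpace (𝓡∂ (n + 1)) : B → Type _) c).baseSet := by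
    rw [TangentBundle.trivializationAt_baseSet, ← extChartAt_source (𝓡∂ (n + 1))]
    exact hz
  simp only [Trivialization.localFrame_apply_of_mem_baseSet _ _ hz', coordVec,
    Trivialization.basisAt]
  simp
  exact Trivialization.symmL_apply _ hz' _

theorem continuousOn_gram (𝔹 : ConicManifold n Y B) (c : B) :
    ContinuousOn (𝔹.gram c)
      ((extChartAt (𝓡∂ (n + 1)) c).source ∩ (𝓡∂ (n + 1)).interior B) := by
  refine continuousOn_pi.2 fun i ↦ continuousOn_pi.2 fun j ↦ ?_
  have h := ContMDiffOn.clm_bundle_apply₂ (𝕜 := ℝ)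
    (E₃ := fun _ : B ↦ ℝ) (F₃ := ℝ)
    (𝔹.contMDiffOn_g.mono (inter_subset_right (s := (extChartAt (𝓡∂ (n + 1)) c).source)))
    ((contMDiffOn_coordVec c i).mono inter_subset_left)
    ((contMDiffOn_coordVec c j).mono inter_subset_left)
  intro z hz
  have h' := h z hz
  simp only [contMDiffWithinAt_totalSpace] at h'
  exact h'.2.continuousWithinAt

theorem continuousOn_partialDeriv {u : B → ℂ} (hu : ContMDiff (𝓡∂ (n + 1)) 𝓘(ℝ, ℂ) ∞ u)
    (c : B) (i : Fin (n + 1)) :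
    ContinuousOn (fun z ↦ partialDeriv u c z i) (extChartAt (𝓡∂ (n + 1)) c).source := by
  have h1 : Continuous (tangentMap (𝓡∂ (n + 1)) 𝓘(ℝ, ℂ) u) :=
    hu.continuous_tangentMap (by simp)
  have h2 : Continuous (fun p : TangentBundle 𝓘(ℝ, ℂ) ℂ ↦ (p.2 : ℂ)) :=
    (contMDiff_snd_tangentBundle_modelSpace ℂ 𝓘(ℝ, ℂ) (n := 0)).continuous
  exact (h2.comp h1).comp_continuousOn (contMDiffOn_coordVec c i).continuousOn

theorem gram_self_apply (𝔹 : ConicManifold n Y B) (z : B) (a : Fin (n + 1) → ℝ) :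
    a ⬝ᵥ (𝔹.gram z z *ᵥ a) =
      𝔹.g z (∑ i, a i • coordVec z z i) (∑ i, a i • coordVec z z i) := by
  simp only [dotProduct, Matrix.mulVec, gram, Matrix.of_apply, map_sum, map_smul, sum_apply,
    smul_apply, smul_eq_mul, Finset.mul_sum]
  rw [Finset.sum_comm]
  refine Finset.sum_congr rfl fun i _ ↦ Finset.sum_congr rfl fun j _ ↦ ?_
  ring

theorem posDef_gram_self (𝔹 : ConicManifold n Y B) {z : B}
    (hz : z ∈ (𝓡∂ (n + 1)).interior B) : (𝔹.gram z z).PosDef := by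
  refine Matrix.PosDef.of_dotProduct_mulVec_pos ?_ fun a ha ↦ ?_
  · ext i j
    simp [gram, 𝔹.g_symm z hz (coordVec z z i)]
  · rw [star_trivial, gram_self_apply]
    refine 𝔹.g_pos z hz _ fun h0 ↦ ha ?_
    have hz' : z ∈ (chartAt (EuclideanHalfSpace (n + 1)) z).source := mem_chart_source _ z
    unfold coordVec at h0
    simp only [← map_smul, ← map_sum] at h0
    rw [TangentBundle.symmL_trivializationAt_eq_core hz'] at h0
    have h1 := (tangentCoordChange_self (I := 𝓡∂ (n + 1)) (x := z) (z := z)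
      (v := ∑ i, a i • EuclideanSpace.single i (1 : ℝ)) (mem_extChartAt_source z)).symm.trans h0
    ext i
    have h2 : (∑ i, a i • EuclideanSpace.single i (1 : ℝ) : EuclideanSpace ℝ (Fin (n + 1))) i =
        (0 : EuclideanSpace ℝ (Fin (n + 1))) i := congrArg (fun v ↦ v i) h1
    simpa [Finset.sum_apply, Pi.single_apply] using h2

theorem isUnit_det_gram (𝔹 : ConicManifold n Y B) {c z : B}
    (hc : z ∈ (extChartAt (𝓡∂ (n + 1)) c).source)
    (hz : z ∈ (𝓡∂ (n + 1)).interior B) : IsUnit (𝔹.gram c z).det := by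
  rw [𝔹.gram_change hc (mem_extChartAt_source z), Matrix.det_mul, Matrix.det_mul,
    Matrix.det_transpose]
  have h := isUnit_det_jac hc (mem_extChartAt_source (I := 𝓡∂ (n + 1)) z)
  exact (h.mul (𝔹.posDef_gram_self hz).det_pos.ne'.isUnit).mul h

/-- `⟨∇u, \overline{∇v}⟩` may be computed in any chart. -/
theorem gradInner_eq (𝔹 : ConicManifold n Y B) (u v : B → ℂ) {c z : B}
    (hc : z ∈ (extChartAt (𝓡∂ (n + 1)) c).source) :
    𝔹.gradInner u v z = ∑ i, ∑ j, (((𝔹.gram c z)⁻¹ i j : ℝ) : ℂ) *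
      partialDeriv u c z i * (starRingEnd ℂ) (partialDeriv v c z j) := by
  have hzz := mem_extChartAt_source (I := 𝓡∂ (n + 1)) z
  have key : (𝔹.gram c z)⁻¹ = jac n z c z * (𝔹.gram z z)⁻¹ * (jac n z c z)ᵀ := by
    have h := isUnit_det_jac hzz hc
    have h' : IsUnit (jac n z c z)ᵀ.det := by rwa [Matrix.det_transpose]
    rw [𝔹.gram_change hzz hc, Matrix.mul_inv_rev, Matrix.mul_inv_rev,
      ← Matrix.mul_assoc, Matrix.mul_nonsing_inv _ h, Matrix.one_mul, Matrix.mul_assoc,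
      Matrix.nonsing_inv_mul _ h', Matrix.mul_one]
  unfold gradInner
  rw [key]
  simp only [partialDeriv_change _ hzz hc, Matrix.mul_apply, Matrix.transpose_apply, map_sum,
    map_mul, Complex.conj_ofReal, Complex.ofReal_sum, Complex.ofReal_mul, Finset.sum_mul,
    Finset.mul_sum]
  have rev : ∀ F : Fin (n + 1) → Fin (n + 1) → Fin (n + 1) → Fin (n + 1) → ℂ,
      ∑ i, ∑ j, ∑ l, ∑ k, F i j l k = ∑ k, ∑ l, ∑ j, ∑ i, F i j l k := fun F ↦
    (Finset.sum_congr rfl fun i _ ↦ Finset.sum_congr rfl fun j _ ↦ Finset.sum_comm).trans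
      ((Finset.sum_congr rfl fun i _ ↦ Finset.sum_comm).trans (Finset.sum_comm.trans
        (Finset.sum_congr rfl fun k _ ↦ (Finset.sum_congr rfl fun i _ ↦ Finset.sum_comm).trans
          (Finset.sum_comm.trans (Finset.sum_congr rfl fun l _ ↦ Finset.sum_comm)))))
  rw [rev]
  refine Finset.sum_congr rfl fun k _ ↦ Finset.sum_congr rfl fun l _ ↦
    Finset.sum_congr rfl fun j _ ↦ Finset.sum_congr rfl fun i _ ↦ ?_
  ring

/-- `⟨∇u, \overline{∇v}⟩` is continuous on the interior. -/
theorem continuousOn_gradInner (𝔹 : ConicManifold n Y B) {u v : B → ℂ}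
    (hu : ContMDiff (𝓡∂ (n + 1)) 𝓘(ℝ, ℂ) ∞ u) (hv : ContMDiff (𝓡∂ (n + 1)) 𝓘(ℝ, ℂ) ∞ v) :
    ContinuousOn (𝔹.gradInner u v) ((𝓡∂ (n + 1)).interior B) := by
  intro c hc
  have hcs : c ∈ (extChartAt (𝓡∂ (n + 1)) c).source := mem_extChartAt_source c
  have hmem : c ∈ (extChartAt (𝓡∂ (n + 1)) c).source ∩ (𝓡∂ (n + 1)).interior B := ⟨hcs, hc⟩
  have hinv : ContinuousOn (fun z ↦ (𝔹.gram c z)⁻¹)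
      ((extChartAt (𝓡∂ (n + 1)) c).source ∩ (𝓡∂ (n + 1)).interior B) := by
    have hg := 𝔹.continuousOn_gram c
    have hdet := (Continuous.matrix_det (A := fun M : Matrix (Fin (n + 1)) (Fin (n + 1)) ℝ ↦ M)
      continuous_id).comp_continuousOn hg
    have hadj := (Continuous.matrix_adjugate
      (A := fun M : Matrix (Fin (n + 1)) (Fin (n + 1)) ℝ ↦ M) continuous_id).comp_continuousOn hg
    refine ((hdet.inv₀ fun z hz ↦ (𝔹.isUnit_det_gram hz.1 hz.2).ne_zero).smul hadj).congr
      fun z hz ↦ ?_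
    simp [Matrix.inv_def]
  have h : ContinuousWithinAt (𝔹.gradInner u v)
      ((extChartAt (𝓡∂ (n + 1)) c).source ∩ (𝓡∂ (n + 1)).interior B) c := by
    have h1 : ContinuousOn (fun z ↦ ∑ i, ∑ j, (((𝔹.gram c z)⁻¹ i j : ℝ) : ℂ) *
      partialDeriv u c z i * (starRingEnd ℂ) (partialDeriv v c z j))
        ((extChartAt (𝓡∂ (n + 1)) c).source ∩ (𝓡∂ (n + 1)).interior B) := by
      refine continuousOn_finsetSum _ fun i _ ↦ continuousOn_finsetSum _ fun j _ ↦ ?_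
      refine ContinuousOn.mul (ContinuousOn.mul ?_ ?_) ?_
      · exact Complex.continuous_ofReal.comp_continuousOn
          (continuousOn_pi.1 (continuousOn_pi.1 hinv i) j)
      · exact (continuousOn_partialDeriv hu c i).mono inter_subset_left
      · exact Complex.continuous_conj.comp_continuousOn
          ((continuousOn_partialDeriv hv c j).mono inter_subset_left)
    exact (h1.congr fun z hz ↦ 𝔹.gradInner_eq u v hz.1) c hmem
  rw [inter_comm] at h
  exact h.mono_of_mem_nhdsWithin (inter_mem_nhdsWithin _ (extChartAt_source_mem_nhds c))

/-! ### The Riemannian measure in charts -/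

section Measure

variable [MeasurableSpace B] [BorelSpace B]

theorem measurableSet_interior : MeasurableSet ((𝓡∂ (n + 1)).interior B) :=
  (ModelWithCorners.isOpen_interior (n := ∞) (by simp)).measurableSet

theorem measurableSet_chart_image (c : B) {s : Set B} (hs : MeasurableSet s) :
    MeasurableSet (extChartAt (𝓡∂ (n + 1)) c ''
      ((extChartAt (𝓡∂ (n + 1)) c).source ∩ s)) := by
  have ht : MeasurableSet (extChartAt (𝓡∂ (n + 1)) c).target := by
    rw [extChartAt_target]
    exact ((chartAt _ c).open_target.preimage (𝓡∂ (n + 1)).continuous_symm).measurableSet.inter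
      (𝓡∂ (n + 1)).isClosed_range.measurableSet
  have hc := (continuousOn_iff_continuous_domRestrict.1
    (continuousOn_extChartAt_symm (I := 𝓡∂ (n + 1)) c)).measurable
  rw [PartialEquiv.image_source_inter_eq' ]
  have := ht.subtype_image (hc hs)
  convert this using 1
  ext p
  simp [and_comm]

theorem aemeasurable_extChartAt_symm (c : B) (f : EuclideanSpace ℝ (Fin (n + 1)) → ℝ≥0∞) :
    AEMeasurable (extChartAt (𝓡∂ (n + 1)) c).symm
      (((volume : Measure (EuclideanSpace ℝ (Fin (n + 1)))).restrict
      (extChartAt (𝓡∂ (n + 1)) c ''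
        ((extChartAt (𝓡∂ (n + 1)) c).source ∩ (𝓡∂ (n + 1)).interior B))).withDensity f) := by
  refine AEMeasurable.mono_ac ?_ (withDensity_absolutelyContinuous _ _)
  refine ContinuousOn.aemeasurable ((continuousOn_extChartAt_symm c).mono ?_)
    (measurableSet_chart_image c measurableSet_interior)
  rintro _ ⟨z, hz, rfl⟩
  exact (extChartAt (𝓡∂ (n + 1)) c).map_source hz.1

theorem chartVolume_apply (𝔹 : ConicManifold n Y B) (c : B) {s : Set B} (hs : MeasurableSet s) :
    𝔹.chartVolume c s = ∫⁻ p in extChartAt (𝓡∂ (n + 1)) c ''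
        ((extChartAt (𝓡∂ (n + 1)) c).source ∩ ((𝓡∂ (n + 1)).interior B ∩ s)),
      ENNReal.ofReal √(𝔹.gram c ((extChartAt (𝓡∂ (n + 1)) c).symm p)).det := by
  have hm := measurableSet_chart_image (n := n) c (measurableSet_interior (n := n) (B := B))
  have hms := measurableSet_chart_image (n := n) c ((measurableSet_interior (n := n)).inter hs)
  have hset : extChartAt (𝓡∂ (n + 1)) c ''
        ((extChartAt (𝓡∂ (n + 1)) c).source ∩ ((𝓡∂ (n + 1)).interior B ∩ s)) =
      (extChartAt (𝓡∂ (n + 1)) c).symm ⁻¹' s ∩ extChartAt (𝓡∂ (n + 1)) c ''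
        ((extChartAt (𝓡∂ (n + 1)) c).source ∩ (𝓡∂ (n + 1)).interior B) := by
    ext p
    constructor
    · rintro ⟨z, ⟨hz, hi, hzs⟩, rfl⟩
      exact ⟨by rwa [mem_preimage, (extChartAt (𝓡∂ (n + 1)) c).left_inv hz], z, ⟨hz, hi⟩, rfl⟩
    · rintro ⟨hp, z, ⟨hz, hi⟩, rfl⟩
      rw [mem_preimage, (extChartAt (𝓡∂ (n + 1)) c).left_inv hz] at hp
      exact ⟨z, ⟨hz, hi, hp⟩, rfl⟩
  unfold chartVolume
  rw [Measure.map_apply_of_aemeasurable (aemeasurable_extChartAt_symm c _) hs,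
    withDensity_apply', hset]
  rw [Measure.restrict_restrict' hm]

theorem chartVolume_eq (𝔹 : ConicManifold n Y B) (c d : B) {s : Set B} (hs : MeasurableSet s)
    (hc : s ⊆ (extChartAt (𝓡∂ (n + 1)) c).source) (hd : s ⊆ (extChartAt (𝓡∂ (n + 1)) d).source) :
    𝔹.chartVolume c s = 𝔹.chartVolume d s := by
  rw [chartVolume_apply 𝔹 c hs, chartVolume_apply 𝔹 d hs]
  have hmP := measurableSet_chart_image (n := n) c ((measurableSet_interior (n := n)).inter hs)
  set P := extChartAt (𝓡∂ (n + 1)) c ''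
        ((extChartAt (𝓡∂ (n + 1)) c).source ∩ ((𝓡∂ (n + 1)).interior B ∩ s)) with hP
  have himg : extChartAt (𝓡∂ (n + 1)) d ''
        ((extChartAt (𝓡∂ (n + 1)) d).source ∩ ((𝓡∂ (n + 1)).interior B ∩ s)) =
      (extChartAt (𝓡∂ (n + 1)) d ∘ (extChartAt (𝓡∂ (n + 1)) c).symm) '' P := by
    rw [hP, image_image]
    ext p
    constructor
    · rintro ⟨z, ⟨hz, hi, hzs⟩, rfl⟩
      exact ⟨z, ⟨hc hzs, hi, hzs⟩, by
        simp only [Function.comp_apply, (extChartAt (𝓡∂ (n + 1)) c).left_inv (hc hzs)]⟩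
    · rintro ⟨z, ⟨hz, hi, hzs⟩, rfl⟩
      exact ⟨z, ⟨hd hzs, hi, hzs⟩, by
        simp only [Function.comp_apply, (extChartAt (𝓡∂ (n + 1)) c).left_inv hz]⟩
  have hinj : InjOn (extChartAt (𝓡∂ (n + 1)) d ∘ (extChartAt (𝓡∂ (n + 1)) c).symm) P := by
    rintro _ ⟨z, ⟨hz, hi, hzs⟩, rfl⟩ _ ⟨w, ⟨hw, hiw, hws⟩, rfl⟩ h
    simp only [Function.comp_apply, (extChartAt (𝓡∂ (n + 1)) c).left_inv hz,
      (extChartAt (𝓡∂ (n + 1)) c).left_inv hw] at h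
    rw [(extChartAt (𝓡∂ (n + 1)) d).injOn (hd hzs) (hd hws) h]
  have hder : ∀ p ∈ P, HasFDerivWithinAt
      (extChartAt (𝓡∂ (n + 1)) d ∘ (extChartAt (𝓡∂ (n + 1)) c).symm)
      (tangentCoordChange (𝓡∂ (n + 1)) c d ((extChartAt (𝓡∂ (n + 1)) c).symm p)) P p := by
    rintro _ ⟨z, ⟨hz, hi, hzs⟩, rfl⟩
    have := hasFDerivWithinAt_tangentCoordChange (I := 𝓡∂ (n + 1)) (x := c) (y := d) (z := z)
      ⟨hz, hd hzs⟩
    rw [(extChartAt (𝓡∂ (n + 1)) c).left_inv hz]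
    refine this.mono ?_
    rintro _ ⟨w, ⟨hw, -⟩, rfl⟩
    exact extChartAt_target_subset_range c ((extChartAt (𝓡∂ (n + 1)) c).map_source hw)
  rw [himg, lintegral_image_eq_lintegral_abs_det_fderiv_mul volume hmP hder hinj]
  refine setLIntegral_congr_fun hmP ?_
  rintro _ ⟨z, ⟨hz, hi, hzs⟩, rfl⟩
  simp only [Function.comp_apply, (extChartAt (𝓡∂ (n + 1)) c).left_inv hz,
    (extChartAt (𝓡∂ (n + 1)) d).left_inv (hd hzs)]
  rw [𝔹.gram_change hz (hd hzs), Matrix.det_mul, Matrix.det_mul, Matrix.det_transpose, det_jac,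
    ← ENNReal.ofReal_mul (abs_nonneg _), ← Real.sqrt_sq_eq_abs, ← Real.sqrt_mul (sq_nonneg _)]
  congr 2
  ring

theorem chartVolume_compl (𝔹 : ConicManifold n Y B) (c : B) :
    𝔹.chartVolume c ((extChartAt (𝓡∂ (n + 1)) c).source ∩ (𝓡∂ (n + 1)).interior B)ᶜ = 0 := by
  rw [chartVolume_apply 𝔹 c
    ((isOpen_extChartAt_source c).measurableSet.inter measurableSet_interior).compl]
  have : (extChartAt (𝓡∂ (n + 1)) c).source ∩ ((𝓡∂ (n + 1)).interior B ∩
      ((extChartAt (𝓡∂ (n + 1)) c).source ∩ (𝓡∂ (n + 1)).interior B)ᶜ) = ∅ := by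
    ext z
    simp only [mem_inter_iff, mem_compl_iff, mem_empty_iff_false, iff_false]
    tauto
  rw [this]
  simp

/-- In each chart, `dμ_g = √(det gᵢⱼ) dp`. -/
theorem restrict_vol (𝔹 : ConicManifold n Y B) (c : B) :
    𝔹.vol.restrict (extChartAt (𝓡∂ (n + 1)) c).source = 𝔹.chartVolume c := by
  set S := (extChartAt (𝓡∂ (n + 1)) c).source with hS
  have hSm : MeasurableSet S := (isOpen_extChartAt_source c).measurableSet
  have hself : (𝔹.chartVolume c).restrict S = 𝔹.chartVolume c := by
    refine Measure.restrict_eq_self_of_ae_mem ?_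
    refine measure_mono_null ?_ (𝔹.chartVolume_compl c)
    intro z hz hz'
    exact hz hz'.1
  refine le_antisymm ?_ ?_
  · have hle : 𝔹.vol ≤ 𝔹.chartVolume c + 𝔹.vol.restrict Sᶜ := by
      refine iSup_le fun d ↦ ?_
      rw [← Measure.restrict_add_restrict_compl (μ := 𝔹.chartVolume d) hSm]
      refine add_le_add ?_ (Measure.restrict_mono le_rfl (le_iSup 𝔹.chartVolume d))
      refine Measure.le_iff.2 fun s hs ↦ ?_
      rw [Measure.restrict_apply hs]
      set T := (extChartAt (𝓡∂ (n + 1)) d).source with hT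
      have hTm : MeasurableSet T := (isOpen_extChartAt_source d).measurableSet
      calc 𝔹.chartVolume d (s ∩ S)
          = 𝔹.chartVolume d (s ∩ S ∩ T) := by
            refine (measure_inter_conull ?_).symm
            refine measure_mono_null ?_ (𝔹.chartVolume_compl d)
            intro z hz hz'
            exact hz hz'.1
        _ = 𝔹.chartVolume c (s ∩ S ∩ T) :=
            𝔹.chartVolume_eq d c ((hs.inter hSm).inter hTm) inter_subset_right
              (inter_subset_left.trans inter_subset_right)
        _ ≤ 𝔹.chartVolume c s := measure_mono (inter_subset_left.trans inter_subset_left)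
    have := Measure.restrict_mono (le_refl S) hle
    rwa [Measure.restrict_add, hself, Measure.restrict_restrict hSm, inter_compl_self,
      Measure.restrict_empty, add_zero] at this
  · rw [← hself]
    exact Measure.restrict_mono le_rfl (le_iSup 𝔹.chartVolume c)

theorem vol_boundary (𝔹 : ConicManifold n Y B) : 𝔹.vol ((𝓡∂ (n + 1)).boundary B) = 0 := by
  have hm : MeasurableSet ((𝓡∂ (n + 1)).interior B) := measurableSet_interior
  have hle : 𝔹.vol ≤ 𝔹.vol.restrict ((𝓡∂ (n + 1)).interior B) := by
    refine iSup_le fun c ↦ ?_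
    have : (𝔹.chartVolume c).restrict ((𝓡∂ (n + 1)).interior B) = 𝔹.chartVolume c := by
      refine Measure.restrict_eq_self_of_ae_mem ?_
      refine measure_mono_null ?_ (𝔹.chartVolume_compl c)
      intro z hz hz'
      exact hz hz'.2
    rw [← this]
    exact Measure.restrict_mono le_rfl (le_iSup 𝔹.chartVolume c)
  rw [← ModelWithCorners.compl_interior]
  refine le_antisymm ((hle _).trans ?_) bot_le
  rw [Measure.restrict_apply hm.compl]
  simp

/-- The Riemannian measure is finite near every point of the interior. -/
theorem exists_vol_lt_top (𝔹 : ConicManifold n Y B) {c : B}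
    (hc : c ∈ (𝓡∂ (n + 1)).interior B) : ∃ U ∈ 𝓝 c, 𝔹.vol U < ⊤ := by
  have hcs : c ∈ (extChartAt (𝓡∂ (n + 1)) c).source := mem_extChartAt_source c
  have hopen : IsOpen ((𝓡∂ (n + 1)).interior B) :=
    ModelWithCorners.isOpen_interior (n := ∞) (by simp)
  have hO : IsOpen ((extChartAt (𝓡∂ (n + 1)) c).source ∩ (𝓡∂ (n + 1)).interior B) :=
    (isOpen_extChartAt_source c).inter hopen
  have hdet : ContinuousAt (fun z ↦ √(𝔹.gram c z).det) c :=
    ((Continuous.matrix_det (A := fun M : Matrix (Fin (n + 1)) (Fin (n + 1)) ℝ ↦ M)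
      continuous_id).sqrt.comp_continuousOn (𝔹.continuousOn_gram c)).continuousAt
      (hO.mem_nhds ⟨hcs, hc⟩)
  have h1 : ∀ᶠ z in 𝓝 c, √(𝔹.gram c z).det < √(𝔹.gram c c).det + 1 :=
    hdet.eventually_lt continuousAt_const (by linarith)
  have h2 : ∀ᶠ z in 𝓝 c, extChartAt (𝓡∂ (n + 1)) c z ∈
      Metric.ball (extChartAt (𝓡∂ (n + 1)) c c) 1 :=
    (continuousAt_extChartAt c).eventually (Metric.ball_mem_nhds _ one_pos)
  obtain ⟨U, hU, hUo, hcU⟩ := eventually_nhds_iff.1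
    ((h1.and h2).and (hO.mem_nhds ⟨hcs, hc⟩))
  refine ⟨U, hUo.mem_nhds hcU, ?_⟩
  have hsub : U ⊆ (extChartAt (𝓡∂ (n + 1)) c).source := fun z hz ↦ (hU z hz).2.1
  rw [← Measure.restrict_eq_self 𝔹.vol hsub, restrict_vol, chartVolume_apply 𝔹 c hUo.measurableSet]
  calc _ ≤ ∫⁻ p in extChartAt (𝓡∂ (n + 1)) c ''
        ((extChartAt (𝓡∂ (n + 1)) c).source ∩ ((𝓡∂ (n + 1)).interior B ∩ U)),
        ENNReal.ofReal (√(𝔹.gram c c).det + 1) := by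
        refine setLIntegral_mono' (measurableSet_chart_image c
          (measurableSet_interior.inter hUo.measurableSet)) ?_
        rintro _ ⟨z, ⟨hz, hi, hzU⟩, rfl⟩
        rw [(extChartAt (𝓡∂ (n + 1)) c).left_inv hz]
        exact ENNReal.ofReal_le_ofReal (hU z hzU).1.1.le
    _ < ⊤ := by
        rw [setLIntegral_const]
        refine ENNReal.mul_lt_top ENNReal.ofReal_lt_top ?_
        refine (measure_mono ?_).trans_lt
          (measure_ball_lt_top (x := extChartAt (𝓡∂ (n + 1)) c c) (r := 1))
        rintro _ ⟨z, ⟨hz, hi, hzU⟩, rfl⟩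
        exact (hU z hzU).1.2

end Measure

/-! ### The space `H¹(𝔹)` -/

/-- The space `C_c^∞` of complex-valued smooth functions with compact support contained in
the interior of `B`. -/
def testSubmodule (_𝔹 : ConicManifold n Y B) : Submodule ℂ (B → ℂ) where
  carrier := {u | ContMDiff (𝓡∂ (n + 1)) 𝓘(ℝ, ℂ) ∞ u ∧
    HasCompactSupport u ∧ tsupport u ⊆ (𝓡∂ (n + 1)).interior B}
  add_mem' := by
    rintro u v ⟨hu, hu', hu''⟩ ⟨hv, hv', hv''⟩
    exact ⟨hu.add hv, hu'.add hv', (tsupport_add u v).trans (union_subset hu'' hv'')⟩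
  zero_mem' := ⟨contMDiff_const, HasCompactSupport.zero, by simp [tsupport]⟩
  smul_mem' := by
    rintro a u ⟨hu, hu', hu''⟩
    exact ⟨((contDiff_const_smul (𝕜 := ℝ) a).contMDiff (n := ∞)).comp hu,
      hu'.smul_left (f := fun _ ↦ a), (tsupport_smul_subset_right (fun _ ↦ a) u).trans hu''⟩

/-- The type of the elements of `C_c^∞`, without any topology at first. -/
def TestFunction (𝔹 : ConicManifold n Y B) : Type _ := 𝔹.testSubmodule

noncomputable instance (𝔹 : ConicManifold n Y B) : AddCommGroup 𝔹.TestFunction :=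
  inferInstanceAs (AddCommGroup 𝔹.testSubmodule)

noncomputable instance (𝔹 : ConicManifold n Y B) : Module ℂ 𝔹.TestFunction :=
  inferInstanceAs (Module ℂ 𝔹.testSubmodule)

theorem partialDeriv_eq_zero {u : B → ℂ} {c z : B} (hz : z ∉ tsupport u) (i : Fin (n + 1)) :
    partialDeriv u c z i = 0 := by
  have h : u =ᶠ[𝓝 z] fun _ ↦ 0 := notMem_tsupport_iff_eventuallyEq.1 hz
  unfold partialDeriv
  rw [h.mfderiv_eq, mfderiv_const]
  rfl

theorem partialDeriv_add {u v : B → ℂ} (hu : ContMDiff (𝓡∂ (n + 1)) 𝓘(ℝ, ℂ) ∞ u)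
    (hv : ContMDiff (𝓡∂ (n + 1)) 𝓘(ℝ, ℂ) ∞ v) (c z : B) (i : Fin (n + 1)) :
    partialDeriv (u + v) c z i = partialDeriv u c z i + partialDeriv v c z i := by
  unfold partialDeriv
  rw [mfderiv_add (hu.mdifferentiable (by simp) z) (hv.mdifferentiable (by simp) z)]
  rfl

theorem partialDeriv_smul {u : B → ℂ} (hu : ContMDiff (𝓡∂ (n + 1)) 𝓘(ℝ, ℂ) ∞ u)
    (a : ℂ) (c z : B) (i : Fin (n + 1)) :
    partialDeriv (a • u) c z i = a * partialDeriv u c z i := by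
  have h1 : HasMFDerivAt 𝓘(ℝ, ℂ) 𝓘(ℝ, ℂ) (fun w : ℂ ↦ a • w) (u z)
      (a • ContinuousLinearMap.id ℝ ℂ : ℂ →L[ℝ] ℂ) :=
    ((a • ContinuousLinearMap.id ℝ ℂ : ℂ →L[ℝ] ℂ).hasFDerivAt (x := u z)).hasMFDerivAt
  have h2 := h1.comp z (hu.mdifferentiable (by simp) z).hasMFDerivAt
  unfold partialDeriv
  rw [show a • u = (fun w : ℂ ↦ a • w) ∘ u from rfl, h2.mfderiv]
  rfl

theorem continuous_gradInner (𝔹 : ConicManifold n Y B) (u v : 𝔹.TestFunction) :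
    Continuous (𝔹.gradInner u.1 v.1) := by
  refine continuous_iff_continuousAt.2 fun z ↦ ?_
  by_cases hz : z ∈ tsupport u.1
  · exact (𝔹.continuousOn_gradInner u.2.1 v.2.1).continuousAt
      ((ModelWithCorners.isOpen_interior (n := ∞) (by simp)).mem_nhds (u.2.2.2 hz))
  · have h : 𝔹.gradInner u.1 v.1 =ᶠ[𝓝 z] fun _ ↦ 0 := by
      filter_upwards [(isClosed_tsupport u.1).isOpen_compl.mem_nhds hz] with w hw
      simp [gradInner, partialDeriv_eq_zero hw]
    exact (continuousAt_const.congr h.symm)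

theorem gradInner_symm (𝔹 : ConicManifold n Y B) (u v : 𝔹.TestFunction) (z : B) :
    (starRingEnd ℂ) (𝔹.gradInner u.1 v.1 z) = 𝔹.gradInner v.1 u.1 z := by
  by_cases hz : z ∈ tsupport u.1
  · have hs : ∀ i j, (𝔹.gram z z)⁻¹ i j = (𝔹.gram z z)⁻¹ j i := fun i j ↦ by
      simpa using congrFun (congrFun (𝔹.posDef_gram_self (u.2.2.2 hz)).isHermitian.inv j) i
    simp only [gradInner, map_sum, map_mul, Complex.conj_ofReal, Complex.conj_conj]
    rw [Finset.sum_comm]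
    refine Finset.sum_congr rfl fun i _ ↦ Finset.sum_congr rfl fun j _ ↦ ?_
    rw [hs j i]
    ring
  · simp [gradInner, partialDeriv_eq_zero hz]

theorem gradInner_self_nonneg (𝔹 : ConicManifold n Y B) (u : 𝔹.TestFunction) (z : B) :
    0 ≤ (𝔹.gradInner u.1 u.1 z).re := by
  by_cases hz : z ∈ tsupport u.1
  · have hp := (𝔹.posDef_gram_self (u.2.2.2 hz)).inv.posSemidef
    have h1 := hp.dotProduct_mulVec_nonneg (fun i ↦ (partialDeriv u.1 z z i).re)
    have h2 := hp.dotProduct_mulVec_nonneg (fun i ↦ (partialDeriv u.1 z z i).im)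
    refine (add_nonneg h1 h2).trans_eq ?_
    simp only [gradInner, dotProduct, Matrix.mulVec, Finset.mul_sum, star_trivial,
      Complex.re_sum, ← Finset.sum_add_distrib]
    refine Finset.sum_congr rfl fun i _ ↦ Finset.sum_congr rfl fun j _ ↦ ?_
    simp
    ring
  · simp [gradInner, partialDeriv_eq_zero hz]

section

variable [MeasurableSpace B] [BorelSpace B]

theorem integrable_of_continuous (𝔹 : ConicManifold n Y B) (u : 𝔹.TestFunction) {f : B → ℂ}
    (hf : Continuous f) (h0 : ∀ z ∉ tsupport u.1, f z = 0) : Integrable f 𝔹.vol := by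
  have hK : IsCompact (tsupport u.1) := u.2.2.1
  have hfin : 𝔹.vol (tsupport u.1) < ⊤ :=
    hK.measure_lt_top_of_nhdsWithin fun z hz ↦ by
      obtain ⟨U, hU, hlt⟩ := 𝔹.exists_vol_lt_top (u.2.2.2 hz)
      exact ⟨U, mem_nhdsWithin_of_mem_nhds hU, hlt⟩
  obtain ⟨C, hC⟩ := hK.exists_bound_of_continuousOn hf.continuousOn
  have h1 : IntegrableOn f (tsupport u.1) 𝔹.vol :=
    Measure.integrableOn_of_bounded hfin.ne hf.aestronglyMeasurable
      ((ae_restrict_iff' (isClosed_tsupport u.1).measurableSet).2 (ae_of_all _ hC))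
  exact h1.integrable_of_forall_notMem_eq_zero h0

theorem integrable_mul (𝔹 : ConicManifold n Y B) (u v : 𝔹.TestFunction) :
    Integrable (fun z ↦ u.1 z * (starRingEnd ℂ) (v.1 z)) 𝔹.vol :=
  𝔹.integrable_of_continuous u
    (u.2.1.continuous.mul (Complex.continuous_conj.comp v.2.1.continuous))
    fun z hz ↦ by simp [image_eq_zero_of_notMem_tsupport hz]

theorem integrable_gradInner (𝔹 : ConicManifold n Y B) (u v : 𝔹.TestFunction) :
    Integrable (𝔹.gradInner u.1 v.1) 𝔹.vol :=
  𝔹.integrable_of_continuous u (𝔹.continuous_gradInner u v)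
    fun z hz ↦ by simp [gradInner, partialDeriv_eq_zero hz]

/-- The (semi-)inner product `(u, v) = ∫ u \overline{v} dμ_g + ∫ ⟨∇u, \overline{∇v}⟩ dμ_g`
on `C_c^∞`. By the convention of the library an inner product is linear in its second argument,
so that `inner u v` is `(v, u)`. -/
@[reducible] noncomputable def innerCore (𝔹 : ConicManifold n Y B) :
    PreInnerProductSpace.Core ℂ 𝔹.TestFunction where
  inner u v := ∫ z, v.1 z * (starRingEnd ℂ) (u.1 z) ∂𝔹.vol + ∫ z, 𝔹.gradInner v.1 u.1 z ∂𝔹.vol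
  conj_inner_symm u v := by
    rw [map_add, ← integral_conj, ← integral_conj]
    congr 1
    · simp only [map_mul, Complex.conj_conj, mul_comm]
    · simp only [gradInner_symm]
  re_inner_nonneg u := by
    rw [map_add]
    refine add_nonneg ?_ ?_
    · rw [← integral_re (𝔹.integrable_mul u u)]
      refine integral_nonneg fun z ↦ ?_
      simp only [Complex.mul_conj]
      simpa using Complex.normSq_nonneg _
    · rw [← integral_re (𝔹.integrable_gradInner u u)]
      exact integral_nonneg fun z ↦ 𝔹.gradInner_self_nonneg u z
  add_left u v w := by
    have h1 : ∀ z, w.1 z * (starRingEnd ℂ) ((u + v).1 z) =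
        w.1 z * (starRingEnd ℂ) (u.1 z) + w.1 z * (starRingEnd ℂ) (v.1 z) := fun z ↦ by
      change w.1 z * (starRingEnd ℂ) (u.1 z + v.1 z) = _
      rw [map_add, mul_add]
    have h2 : ∀ z, 𝔹.gradInner w.1 (u + v).1 z =
        𝔹.gradInner w.1 u.1 z + 𝔹.gradInner w.1 v.1 z := fun z ↦ by
      change 𝔹.gradInner w.1 (u.1 + v.1) z = _
      simp only [gradInner, partialDeriv_add u.2.1 v.2.1, map_add, mul_add,
        Finset.sum_add_distrib]
    simp only [h1, h2]
    rw [integral_add (𝔹.integrable_mul w u) (𝔹.integrable_mul w v),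
      integral_add (𝔹.integrable_gradInner w u) (𝔹.integrable_gradInner w v)]
    ring
  smul_left u v a := by
    have h1 : ∀ z, v.1 z * (starRingEnd ℂ) ((a • u).1 z) =
        (starRingEnd ℂ) a * (v.1 z * (starRingEnd ℂ) (u.1 z)) := fun z ↦ by
      change v.1 z * (starRingEnd ℂ) (a * u.1 z) = _
      rw [map_mul]
      ring
    have h2 : ∀ z, 𝔹.gradInner v.1 (a • u).1 z =
        (starRingEnd ℂ) a * 𝔹.gradInner v.1 u.1 z := fun z ↦ by
      change 𝔹.gradInner v.1 (a • u.1) z = _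
      simp only [gradInner, partialDeriv_smul u.2.1, map_mul, Finset.mul_sum]
      refine Finset.sum_congr rfl fun i _ ↦ Finset.sum_congr rfl fun j _ ↦ ?_
      ring
    simp only [h1, h2]
    rw [integral_const_mul, integral_const_mul]
    ring

noncomputable instance (𝔹 : ConicManifold n Y B) : SeminormedAddCommGroup 𝔹.TestFunction :=
  InnerProductSpace.Core.toSeminormedAddCommGroup (c := 𝔹.innerCore)

noncomputable instance (𝔹 : ConicManifold n Y B) : InnerProductSpace ℂ 𝔹.TestFunction :=
  InnerProductSpace.ofCore 𝔹.innerCore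

/-- The Hilbert space `H¹(𝔹)`, the completion of `C_c^∞` with respect to the inner product
`∫ u \overline{v} dμ_g + ∫ ⟨∇u, \overline{∇v}⟩ dμ_g`. -/
abbrev H1 (𝔹 : ConicManifold n Y B) : Type _ := UniformSpace.Completion 𝔹.TestFunction

/-- The measure `|x^{-a}|^p dμ_g`: the weighted space `x^a L^p(𝔹)` of all `u` with
`∫ |x^{-a} u|^p dμ_g < ∞` is `L^p` of this measure. -/
noncomputable def weightedVol (𝔹 : ConicManifold n Y B) (x : B → ℝ) (a p : ℝ) : Measure B :=
  𝔹.vol.withDensity fun z ↦ ENNReal.ofReal ((x z ^ (-a)) ^ p)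

/-- A function `x : B → [0, 1]` that is smooth and positive on the interior and equal to the
collar coordinate in a neighbourhood `[0, δ) × Y` of the boundary. -/
structure IsBoundaryFunction (𝔹 : ConicManifold n Y B) (x : B → ℝ) : Prop where
  mem_Icc : ∀ z, x z ∈ Icc (0 : ℝ) 1
  contMDiffOn : ContMDiffOn (𝓡∂ (n + 1)) 𝓘(ℝ, ℝ) ∞ x ((𝓡∂ (n + 1)).interior B)
  pos : ∀ z ∈ (𝓡∂ (n + 1)).interior B, 0 < x z
  eq_collar : ∃ δ ∈ Ioc (0 : ℝ) 1, ∀ t ∈ Ico 0 δ, ∀ y, x (𝔹.collar (t, y)) = t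

instance : Fact ((1 : ℝ≥0∞) ≤ 4) := ⟨by norm_num⟩

instance : Fact ((1 : ℝ≥0∞) ≤ 6) := ⟨by norm_num⟩

/-- `H¹(𝔹) ↪ L^p(μ)`, a continuous inclusion: there is an injective continuous linear map from
`H¹(𝔹)` to `L^p(μ)` that sends every test function to (the class of) itself. -/
def H1EmbedsIn (𝔹 : ConicManifold n Y B) (p : ℝ≥0∞) [Fact (1 ≤ p)] (μ : Measure B) : Prop :=
  ∃ ι : 𝔹.H1 →L[ℂ] Lp ℂ p μ, Function.Injective ι ∧
    ∀ u : 𝔹.TestFunction, ι (u : 𝔹.H1) =ᵐ[μ] u.1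

end

end ConicManifold

set_option linter.unusedSectionVars false

/-! ### Inequalities on Euclidean space -/

section Euclidean

variable {E : Type*} [NormedAddCommGroup E] [NormedSpace ℝ E] [FiniteDimensional ℝ E]
  [MeasurableSpace E] [BorelSpace E] (μ : Measure E) [μ.IsAddHaarMeasure]

/-! The substitution `x = exp (-t)` turns the cone into a cylinder: `dx² + x² h = exp (-2t) (dt² +
h)`, and `h` is uniformly positive definite up to `x = 0`. So near a boundary point, and trivially
near an interior point, the metric is comparable to `exp (-2t)` times a Euclidean metric (`Patch`,
`exists_collar_patch`, `exists_interior_patch`). In such coordinates the volume density is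
comparable to `exp (-(n+1)t)`, and the `H¹` norm controls the Euclidean `L²` norms of `exp
(-(n+1)t/2) u` and `exp (-(n-1)t/2) ∂u`.

The `L⁶(𝔹)` norm of `u` is comparable to the Euclidean `L⁶` norm of `exp (-βt) u` with `β =
(n+1)/6`. By the Euclidean Sobolev inequality (`exists_eLpNorm_six_le`) it is enough to bound `exp
(-βt) χ u` and its derivative in `L²`, where `χ` is a cutoff. Since `t` is bounded below, the term
`exp (-βt) ∂u` is controlled as soon as `β ≥ (n-1)/2`, which means `n ≤ 2`. The term `exp (-βt) u`
is not controlled by the `L²` part of the norm, because `β < (n+1)/2`. Hardy's inequality `β ‖exp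
(-βt) F‖ ≤ ‖exp (-βt) ∂ₜF‖` (`hardy_inequality_exp`), valid as `β > 0`, reduces it to the
derivative. This is the local estimate `Patch.IsCutoff.exists_eLpNorm_six_le`.

Compactness of `B` then gives the unweighted `L⁶` bound in dimensions two and three. The `L⁴` bound
follows by interpolation with `L²`. The weighted statement follows because the weight is at most
one; the unweighted bound is stronger.

The bounds on test functions extend to the completion, but injectivity of the extension needs the
gradient to be closable. A Cauchy sequence in `H¹` whose image tends to zero tends to zero almost
everywhere along a subsequence, hence in `L²` by Fatou. Integration by parts makes the gradients
tend to zero in `L²` on compact subsets of the interior, and the Cauchy property handles the rest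
(`tendsto_zero_of_tendsto_eLpNorm_two`). -/

theorem memLp_two_iff_sq {F : Type*} [NormedAddCommGroup F] {f : E → F} (hf : MemLp f 2 μ) :
    eLpNorm f 2 μ ^ 2 = ENNReal.ofReal (∫ x, ‖f x‖ ^ 2 ∂μ) := by
  rw [hf.eLpNorm_eq_integral_rpow_norm (by norm_num) (by norm_num),
    ← ENNReal.ofReal_pow (by positivity)]
  congr 1
  simp only [ENNReal.toReal_ofNat, Real.rpow_ofNat]
  rw [← Real.rpow_natCast, ← Real.rpow_mul (by positivity)]
  norm_num

theorem hasCompactSupport_fderiv_apply {v : E → ℂ} (hc : HasCompactSupport v) (e : E) :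
    HasCompactSupport fun p ↦ fderiv ℝ v p e :=
  (hc.fderiv ℝ).comp_left (g := fun L : E →L[ℝ] ℂ ↦ L e) rfl

theorem continuous_fderiv_apply_const {v : E → ℂ} (hv : ContDiff ℝ 1 v) (e : E) :
    Continuous fun p ↦ fderiv ℝ v p e :=
  (hv.continuous_fderiv one_ne_zero).clm_apply continuous_const

/-- Hardy's inequality in exponential coordinates. -/
theorem hardy_inequality {v : E → ℂ} (hv : ContDiff ℝ 1 v) (hc : HasCompactSupport v) (e : E)
    {β : ℝ} (hβ : 0 ≤ β) :
    ENNReal.ofReal β * eLpNorm v 2 μ ≤ eLpNorm (fun p ↦ fderiv ℝ v p e + β * v p) 2 μ := by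
  have hcd := hasCompactSupport_fderiv_apply hc e
  have hd := continuous_fderiv_apply_const hv e
  have hB : ∀ p, ‖fderiv ℝ v p e + β * v p‖ ^ 2 =
      ‖fderiv ℝ v p e‖ ^ 2 + 2 * β * inner ℝ (v p) (fderiv ℝ v p e) + β ^ 2 * ‖v p‖ ^ 2 := by
    intro p
    rw [← Complex.real_smul, norm_add_sq_real, norm_smul, inner_smul_right, real_inner_comm,
      mul_pow, Real.norm_eq_abs, sq_abs]
    ring
  have hs : MemLp (fun p ↦ fderiv ℝ v p e + β * v p) 2 μ :=
    (hd.add (continuous_const.mul hv.continuous)).memLp_of_hasCompactSupport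
      (hcd.add (hc.mul_left (f := fun _ ↦ (β : ℂ))))
  have hvm : MemLp v 2 μ := hv.continuous.memLp_of_hasCompactSupport hc
  have hdm : MemLp (fun p ↦ fderiv ℝ v p e) 2 μ := hd.memLp_of_hasCompactSupport hcd
  have hint : Integrable (fun p ↦ inner ℝ (v p) (fderiv ℝ v p e)) μ := by
    refine (hv.continuous.inner hd).integrable_of_hasCompactSupport ?_
    exact hc.mono fun p hp h ↦ hp (by simp [h])
  -- The cross term is half the derivative of `|v|²` along `e`; integration by parts shows that its
  -- integral equals its own negative.
  have hzero : ∫ p, inner ℝ (v p) (fderiv ℝ v p e) ∂μ = 0 := by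
    have h2 : ∀ p, inner ℝ (fderiv ℝ v p e) (v p) = inner ℝ (v p) (fderiv ℝ v p e) :=
      fun p ↦ real_inner_comm _ _
    have h : ∫ p, inner ℝ (v p) (fderiv ℝ v p e) ∂μ = -∫ p, inner ℝ (fderiv ℝ v p e) (v p) ∂μ :=
      integral_bilinear_fderiv_right_eq_neg_left_of_integrable (μ := μ) (f := v) (g := v)
        (v := e) (B := innerSL ℝ) (hint.congr (ae_of_all _ fun p ↦ (h2 p).symm)) hint
        ((hv.continuous.inner hv.continuous).integrable_of_hasCompactSupport
          (hc.mono fun p hp h ↦ hp (by simp [h])))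
        (fun x _ ↦ hv.differentiable one_ne_zero x) (fun x _ ↦ hv.differentiable one_ne_zero x)
    simp only [h2] at h
    linarith
  rw [← ENNReal.pow_le_pow_left_iff (n := 2) two_ne_zero, mul_pow,
    memLp_two_iff_sq μ hs, memLp_two_iff_sq μ hvm,
    ← ENNReal.ofReal_pow hβ, ← ENNReal.ofReal_mul (by positivity)]
  refine ENNReal.ofReal_le_ofReal ?_
  have i1 := hdm.integrable_norm_pow (p := 2) two_ne_zero
  have i2 := hvm.integrable_norm_pow (p := 2) two_ne_zero
  have hsum : ∫ p, ‖fderiv ℝ v p e + β * v p‖ ^ 2 ∂μ =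
      ∫ p, ‖fderiv ℝ v p e‖ ^ 2 ∂μ + β ^ 2 * ∫ p, ‖v p‖ ^ 2 ∂μ := by
    simp only [hB]
    rw [integral_add (f := fun p ↦ ‖fderiv ℝ v p e‖ ^ 2 + 2 * β * inner ℝ (v p) (fderiv ℝ v p e))
        (i1.add (hint.const_mul _)) (i2.const_mul _),
      integral_add i1 (hint.const_mul _), integral_const_mul, integral_const_mul, hzero]
    ring
  rw [hsum]
  have : 0 ≤ ∫ p, ‖fderiv ℝ v p e‖ ^ 2 ∂μ := by positivity
  linarith

theorem eLpNorm_pow_natCast {X : Type*} [MeasurableSpace X] (ν : Measure X) {v : X → ℂ} (k : ℕ)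
    (hk : k ≠ 0) (p : ℝ≥0∞) (q : ℝ≥0∞) (hq : q = p * k) :
    eLpNorm (fun x ↦ v x ^ k) p ν = eLpNorm v q ν ^ k := by
  have h := eLpNorm_norm_rpow (μ := ν) (p := p) v (q := k) (by positivity)
  rw [← eLpNorm_norm]
  simp only [norm_pow]
  simp only [Real.rpow_natCast, ENNReal.rpow_natCast, ENNReal.ofReal_natCast] at h
  rw [h, hq]

/-- The Sobolev conjugate of `2` in dimension three is `6`, since `1/6 = 1/2 - 1/3`, so the
derivative alone suffices. -/
theorem exists_eLpNorm_six_le_of_finrank_three (h3 : Module.finrank ℝ E = 3) :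
    ∃ C : NNReal, ∀ v : E → ℂ, ContDiff ℝ 1 v → HasCompactSupport v →
      eLpNorm v 6 μ ≤ C * eLpNorm (fderiv ℝ v) 2 μ := by
  refine ⟨SNormLESNormFDerivOfEqConst ℂ μ 2, fun v hv hc ↦ ?_⟩
  have := eLpNorm_le_eLpNorm_fderiv_of_eq μ (p := 2) (p' := 6) hv hc (by norm_num) (by omega)
    (by rw [h3]; norm_num)
  simpa using this

/-- The exponent `2` is critical in dimension two and has no finite Sobolev conjugate. Instead the
inequality for exponent `1`, whose conjugate is `2`, is applied to the power `v ^ (k + 1)`. Its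
derivative is `(k + 1) v ^ k ∂v`, to which Cauchy–Schwarz applies. Iteration over `k` raises the
exponent by two each time. -/
theorem exists_eLpNorm_pow_le_of_finrank_two (h2 : Module.finrank ℝ E = 2) :
    ∃ C : NNReal, ∀ v : E → ℂ, ContDiff ℝ 1 v → HasCompactSupport v → ∀ k : ℕ, k ≠ 0 →
      eLpNorm v (2 * (k + 1)) μ ^ (k + 1) ≤
        C * (k + 1) * (eLpNorm v (2 * k) μ ^ k * eLpNorm (fderiv ℝ v) 2 μ) := by
  refine ⟨eLpNormLESNormFDerivOneConst μ 2, fun v hv hc k hk ↦ ?_⟩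
  have := eLpNorm_le_eLpNorm_fderiv_one μ (u := fun x ↦ v x ^ (k + 1)) (hv.pow _)
    (hc.comp_left (g := fun z : ℂ ↦ z ^ (k + 1)) (by simp)) (p := 2)
    (by rw [h2]; exact NNReal.HolderConjugate.two_two)
  rw [← eLpNorm_pow_natCast μ (v := v) (k + 1) (by simp) 2 _ (by push_cast; rfl)]
  refine this.trans ?_
  rw [mul_assoc]
  refine mul_le_mul_right ?_ _
  have h := eLpNorm_le_eLpNorm_mul_eLpNorm'_of_norm (μ := μ) (p := 2) (q := 2) (r := 1)
    (f := fun x ↦ v x ^ k) (g := fderiv ℝ v) (hv.continuous.pow k).aestronglyMeasurable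
    (hv.continuous_fderiv one_ne_zero).aestronglyMeasurable
    (fun z L ↦ ((k + 1 : ℂ) * z) • L) (k + 1) (ae_of_all _ fun x ↦ by
      rw [norm_smul, norm_mul]
      norm_cast)
  rw [eLpNorm_pow_natCast μ k hk 2 _ rfl] at h
  refine (eLpNorm_congr_ae (ae_of_all _ fun x ↦ ?_)).trans_le (h.trans_eq ?_)
  · rw [fderiv_fun_pow _ (hv.differentiable one_ne_zero x)]
    ext w
    simp
  · push_cast
    ring

/-- The Sobolev inequality `H¹ ⊆ L⁶` in dimensions two and three. -/
theorem exists_eLpNorm_six_le (h : Module.finrank ℝ E = 2 ∨ Module.finrank ℝ E = 3) :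
    ∃ C : NNReal, ∀ v : E → ℂ, ContDiff ℝ 1 v → HasCompactSupport v →
      eLpNorm v 6 μ ≤ C * (eLpNorm v 2 μ + eLpNorm (fderiv ℝ v) 2 μ) := by
  rcases h with h | h
  · obtain ⟨C, hC⟩ := exists_eLpNorm_pow_le_of_finrank_two μ h
    refine ⟨6 * C + 1, fun v hv hc ↦ ?_⟩
    have h1 := hC v hv hc 1 one_ne_zero
    have h2 := hC v hv hc 2 two_ne_zero
    norm_num at h1 h2
    set a := eLpNorm v 2 μ
    set d := eLpNorm (fderiv ℝ v) 2 μ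
    rw [← ENNReal.pow_le_pow_left_iff (n := 3) three_ne_zero]
    -- One constant that dominates `2C` and `3C` and is at least one: the two steps of the iteration
    -- produce only two factors, and the third is inserted to complete the cube.
    set K : ℝ≥0∞ := ((6 * C + 1 : NNReal) : ℝ≥0∞)
    have ha : a ≤ a + d := le_self_add
    have hd : d ≤ a + d := le_add_self
    have hK : ∀ r : NNReal, r ≤ 6 → (C : ℝ≥0∞) * r ≤ K := fun r hr ↦ by
      refine ENNReal.coe_le_coe.2 ?_
      calc C * r ≤ C * 6 := by gcongr
        _ ≤ 6 * C + 1 := by rw [mul_comm]; exact le_self_add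
    have hK1 : 1 ≤ K := by
      refine ENNReal.coe_le_coe.2 le_add_self
    have hK2 := hK 2 (by norm_num)
    have hK3 := hK 3 (by norm_num)
    push_cast at hK2 hK3
    calc eLpNorm v 6 μ ^ 3 ≤ C * 3 * (eLpNorm v 4 μ ^ 2 * d) := h2
      _ ≤ C * 3 * (C * 2 * (a * d) * d) := by gcongr
      _ ≤ K * (K * ((a + d) * (a + d)) * (a + d)) := by gcongr
      _ = 1 * (K * K * (a + d) ^ 3) := by ring
      _ ≤ K * (K * K * (a + d) ^ 3) := by gcongr
      _ = (K * (a + d)) ^ 3 := by ring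
  · obtain ⟨C, hC⟩ := exists_eLpNorm_six_le_of_finrank_three μ h
    exact ⟨C, fun v hv hc ↦ (hC v hv hc).trans (by gcongr; exact le_add_self)⟩

/-- In `‖D k‖² = ⟨D k - D N, D k⟩ + ⟨D N, D k⟩` the first term is small by the Cauchy property and
the second by weak convergence against the fixed vector `D N`. No completeness is needed. -/
theorem tendsto_zero_of_cauchy_of_inner {H : Type*} [NormedAddCommGroup H]
    [InnerProductSpace ℝ H] (D : ℕ → H)
    (hC : ∀ ε : ℝ, 0 < ε → ∃ N, ∀ k ≥ N, ∀ m ≥ N, ‖D k - D m‖ ≤ ε)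
    (hw : ∀ m, Tendsto (fun k ↦ inner ℝ (D m) (D k)) atTop (𝓝 0)) :
    Tendsto D atTop (𝓝 0) := by
  rw [tendsto_zero_iff_norm_tendsto_zero, Metric.tendsto_atTop]
  intro ε hε
  obtain ⟨N, hN⟩ := hC (ε / 2) (by positivity)
  obtain ⟨K, hK⟩ := Metric.tendsto_atTop.1 (hw N) (ε ^ 2 / 2) (by positivity)
  refine ⟨max N K, fun k hk ↦ ?_⟩
  have h1 := hN k (le_of_max_le_left hk) N le_rfl
  have h2 := hK k (le_of_max_le_right hk)
  rw [Real.dist_eq, sub_zero] at h2 ⊢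
  rw [abs_norm]
  have h3 : ‖D k‖ ^ 2 = inner ℝ (D k - D N) (D k) + inner ℝ (D N) (D k) := by
    rw [← inner_add_left, sub_add_cancel, real_inner_self_eq_norm_sq]
  have h4 := real_inner_le_norm (D k - D N) (D k)
  have h5 := le_abs_self (inner ℝ (D N) (D k))
  have h6 : ‖D k - D N‖ * ‖D k‖ ≤ ε / 2 * ‖D k‖ := by gcongr
  by_contra! h7
  nlinarith

/-- Derivatives are closable in `L²`. -/
theorem tendsto_eLpNorm_fderiv_apply {v : ℕ → E → ℂ} (hv : ∀ k, ContDiff ℝ ∞ (v k))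
    (hc : ∀ k, HasCompactSupport (v k)) (e : E)
    (h0 : Tendsto (fun k ↦ eLpNorm (v k) 2 μ) atTop (𝓝 0))
    (hC : ∀ ε : ℝ, 0 < ε → ∃ N, ∀ k ≥ N, ∀ m ≥ N,
      eLpNorm (fun p ↦ fderiv ℝ (v k) p e - fderiv ℝ (v m) p e) 2 μ ≤ ENNReal.ofReal ε) :
    Tendsto (fun k ↦ eLpNorm (fun p ↦ fderiv ℝ (v k) p e) 2 μ) atTop (𝓝 0) := by
  have h1 : ∀ k, ContDiff ℝ 1 (v k) := fun k ↦ (hv k).of_le (by simp)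
  have hD : ∀ k, MemLp (fun p ↦ fderiv ℝ (v k) p e) 2 μ := fun k ↦
    (continuous_fderiv_apply_const (h1 k) e).memLp_of_hasCompactSupport
      (hasCompactSupport_fderiv_apply (hc k) e)
  have hV : ∀ k, MemLp (v k) 2 μ := fun k ↦
    (hv k).continuous.memLp_of_hasCompactSupport (hc k)
  have hDs : ∀ k, ContDiff ℝ 1 (fun p ↦ fderiv ℝ (v k) p e) := fun k ↦
    ((hv k).fderiv_right (m := 1) (by norm_cast)).clm_apply contDiff_const
  have hDc : ∀ k, HasCompactSupport (fun p ↦ fderiv ℝ (v k) p e) := fun k ↦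
    hasCompactSupport_fderiv_apply (hc k) e
  have hDD : ∀ k, MemLp (fun p ↦ fderiv ℝ (fun q ↦ fderiv ℝ (v k) q e) p e) 2 μ := fun k ↦
    (continuous_fderiv_apply_const (hDs k) e).memLp_of_hasCompactSupport
      (hasCompactSupport_fderiv_apply (hDc k) e)
  -- Integration by parts moves a derivative from `v k` to the smooth function `v m`. For fixed `m`
  -- the pairing then tends to zero with `v k`, which is the weak convergence needed below.
  have hparts : ∀ k m, inner ℝ ((hD m).toLp _) ((hD k).toLp _) =
      -inner ℝ ((hDD m).toLp _) ((hV k).toLp _) := by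
    intro k m
    rw [L2.inner_def, L2.inner_def]
    have e1 : ∫ x, inner ℝ ((hD m).toLp _ x) ((hD k).toLp _ x) ∂μ =
        ∫ x, inner ℝ (fderiv ℝ (v m) x e) (fderiv ℝ (v k) x e) ∂μ := by
      refine integral_congr_ae ?_
      filter_upwards [(hD m).coeFn_toLp, (hD k).coeFn_toLp] with x hx hx'
      rw [hx, hx']
    have e2 : ∫ x, inner ℝ ((hDD m).toLp _ x) ((hV k).toLp _ x) ∂μ =
        ∫ x, inner ℝ (fderiv ℝ (fun q ↦ fderiv ℝ (v m) q e) x e) (v k x) ∂μ := by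
      refine integral_congr_ae ?_
      filter_upwards [(hDD m).coeFn_toLp, (hV k).coeFn_toLp] with x hx hx'
      rw [hx, hx']
    rw [e1, e2]
    have hi : ∀ {f g : E → ℂ}, Continuous f → Continuous g → HasCompactSupport f →
        Integrable (fun x ↦ inner ℝ (f x) (g x)) μ := fun hf hg hfc ↦
      (hf.inner hg).integrable_of_hasCompactSupport (hfc.mono fun p hp h ↦ hp (by simp [h]))
    exact integral_bilinear_fderiv_right_eq_neg_left_of_integrable (μ := μ) (g := v k)
      (f := fun q ↦ fderiv ℝ (v m) q e) (v := e) (B := innerSL ℝ)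
      (hi (continuous_fderiv_apply_const (hDs m) e) (hv k).continuous
        (hasCompactSupport_fderiv_apply (hDc m) e))
      (hi (hDs m).continuous (hDs k).continuous (hDc m))
      (hi (hDs m).continuous (hv k).continuous (hDc m))
      (fun x _ ↦ (hDs m).differentiable one_ne_zero x)
      (fun x _ ↦ (h1 k).differentiable one_ne_zero x)
  have hlim : ∀ m, Tendsto (fun k ↦ inner ℝ ((hD m).toLp _) ((hD k).toLp _)) atTop (𝓝 0) := by
    intro m
    have hV0 : Tendsto (fun k ↦ (hV k).toLp (v k)) atTop (𝓝 0) := by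
      rw [tendsto_zero_iff_norm_tendsto_zero]
      simp only [Lp.norm_toLp]
      simpa [Function.comp_def] using (ENNReal.tendsto_toReal ENNReal.zero_ne_top).comp h0
    simp only [hparts]
    simpa using ((tendsto_const_nhds (x := (hDD m).toLp _)).inner (𝕜 := ℝ) hV0).neg
  have hmain := tendsto_zero_of_cauchy_of_inner (fun k ↦ (hD k).toLp _) (fun ε hε ↦ by
    obtain ⟨N, hN⟩ := hC ε hε
    refine ⟨N, fun k hk m hm ↦ ?_⟩
    rw [← MemLp.toLp_sub, Lp.norm_toLp]
    exact ENNReal.toReal_le_of_le_ofReal hε.le (hN k hk m hm)) hlim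
  rw [tendsto_zero_iff_norm_tendsto_zero] at hmain
  simp only [Lp.norm_toLp] at hmain
  refine (ENNReal.tendsto_toReal_iff (fun k ↦ (hD k).2.ne) ENNReal.zero_ne_top).1 ?_
  simpa using hmain

end Euclidean

/-! ### Determinants and quadratic forms -/

/-- Each eigenvalue is the value of the quadratic form at a unit eigenvector, and the determinant is
the product of the eigenvalues. This turns bounds on a metric into bounds on its volume density. -/
theorem Matrix.PosDef.pow_le_det_le_pow {m : ℕ} {G : Matrix (Fin m) (Fin m) ℝ} (hG : G.IsHermitian)
    {a A : ℝ} (ha : 0 ≤ a)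
    (hlow : ∀ v : EuclideanSpace ℝ (Fin m), a * ‖v‖ ^ 2 ≤ ⇑v ⬝ᵥ (G *ᵥ ⇑v))
    (hupp : ∀ v : EuclideanSpace ℝ (Fin m), ⇑v ⬝ᵥ (G *ᵥ ⇑v) ≤ A * ‖v‖ ^ 2) :
    a ^ m ≤ G.det ∧ G.det ≤ A ^ m := by
  have h1 : ∀ i, a ≤ hG.eigenvalues i ∧ hG.eigenvalues i ≤ A := fun i ↦ by
    have e := hG.eigenvalues_eq i
    have l := hlow (hG.eigenvectorBasis i)
    have u := hupp (hG.eigenvectorBasis i)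
    rw [hG.eigenvectorBasis.orthonormal.1 i] at l u
    simp only [star_trivial, RCLike.re_to_real] at e
    constructor <;> linarith
  rw [hG.det_eq_prod_eigenvalues]
  constructor
  · simpa using Finset.prod_le_prod (s := Finset.univ) (fun i _ ↦ ha) fun i _ ↦ (h1 i).1
  · simpa using Finset.prod_le_prod (s := Finset.univ) (fun i _ ↦ ha.trans (h1 i).1)
      fun i _ ↦ (h1 i).2

/-- Cauchy–Schwarz between the form `G` and its dual form `G⁻¹`. It follows from the nonnegativity
of `G` at `(b ⬝ᵥ w) • a - (a ⬝ᵥ b) • w` with `w = G⁻¹ b`, after division by `b ⬝ᵥ w`. -/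
theorem Matrix.PosDef.sq_dotProduct_le {m : ℕ} {G : Matrix (Fin m) (Fin m) ℝ} (hG : G.PosDef)
    (a b : Fin m → ℝ) : (a ⬝ᵥ b) ^ 2 ≤ (a ⬝ᵥ (G *ᵥ a)) * (b ⬝ᵥ (G⁻¹ *ᵥ b)) := by
  have hdet : IsUnit G.det := hG.det_pos.ne'.isUnit
  have hGb : G *ᵥ (G⁻¹ *ᵥ b) = b := by
    rw [Matrix.mulVec_mulVec, Matrix.mul_nonsing_inv _ hdet, Matrix.one_mulVec]
  set w := G⁻¹ *ᵥ b with hw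
  have hsymm : w ⬝ᵥ (G *ᵥ a) = a ⬝ᵥ b := by
    rw [Matrix.dotProduct_mulVec, ← Matrix.mulVec_transpose, show Gᵀ = G from hG.isHermitian, hGb,
      dotProduct_comm]
  have hs : 0 ≤ b ⬝ᵥ w := by simpa using hG.inv.posSemidef.dotProduct_mulVec_nonneg b
  have hq := hG.posSemidef.dotProduct_mulVec_nonneg ((b ⬝ᵥ w) • a - (a ⬝ᵥ b) • w)
  simp only [star_trivial, Matrix.mulVec_sub, Matrix.mulVec_smul, hGb, dotProduct_sub,
    sub_dotProduct, smul_dotProduct, dotProduct_smul, smul_eq_mul, hsymm,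
    dotProduct_comm w b] at hq
  rcases hs.eq_or_lt with h0 | hpos
  · have hb : b = 0 := by
      by_contra hb
      have := hG.inv.dotProduct_mulVec_pos hb
      simp only [star_trivial] at this
      exact absurd h0 this.ne
    simp [hb]
  · have : 0 ≤ (b ⬝ᵥ w) * ((a ⬝ᵥ (G *ᵥ a)) * (b ⬝ᵥ w) - (a ⬝ᵥ b) ^ 2) := by nlinarith
    have := nonneg_of_mul_nonneg_right this hpos
    linarith

/-- Uniform bounds for a continuous family of positive quadratic forms on a compact set. -/
theorem exists_quadratic_bounds {X : Type*} [TopologicalSpace X] {m : ℕ} {K : Set X}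
    (hK : IsCompact K) {Q : X → Matrix (Fin m) (Fin m) ℝ} (hQ : ContinuousOn Q K)
    (hpos : ∀ x ∈ K, ∀ v : EuclideanSpace ℝ (Fin m), v ≠ 0 → 0 < ⇑v ⬝ᵥ (Q x *ᵥ ⇑v)) :
    ∃ a A : ℝ, 0 < a ∧ 0 < A ∧ ∀ x ∈ K, ∀ v : EuclideanSpace ℝ (Fin m),
      a * ‖v‖ ^ 2 ≤ ⇑v ⬝ᵥ (Q x *ᵥ ⇑v) ∧ ⇑v ⬝ᵥ (Q x *ᵥ ⇑v) ≤ A * ‖v‖ ^ 2 := by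
  set S := K ×ˢ Metric.sphere (0 : EuclideanSpace ℝ (Fin m)) 1
  have hS : IsCompact S := hK.prod (isCompact_sphere _ _)
  set f : X × EuclideanSpace ℝ (Fin m) → ℝ := fun q ↦ ⇑q.2 ⬝ᵥ (Q q.1 *ᵥ ⇑q.2)
  have hv : Continuous fun q : X × EuclideanSpace ℝ (Fin m) ↦ (⇑q.2 : Fin m → ℝ) := by fun_prop
  have hf : ContinuousOn f S := by
    have hQ' : ContinuousOn (fun q : X × EuclideanSpace ℝ (Fin m) ↦ Q q.1) S :=
      hQ.comp continuousOn_fst fun q hq ↦ hq.1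
    simp only [f, dotProduct, Matrix.mulVec]
    refine continuousOn_finsetSum _ fun i _ ↦ ContinuousOn.mul (by fun_prop) ?_
    refine continuousOn_finsetSum _ fun j _ ↦ ContinuousOn.mul ?_ (by fun_prop)
    exact continuousOn_pi.1 (continuousOn_pi.1 hQ' i) j
  have hmain : ∃ a A : ℝ, 0 < a ∧ 0 < A ∧ ∀ q ∈ S, a ≤ f q ∧ f q ≤ A := by
    rcases S.eq_empty_or_nonempty with h | h
    · exact ⟨1, 1, one_pos, one_pos, fun q hq ↦ by simp [h] at hq⟩
    · obtain ⟨q, hq, hmin⟩ := hS.exists_isMinOn h hf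
      obtain ⟨r, hr, hmax⟩ := hS.exists_isMaxOn h hf
      have hpos' : ∀ q ∈ S, 0 < f q := fun q hq ↦
        hpos q.1 hq.1 q.2 (Metric.ne_of_mem_sphere hq.2 one_ne_zero)
      exact ⟨f q, f r, hpos' q hq, hpos' r hr, fun s hs ↦ ⟨hmin hs, hmax hs⟩⟩
  obtain ⟨a, A, ha, hA, h⟩ := hmain
  refine ⟨a, A, ha, hA, fun x hx v ↦ ?_⟩
  by_cases hv0 : v = 0
  · simp [hv0]
  have hn : 0 < ‖v‖ := norm_pos_iff.2 hv0
  have h1 := h (x, ‖v‖⁻¹ • v) ⟨hx, by simp [norm_smul, hn.ne']⟩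
  have h2 : f (x, ‖v‖⁻¹ • v) = (⇑v ⬝ᵥ (Q x *ᵥ ⇑v)) / ‖v‖ ^ 2 := by
    simp only [f, WithLp.ofLp_smul, Matrix.mulVec_smul, smul_dotProduct, dotProduct_smul,
      smul_eq_mul]
    field_simp
  rw [h2, le_div_iff₀ (by positivity), div_le_iff₀ (by positivity)] at h1
  exact h1

namespace ConicManifold

variable {n : ℕ} {Y B : Type*}
  [TopologicalSpace Y] [ChartedSpace (EuclideanSpace ℝ (Fin n)) Y] [IsManifold (𝓡 n) ∞ Y]
  [TopologicalSpace B] [ChartedSpace (EuclideanHalfSpace (n + 1)) B]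
  [IsManifold (𝓡∂ (n + 1)) ∞ B]

/-! ### The metric in a parametrization -/

theorem symmL_eq_sum_coordVec (c z : B) (a : EuclideanSpace ℝ (Fin (n + 1))) :
    (trivializationAt (EuclideanSpace ℝ (Fin (n + 1))) (TangentSpace (𝓡∂ (n + 1))) c).symmL ℝ z a =
      ∑ i, a i • coordVec c z i := by
  have e : a = ∑ i, a i • (EuclideanSpace.single i 1 : EuclideanSpace ℝ (Fin (n + 1))) := by
    ext k
    simp [Finset.sum_apply, Pi.single_apply]
  conv_lhs => rw [e]
  simp only [map_sum, map_smul, coordVec]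

theorem exists_eq_sum_coordVec {c z : B} (hc : z ∈ (extChartAt (𝓡∂ (n + 1)) c).source)
    (w : TangentSpace (𝓡∂ (n + 1)) z) : ∃ a : Fin (n + 1) → ℝ, w = ∑ i, a i • coordVec c z i := by
  have hb : z ∈ (trivializationAt (EuclideanSpace ℝ (Fin (n + 1)))
      (TangentSpace (𝓡∂ (n + 1)) : B → Type _) c).baseSet := by
    simpa [TangentBundle.trivializationAt_baseSet] using hc
  have h := (trivializationAt (EuclideanSpace ℝ (Fin (n + 1)))
      (TangentSpace (𝓡∂ (n + 1)) : B → Type _) c).symmL_continuousLinearMapAt (R := ℝ) hb w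
  rw [symmL_eq_sum_coordVec] at h
  exact ⟨_, h.symm⟩

theorem g_sum_coordVec (𝔹 : ConicManifold n Y B) (c z : B) (a b : Fin (n + 1) → ℝ) :
    𝔹.g z (∑ i, a i • coordVec c z i) (∑ i, b i • coordVec c z i) = a ⬝ᵥ (𝔹.gram c z *ᵥ b) := by
  simp only [dotProduct, Matrix.mulVec, gram, Matrix.of_apply, map_sum, map_smul, sum_apply,
    smul_apply, smul_eq_mul, Finset.mul_sum]
  rw [Finset.sum_comm]
  refine Finset.sum_congr rfl fun i _ ↦ Finset.sum_congr rfl fun j _ ↦ ?_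
  ring

theorem mfderiv_sum_coordVec (u : B → ℂ) (c z : B) (a : Fin (n + 1) → ℝ) :
    (mfderiv (𝓡∂ (n + 1)) 𝓘(ℝ, ℂ) u z (∑ i, a i • coordVec c z i) : ℂ) =
      ∑ i, (a i : ℂ) * partialDeriv u c z i := by
  rw [map_sum]
  refine Finset.sum_congr rfl fun i _ ↦ ?_
  rw [map_smul]
  exact Complex.real_smul

theorem gradInner_self_re (𝔹 : ConicManifold n Y B) (u : B → ℂ) (z : B) :
    (𝔹.gradInner u u z).re =
      (fun i ↦ (partialDeriv u z z i).re) ⬝ᵥ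
        ((𝔹.gram z z)⁻¹ *ᵥ fun i ↦ (partialDeriv u z z i).re) +
      (fun i ↦ (partialDeriv u z z i).im) ⬝ᵥ
        ((𝔹.gram z z)⁻¹ *ᵥ fun i ↦ (partialDeriv u z z i).im) := by
  simp only [gradInner, dotProduct, Matrix.mulVec, Finset.mul_sum,
    Complex.re_sum, ← Finset.sum_add_distrib]
  refine Finset.sum_congr rfl fun i _ ↦ Finset.sum_congr rfl fun j _ ↦ ?_
  simp
  ring

/-- The differential is bounded by the gradient. -/
theorem normSq_mfderiv_le (𝔹 : ConicManifold n Y B) (u : B → ℂ) {z : B}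
    (hz : z ∈ (𝓡∂ (n + 1)).interior B) (w : TangentSpace (𝓡∂ (n + 1)) z) :
    Complex.normSq (mfderiv (𝓡∂ (n + 1)) 𝓘(ℝ, ℂ) u z w) ≤ 𝔹.g z w w * (𝔹.gradInner u u z).re := by
  obtain ⟨a, rfl⟩ := exists_eq_sum_coordVec (mem_extChartAt_source (I := 𝓡∂ (n + 1)) z) w
  have hG := 𝔹.posDef_gram_self hz
  -- Cauchy–Schwarz is applied to the real and the imaginary part of the differential; the squares
  -- add up to `Complex.normSq`.
  have h1 := hG.sq_dotProduct_le a fun i ↦ (partialDeriv u z z i).re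
  have h2 := hG.sq_dotProduct_le a fun i ↦ (partialDeriv u z z i).im
  rw [mfderiv_sum_coordVec, g_sum_coordVec, gradInner_self_re]
  rw [Complex.normSq_apply]
  simp only [Complex.re_sum, Complex.im_sum, Complex.re_ofReal_mul, Complex.im_ofReal_mul]
  rw [mul_add, ← sq, ← sq]
  exact add_le_add h1 h2

/-- Conversely, the gradient is bounded by the differential. -/
theorem gradInner_le (𝔹 : ConicManifold n Y B) (u : B → ℂ) {z : B}
    (hz : z ∈ (𝓡∂ (n + 1)).interior B) {M : ℝ} (hM0 : 0 ≤ M)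
    (hM : ∀ w : TangentSpace (𝓡∂ (n + 1)) z,
      Complex.normSq (mfderiv (𝓡∂ (n + 1)) 𝓘(ℝ, ℂ) u z w) ≤ M * 𝔹.g z w w) :
    (𝔹.gradInner u u z).re ≤ 2 * M := by
  have hG := 𝔹.posDef_gram_self hz
  have hdet : IsUnit (𝔹.gram z z).det := hG.det_pos.ne'.isUnit
  -- The hypothesis is tested on the gradient vector `a = G⁻¹ b` of the real or the imaginary part.
  -- It gives `(b ⬝ᵥ a)² ≤ M (b ⬝ᵥ a)`, hence a bound by `M` for each part and the factor two in the
  -- conclusion.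
  have key : ∀ b : Fin (n + 1) → ℝ, (∀ a : Fin (n + 1) → ℝ,
      |a ⬝ᵥ b| ≤ ‖∑ i, (a i : ℂ) * partialDeriv u z z i‖) → b ⬝ᵥ ((𝔹.gram z z)⁻¹ *ᵥ b) ≤ M := by
    intro b hb
    set a := (𝔹.gram z z)⁻¹ *ᵥ b with ha
    have h1 := hM (∑ i, a i • coordVec z z i)
    rw [g_sum_coordVec, ha, Matrix.mulVec_mulVec, Matrix.mul_nonsing_inv _ hdet,
      Matrix.one_mulVec, ← ha, mfderiv_sum_coordVec, ← Complex.sq_norm] at h1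
    have h2 := (pow_le_pow_left₀ (abs_nonneg _) (hb a) 2).trans h1
    rw [sq_abs, dotProduct_comm] at h2
    have h3 : 0 ≤ b ⬝ᵥ a := by simpa using hG.inv.posSemidef.dotProduct_mulVec_nonneg b
    by_contra! h4
    nlinarith
  rw [gradInner_self_re, two_mul]
  refine add_le_add (key _ fun a ↦ ?_) (key _ fun a ↦ ?_)
  · refine le_trans (le_of_eq ?_) (Complex.abs_re_le_norm _)
    simp only [Complex.re_sum, Complex.re_ofReal_mul, dotProduct]
  · refine le_trans (le_of_eq ?_) (Complex.abs_im_le_norm _)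
    simp only [Complex.im_sum, Complex.im_ofReal_mul, dotProduct]

/-- The trivialization at `c` is the derivative of the chart at `c`, so its inverse recovers the
derivative of `Φ` from that of `Φ` read in the chart. -/
theorem mfderiv_eq_sum_coordVec {Φ : EuclideanSpace ℝ (Fin (n + 1)) → B}
    {p : EuclideanSpace ℝ (Fin (n + 1))} {c : B}
    (hΦ : MDifferentiableAt 𝓘(ℝ, EuclideanSpace ℝ (Fin (n + 1))) (𝓡∂ (n + 1)) Φ p)
    (hc : Φ p ∈ (extChartAt (𝓡∂ (n + 1)) c).source) (v : EuclideanSpace ℝ (Fin (n + 1))) :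
    mfderiv 𝓘(ℝ, EuclideanSpace ℝ (Fin (n + 1))) (𝓡∂ (n + 1)) Φ p v =
      ∑ i, (fderiv ℝ (extChartAt (𝓡∂ (n + 1)) c ∘ Φ) p v) i • coordVec c (Φ p) i := by
  have hc' : Φ p ∈ (chartAt (EuclideanHalfSpace (n + 1)) c).source := by simpa using hc
  have hb : Φ p ∈ (trivializationAt (EuclideanSpace ℝ (Fin (n + 1)))
      (TangentSpace (𝓡∂ (n + 1)) : B → Type _) c).baseSet := by
    simpa [TangentBundle.trivializationAt_baseSet] using hc
  rw [← symmL_eq_sum_coordVec, ← mfderiv_eq_fderiv,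
    mfderiv_comp p (mdifferentiableAt_extChartAt hc') hΦ,
    ← TangentBundle.continuousLinearMapAt_trivializationAt hc']
  exact ((trivializationAt (EuclideanSpace ℝ (Fin (n + 1)))
      (TangentSpace (𝓡∂ (n + 1)) : B → Type _) c).symmL_continuousLinearMapAt (R := ℝ) hb _).symm

/-- The coefficients of the metric in a parametrization `Φ`. -/
noncomputable def pullGram (𝔹 : ConicManifold n Y B) (Φ : EuclideanSpace ℝ (Fin (n + 1)) → B)
    (p : EuclideanSpace ℝ (Fin (n + 1))) : Matrix (Fin (n + 1)) (Fin (n + 1)) ℝ :=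
  Matrix.of fun i j ↦ 𝔹.g (Φ p)
    (mfderiv 𝓘(ℝ, EuclideanSpace ℝ (Fin (n + 1))) (𝓡∂ (n + 1)) Φ p
      (EuclideanSpace.single i (1 : ℝ)))
    (mfderiv 𝓘(ℝ, EuclideanSpace ℝ (Fin (n + 1))) (𝓡∂ (n + 1)) Φ p
      (EuclideanSpace.single j (1 : ℝ)))

theorem dotProduct_pullGram (𝔹 : ConicManifold n Y B) (Φ : EuclideanSpace ℝ (Fin (n + 1)) → B)
    (p v : EuclideanSpace ℝ (Fin (n + 1))) :
    ⇑v ⬝ᵥ (𝔹.pullGram Φ p *ᵥ ⇑v) = 𝔹.g (Φ p)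
      (mfderiv 𝓘(ℝ, EuclideanSpace ℝ (Fin (n + 1))) (𝓡∂ (n + 1)) Φ p v)
      (mfderiv 𝓘(ℝ, EuclideanSpace ℝ (Fin (n + 1))) (𝓡∂ (n + 1)) Φ p v) := by
  have e : v = ∑ i, v i • (EuclideanSpace.single i 1 : EuclideanSpace ℝ (Fin (n + 1))) := by
    ext k
    simp [Finset.sum_apply, Pi.single_apply]
  have e2 : mfderiv 𝓘(ℝ, EuclideanSpace ℝ (Fin (n + 1))) (𝓡∂ (n + 1)) Φ p v =
      ∑ i, v i • mfderiv 𝓘(ℝ, EuclideanSpace ℝ (Fin (n + 1))) (𝓡∂ (n + 1)) Φ p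
        (EuclideanSpace.single i (1 : ℝ)) := by
    conv_lhs => rw [e]
    refine (map_sum _ _ _).trans (Finset.sum_congr rfl fun i _ ↦ ?_)
    exact map_smul _ _ _
  rw [e2]
  simp only [dotProduct, Matrix.mulVec, pullGram, Matrix.of_apply, map_sum, map_smul, sum_apply,
    smul_apply, smul_eq_mul, Finset.mul_sum]
  rw [Finset.sum_comm]
  refine Finset.sum_congr rfl fun i _ ↦ Finset.sum_congr rfl fun j _ ↦ ?_
  ring

theorem isHermitian_pullGram (𝔹 : ConicManifold n Y B) {Φ : EuclideanSpace ℝ (Fin (n + 1)) → B}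
    {p : EuclideanSpace ℝ (Fin (n + 1))} (hp : Φ p ∈ (𝓡∂ (n + 1)).interior B) :
    (𝔹.pullGram Φ p).IsHermitian := by
  ext i j
  simp [pullGram, 𝔹.g_symm _ hp (mfderiv 𝓘(ℝ, EuclideanSpace ℝ (Fin (n + 1))) (𝓡∂ (n + 1)) Φ p
      (EuclideanSpace.single j (1 : ℝ)))]

/-- With `J` the Jacobian matrix of `Φ` read in the chart, the coefficients transform as `Jᵀ G J`.
The factor `|det J|` is the one that the change of variables formula produces. -/
theorem sqrt_det_pullGram (𝔹 : ConicManifold n Y B) {Φ : EuclideanSpace ℝ (Fin (n + 1)) → B}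
    {p : EuclideanSpace ℝ (Fin (n + 1))} {c : B}
    (hΦ : MDifferentiableAt 𝓘(ℝ, EuclideanSpace ℝ (Fin (n + 1))) (𝓡∂ (n + 1)) Φ p)
    (hc : Φ p ∈ (extChartAt (𝓡∂ (n + 1)) c).source) :
    √(𝔹.pullGram Φ p).det =
      |(fderiv ℝ (extChartAt (𝓡∂ (n + 1)) c ∘ Φ) p).det| * √(𝔹.gram c (Φ p)).det := by
  set D := fderiv ℝ (extChartAt (𝓡∂ (n + 1)) c ∘ Φ) p with hD
  set J : Matrix (Fin (n + 1)) (Fin (n + 1)) ℝ :=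
    Matrix.of fun k i ↦ (D (EuclideanSpace.single i 1)) k with hJ
  have hdet : J.det = D.det := by
    have h := LinearMap.det_toMatrix (EuclideanSpace.basisFun (Fin (n + 1)) ℝ).toBasis
      (D : EuclideanSpace ℝ (Fin (n + 1)) →ₗ[ℝ] EuclideanSpace ℝ (Fin (n + 1)))
    rw [ContinuousLinearMap.det, ← h]
    congr 1
  have h : 𝔹.pullGram Φ p = Jᵀ * 𝔹.gram c (Φ p) * J := by
    ext i j
    simp only [pullGram, Matrix.of_apply]
    rw [mfderiv_eq_sum_coordVec hΦ hc, mfderiv_eq_sum_coordVec hΦ hc, g_sum_coordVec]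
    rw [Matrix.mul_assoc, Matrix.mul_apply]
    simp only [dotProduct, Matrix.mulVec, Matrix.mul_apply, Matrix.transpose_apply, hJ,
      Matrix.of_apply, hD]
  rw [h, Matrix.det_mul, Matrix.det_mul, Matrix.det_transpose, hdet, ← Real.sqrt_sq_eq_abs,
    ← Real.sqrt_mul (sq_nonneg _)]
  congr 1
  ring

section Measure

variable [MeasurableSpace B] [BorelSpace B]

/-- The Riemannian measure in a parametrization. -/
theorem setLIntegral_image (𝔹 : ConicManifold n Y B) {Φ : EuclideanSpace ℝ (Fin (n + 1)) → B}
    {O : Set (EuclideanSpace ℝ (Fin (n + 1)))} {c : B} (hO : IsOpen O)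
    (hΦ : ∀ p ∈ O, MDifferentiableAt 𝓘(ℝ, EuclideanSpace ℝ (Fin (n + 1))) (𝓡∂ (n + 1)) Φ p)
    (hinj : InjOn Φ O) (hc : MapsTo Φ O (extChartAt (𝓡∂ (n + 1)) c).source)
    (hi : MapsTo Φ O ((𝓡∂ (n + 1)).interior B)) {f : B → ℝ≥0∞} (hf : Measurable f) :
    ∫⁻ z in Φ '' O, f z ∂𝔹.vol =
      ∫⁻ p in O, f (Φ p) * ENNReal.ofReal √(𝔹.pullGram Φ p).det := by
  set φ := extChartAt (𝓡∂ (n + 1)) c with hφ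
  have hd : ∀ p ∈ O, HasFDerivWithinAt (φ ∘ Φ) (fderiv ℝ (φ ∘ Φ) p) O p := fun p hp ↦ by
    have h1 := (mdifferentiableAt_extChartAt (I := 𝓡∂ (n + 1)) (x := c) (y := Φ p)
      (by simpa [hφ] using! hc hp)).comp p (hΦ p hp)
    exact h1.differentiableAt.hasFDerivAt.hasFDerivWithinAt
  have hinj' : InjOn (φ ∘ Φ) O := fun p hp q hq h ↦
    hinj hp hq (φ.injOn (hc hp) (hc hq) h)
  -- An injective differentiable image of a measurable set is measurable; pulling it back by the
  -- chart gives measurability of `Φ '' O` itself.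
  have hm : MeasurableSet (φ ∘ Φ '' O) :=
    measurable_image_of_fderivWithin hO.measurableSet hd hinj'
  have himg : Φ '' O = φ.source ∩ φ ⁻¹' (φ ∘ Φ '' O) := by
    ext z
    constructor
    · rintro ⟨p, hp, rfl⟩
      exact ⟨hc hp, p, hp, rfl⟩
    · rintro ⟨hz, p, hp, h⟩
      exact ⟨p, hp, φ.injOn (hc hp) hz h⟩
  have hmi : MeasurableSet (Φ '' O) := by
    rw [himg]
    have hcont := (continuousOn_iff_continuous_domRestrict.1
      (continuousOn_extChartAt (I := 𝓡∂ (n + 1)) c)).measurable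
    have := (isOpen_extChartAt_source (I := 𝓡∂ (n + 1)) c).measurableSet.subtype_image (hcont hm)
    convert this using 1
    ext z
    simp [hφ, and_comm]
  have hsub : Φ '' O ⊆ φ.source := by
    rintro _ ⟨p, hp, rfl⟩
    exact hc hp
  have hT := measurableSet_chart_image (n := n) c (measurableSet_interior (n := n) (B := B))
  have hpre : φ.symm ⁻¹' (Φ '' O) ∩ φ '' (φ.source ∩ (𝓡∂ (n + 1)).interior B) = φ ∘ Φ '' O := by
    ext q
    constructor
    · rintro ⟨⟨p, hp, h⟩, z, ⟨hz, hzi⟩, rfl⟩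
      rw [φ.left_inv hz] at h
      exact ⟨p, hp, by simp [h]⟩
    · rintro ⟨p, hp, rfl⟩
      exact ⟨⟨p, hp, (φ.left_inv (hc hp)).symm⟩, Φ p, ⟨hc hp, hi hp⟩, rfl⟩
  have hdens : AEMeasurable (fun q ↦ ENNReal.ofReal √(𝔹.gram c (φ.symm q)).det)
      ((volume : Measure (EuclideanSpace ℝ (Fin (n + 1)))).restrict
        (φ '' (φ.source ∩ (𝓡∂ (n + 1)).interior B))) := by
    refine (ContinuousOn.aemeasurable (ContinuousOn.comp (t := φ.source ∩ (𝓡∂ (n + 1)).interior B)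
      (g := fun z ↦ √(𝔹.gram c z).det) ?_ ?_ ?_) hT).ennreal_ofReal
    · exact (Continuous.matrix_det continuous_id).sqrt.comp_continuousOn (𝔹.continuousOn_gram c)
    · refine (continuousOn_extChartAt_symm c).mono ?_
      rintro _ ⟨z, hz, rfl⟩
      exact φ.map_source hz.1
    · rintro _ ⟨z, hz, rfl⟩
      rwa [φ.left_inv hz.1]
  have hmul := lintegral_withDensity_eq_lintegral_mul₀' hdens
    (g := fun q ↦ (Φ '' O).indicator f (φ.symm q))
    ((hf.indicator hmi).comp_aemeasurable (aemeasurable_extChartAt_symm c _))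
  rw [← Measure.restrict_restrict_of_subset hsub, restrict_vol, ← lintegral_indicator hmi,
    chartVolume,
    lintegral_map' (hf.indicator hmi).aemeasurable (aemeasurable_extChartAt_symm c _)]
  refine hmul.trans ?_
  have hsubT : φ ∘ Φ '' O ⊆ φ '' (φ.source ∩ (𝓡∂ (n + 1)).interior B) :=
    hpre ▸ inter_subset_right
  have hind : ∀ q ∈ φ '' (φ.source ∩ (𝓡∂ (n + 1)).interior B),
      ((fun q ↦ ENNReal.ofReal √(𝔹.gram c (φ.symm q)).det) *
      fun q ↦ (Φ '' O).indicator f (φ.symm q)) q = (φ ∘ Φ '' O).indicator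
        (fun q ↦ ENNReal.ofReal √(𝔹.gram c (φ.symm q)).det * f (φ.symm q)) q := fun q hq ↦ by
    by_cases h : φ.symm q ∈ Φ '' O
    · have h' : q ∈ φ ∘ Φ '' O := hpre ▸ ⟨h, hq⟩
      simp only [Pi.mul_apply, indicator_of_mem h, indicator_of_mem h']
    · have h' : q ∉ φ ∘ Φ '' O := fun h' ↦ h (hpre.ge h').1
      simp only [Pi.mul_apply, indicator_of_notMem h, indicator_of_notMem h', mul_zero]
  rw [setLIntegral_congr_fun hT hind, setLIntegral_indicator hm, inter_eq_left.2 hsubT]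
  -- Change of variables along `φ ∘ Φ`: its Jacobian and the density in the chart combine to the
  -- density of the pulled back metric.
  rw [lintegral_image_eq_lintegral_abs_det_fderiv_mul volume hO.measurableSet hd hinj']
  refine setLIntegral_congr_fun hO.measurableSet fun p hp ↦ ?_
  simp only [Function.comp_apply, φ.left_inv (hc hp)]
  rw [𝔹.sqrt_det_pullGram (hΦ p hp) (hc hp), ENNReal.ofReal_mul (abs_nonneg _)]
  ring

end Measure

end ConicManifold

/-! ### Elementary estimates for `L^p` seminorms -/

section eLpNorm

variable {X F G₁ G₂ : Type*} [MeasurableSpace X] [NormedAddCommGroup F] [NormedAddCommGroup G₁]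
  [NormedAddCommGroup G₂] {μ : Measure X}

theorem eLpNorm_pow_eq_lintegral (f : X → F) {k : ℕ} (hk : k ≠ 0) :
    eLpNorm f k μ ^ k = ∫⁻ x, ‖f x‖ₑ ^ k ∂μ := by
  have := eLpNorm_nnreal_pow_eq_lintegral (f := f) (μ := μ) (p := (k : NNReal)) (by simpa using hk)
  simpa using this

theorem eLpNorm_le_add_of_norm_le {f : X → F} {g₁ : X → G₁} {g₂ : X → G₂} {p : ℝ≥0∞} (hp : 1 ≤ p)
    (h₁ : AEStronglyMeasurable g₁ μ) (h₂ : AEStronglyMeasurable g₂ μ) {c₁ c₂ : ℝ} (hc₁ : 0 ≤ c₁)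
    (hc₂ : 0 ≤ c₂) (h : ∀ᵐ x ∂μ, ‖f x‖ ≤ c₁ * ‖g₁ x‖ + c₂ * ‖g₂ x‖) :
    eLpNorm f p μ ≤ ENNReal.ofReal c₁ * eLpNorm g₁ p μ + ENNReal.ofReal c₂ * eLpNorm g₂ p μ := by
  have h1 : eLpNorm f p μ ≤ eLpNorm ((fun x ↦ c₁ * ‖g₁ x‖) + fun x ↦ c₂ * ‖g₂ x‖) p μ :=
    eLpNorm_mono_ae (h.mono fun x hx ↦ hx.trans (le_abs_self _))
  refine h1.trans ((eLpNorm_add_le (h₁.norm.const_mul _) (h₂.norm.const_mul _) hp).trans ?_)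
  refine add_le_add ?_ ?_
  · refine eLpNorm_le_mul_eLpNorm_of_ae_le_mul (ae_of_all _ fun x ↦ ?_) p
    rw [norm_mul, norm_norm, Real.norm_of_nonneg hc₁]
  · refine eLpNorm_le_mul_eLpNorm_of_ae_le_mul (ae_of_all _ fun x ↦ ?_) p
    rw [norm_mul, norm_norm, Real.norm_of_nonneg hc₂]

/-- Replacing `√C` by `C + 1` avoids taking roots of constants when a bound between squares is
turned into one between norms. -/
theorem mul_le_succ_mul_sq {C : NNReal} {x y : ℝ≥0∞} (h : x ≤ y ^ 2) :
    C * x ≤ (((C + 1 : NNReal) : ℝ≥0∞) * y) ^ 2 := by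
  rw [mul_pow]
  refine mul_le_mul' ?_ h
  rw [sq]
  norm_cast
  calc C ≤ (C + 1) * 1 := by simp
    _ ≤ (C + 1) * (C + 1) := by gcongr; simp

end eLpNorm

namespace ConicManifold

variable {n : ℕ} {Y B : Type*}
  [TopologicalSpace Y] [ChartedSpace (EuclideanSpace ℝ (Fin n)) Y] [IsManifold (𝓡 n) ∞ Y]
  [TopologicalSpace B] [ChartedSpace (EuclideanHalfSpace (n + 1)) B]
  [IsManifold (𝓡∂ (n + 1)) ∞ B]

/-! ### The norm of `H¹` on test functions -/

section Norm

variable [MeasurableSpace B] [BorelSpace B]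

theorem sq_norm_testFunction (𝔹 : ConicManifold n Y B) (u : 𝔹.TestFunction) :
    ‖u‖ ^ 2 = ∫ z, ‖u.1 z‖ ^ 2 ∂𝔹.vol + ∫ z, (𝔹.gradInner u.1 u.1 z).re ∂𝔹.vol := by
  rw [@norm_sq_eq_re_inner ℂ]
  have : inner ℂ u u = ∫ z, u.1 z * (starRingEnd ℂ) (u.1 z) ∂𝔹.vol +
    ∫ z, 𝔹.gradInner u.1 u.1 z ∂𝔹.vol := rfl
  rw [this, map_add, ← integral_re (𝔹.integrable_mul u u),
    ← integral_re (𝔹.integrable_gradInner u u)]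
  congr 1
  refine integral_congr_ae (ae_of_all _ fun z ↦ ?_)
  simp only [Complex.mul_conj, Complex.normSq_eq_norm_sq]
  exact Complex.ofReal_re _

/-- In this form both parts of the norm can be restricted to subsets and transported to patches
without integrability conditions. -/
theorem lintegral_sq_add_lintegral_grad (𝔹 : ConicManifold n Y B) (u : 𝔹.TestFunction) :
    ∫⁻ z, ‖u.1 z‖ₑ ^ 2 ∂𝔹.vol + ∫⁻ z, ENNReal.ofReal (𝔹.gradInner u.1 u.1 z).re ∂𝔹.vol =
      ‖u‖ₑ ^ 2 := by
  have h1 : Integrable (fun z ↦ ‖u.1 z‖ ^ 2) 𝔹.vol := by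
    refine (𝔹.integrable_mul u u).re.congr (ae_of_all _ fun z ↦ ?_)
    simp only [Complex.mul_conj, Complex.normSq_eq_norm_sq]
    exact Complex.ofReal_re _
  have h2 : Integrable (fun z ↦ (𝔹.gradInner u.1 u.1 z).re) 𝔹.vol :=
    (𝔹.integrable_gradInner u u).re
  rw [← ofReal_norm, ← ENNReal.ofReal_pow (norm_nonneg _), sq_norm_testFunction,
    ENNReal.ofReal_add (integral_nonneg fun z ↦ by positivity)
      (integral_nonneg fun z ↦ 𝔹.gradInner_self_nonneg u z),
    ofReal_integral_eq_lintegral_ofReal h1 (ae_of_all _ fun z ↦ by positivity),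
    ofReal_integral_eq_lintegral_ofReal h2 (ae_of_all _ fun z ↦ 𝔹.gradInner_self_nonneg u z)]
  simp only [← ofReal_norm, ENNReal.ofReal_pow (norm_nonneg _)]

theorem eLpNorm_two_le_enorm (𝔹 : ConicManifold n Y B) (u : 𝔹.TestFunction) :
    eLpNorm u.1 2 𝔹.vol ≤ ‖u‖ₑ := by
  rw [← ENNReal.pow_le_pow_left_iff (n := 2) two_ne_zero, ← lintegral_sq_add_lintegral_grad]
  exact (eLpNorm_pow_eq_lintegral u.1 two_ne_zero).trans_le le_self_add

theorem lintegral_grad_le (𝔹 : ConicManifold n Y B) (u : 𝔹.TestFunction) :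
    ∫⁻ z, ENNReal.ofReal (𝔹.gradInner u.1 u.1 z).re ∂𝔹.vol ≤ ‖u‖ₑ ^ 2 := by
  rw [← lintegral_sq_add_lintegral_grad]
  exact le_add_self

end Norm

theorem gradInner_self_re_nonneg (𝔹 : ConicManifold n Y B) (u : B → ℂ) {z : B}
    (hz : z ∈ (𝓡∂ (n + 1)).interior B) : 0 ≤ (𝔹.gradInner u u z).re := by
  have hp := (𝔹.posDef_gram_self hz).inv.posSemidef
  rw [gradInner_self_re]
  exact add_nonneg (by simpa using hp.dotProduct_mulVec_nonneg fun i ↦ (partialDeriv u z z i).re)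
    (by simpa using hp.dotProduct_mulVec_nonneg fun i ↦ (partialDeriv u z z i).im)

/-! ### Patches -/

/-- A parametrization of an open subset of the interior in which the metric is comparable to
`exp (-2 t)` times the Euclidean metric, where `t` is the first coordinate. -/
structure Patch (𝔹 : ConicManifold n Y B) where
  /-- the parametrization -/
  toFun : EuclideanSpace ℝ (Fin (n + 1)) → B
  /-- the domain -/
  dom : Set (EuclideanSpace ℝ (Fin (n + 1)))
  /-- the centre of a chart that contains the image -/
  center : B
  isOpen_dom : IsOpen dom
  contMDiffOn : ContMDiffOn 𝓘(ℝ, EuclideanSpace ℝ (Fin (n + 1))) (𝓡∂ (n + 1)) ∞ toFun dom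
  injOn : InjOn toFun dom
  mapsTo_source : MapsTo toFun dom (extChartAt (𝓡∂ (n + 1)) center).source
  mapsTo_interior : MapsTo toFun dom ((𝓡∂ (n + 1)).interior B)
  /-- the lower bound of the metric -/
  lower : ℝ
  /-- the upper bound of the metric -/
  upper : ℝ
  lower_pos : 0 < lower
  upper_pos : 0 < upper
  lower_le : ∀ p ∈ dom, ∀ v : EuclideanSpace ℝ (Fin (n + 1)),
    lower * Real.exp (-p 0) ^ 2 * ‖v‖ ^ 2 ≤ ⇑v ⬝ᵥ (𝔹.pullGram toFun p *ᵥ ⇑v)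
  le_upper : ∀ p ∈ dom, ∀ v : EuclideanSpace ℝ (Fin (n + 1)),
    ⇑v ⬝ᵥ (𝔹.pullGram toFun p *ᵥ ⇑v) ≤ upper * Real.exp (-p 0) ^ 2 * ‖v‖ ^ 2
  /-- a lower bound of the first coordinate -/
  inf : ℝ
  inf_le : ∀ p ∈ dom, inf ≤ p 0

namespace Patch

variable {𝔹 : ConicManifold n Y B} (P : 𝔹.Patch)

theorem contMDiffAt {p : EuclideanSpace ℝ (Fin (n + 1))} (hp : p ∈ P.dom) :
    ContMDiffAt 𝓘(ℝ, EuclideanSpace ℝ (Fin (n + 1))) (𝓡∂ (n + 1)) ∞ P.toFun p :=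
  P.contMDiffOn.contMDiffAt (P.isOpen_dom.mem_nhds hp)

theorem mdifferentiableAt {p : EuclideanSpace ℝ (Fin (n + 1))} (hp : p ∈ P.dom) :
    MDifferentiableAt 𝓘(ℝ, EuclideanSpace ℝ (Fin (n + 1))) (𝓡∂ (n + 1)) P.toFun p :=
  (P.contMDiffAt hp).mdifferentiableAt (by simp)

/-- The eigenvalues of the metric are comparable to `exp (-2t)` and there are `n + 1` of them, so
the volume density is comparable to `exp (-(n+1)t)`. -/
theorem sqrt_det_bounds {p : EuclideanSpace ℝ (Fin (n + 1))} (hp : p ∈ P.dom) :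
    √P.lower ^ (n + 1) * Real.exp (-((n : ℝ) + 1) * p 0) ≤ √(𝔹.pullGram P.toFun p).det ∧
    √(𝔹.pullGram P.toFun p).det ≤ √P.upper ^ (n + 1) * Real.exp (-((n : ℝ) + 1) * p 0) := by
  have h := Matrix.PosDef.pow_le_det_le_pow (𝔹.isHermitian_pullGram (P.mapsTo_interior hp))
    (by have := P.lower_pos; positivity) (P.lower_le p hp) (P.le_upper p hp)
  have e : ∀ r : ℝ, 0 ≤ r → √r ^ (n + 1) * Real.exp (-((n : ℝ) + 1) * p 0) =
      √((r * Real.exp (-p 0) ^ 2) ^ (n + 1)) := fun r hr ↦ by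
    have e1 : (r * Real.exp (-p 0) ^ 2) ^ (n + 1) = ((√r * Real.exp (-p 0)) ^ (n + 1)) ^ 2 := by
      rw [← pow_mul, mul_comm (n + 1) 2, pow_mul, mul_pow (√r), Real.sq_sqrt hr]
    rw [e1, Real.sqrt_sq (by positivity), mul_pow, ← Real.exp_nat_mul]
    congr 2
    push_cast
    ring
  rw [e _ P.lower_pos.le, e _ P.upper_pos.le]
  exact ⟨Real.sqrt_le_sqrt h.1, Real.sqrt_le_sqrt h.2⟩

theorem contDiffAt_comp {u : B → ℂ} (hu : ContMDiff (𝓡∂ (n + 1)) 𝓘(ℝ, ℂ) ∞ u)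
    {p : EuclideanSpace ℝ (Fin (n + 1))} (hp : p ∈ P.dom) :
    ContDiffAt ℝ ∞ (u ∘ P.toFun) p :=
  contMDiffAt_iff_contDiffAt.1 (hu.contMDiffAt.comp p (P.contMDiffAt hp))

theorem fderiv_comp_apply {u : B → ℂ} (hu : ContMDiff (𝓡∂ (n + 1)) 𝓘(ℝ, ℂ) ∞ u)
    {p : EuclideanSpace ℝ (Fin (n + 1))} (hp : p ∈ P.dom) (v : EuclideanSpace ℝ (Fin (n + 1))) :
    fderiv ℝ (u ∘ P.toFun) p v = mfderiv (𝓡∂ (n + 1)) 𝓘(ℝ, ℂ) u (P.toFun p)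
      (mfderiv 𝓘(ℝ, EuclideanSpace ℝ (Fin (n + 1))) (𝓡∂ (n + 1)) P.toFun p v) := by
  rw [← mfderiv_eq_fderiv, mfderiv_comp p (hu.mdifferentiable (by simp) _) (P.mdifferentiableAt hp)]
  rfl

/-- A Euclidean unit vector has length at most a constant times `exp (-t)` in the metric, which is
the factor lost between the two gradients. -/
theorem norm_fderiv_comp_le {u : B → ℂ} (hu : ContMDiff (𝓡∂ (n + 1)) 𝓘(ℝ, ℂ) ∞ u)
    {p : EuclideanSpace ℝ (Fin (n + 1))} (hp : p ∈ P.dom) :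
    ‖fderiv ℝ (u ∘ P.toFun) p‖ ^ 2 ≤
      P.upper * Real.exp (-p 0) ^ 2 * (𝔹.gradInner u u (P.toFun p)).re := by
  have hg := 𝔹.gradInner_self_re_nonneg u (P.mapsTo_interior hp)
  have hU := P.upper_pos
  rw [← Real.le_sqrt (norm_nonneg _) (by positivity)]
  refine ContinuousLinearMap.opNorm_le_bound _ (Real.sqrt_nonneg _) fun v ↦ ?_
  refine le_of_sq_le_sq ?_ (by positivity)
  rw [mul_pow, Real.sq_sqrt (by positivity), P.fderiv_comp_apply hu hp]
  refine (Complex.sq_norm _).trans_le ?_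
  refine (𝔹.normSq_mfderiv_le u (P.mapsTo_interior hp) _).trans ?_
  rw [← dotProduct_pullGram]
  calc _ ≤ P.upper * Real.exp (-p 0) ^ 2 * ‖v‖ ^ 2 * (𝔹.gradInner u u (P.toFun p)).re := by
        gcongr
        exact P.le_upper p hp v
    _ = _ := by ring

/-- The lower bound of the metric forces the derivative to be injective, and the dimensions agree.
Every tangent vector is then a test vector for the reverse gradient estimate `gradInner_le`. -/
theorem surjective_mfderiv {p : EuclideanSpace ℝ (Fin (n + 1))} (hp : p ∈ P.dom) :
    Function.Surjective
      (mfderiv 𝓘(ℝ, EuclideanSpace ℝ (Fin (n + 1))) (𝓡∂ (n + 1)) P.toFun p) := by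
  have key : ∀ L : EuclideanSpace ℝ (Fin (n + 1)) →ₗ[ℝ] EuclideanSpace ℝ (Fin (n + 1)),
      (∀ v, L v = 0 → v = 0) → Function.Surjective L := fun L hL ↦
    LinearMap.injective_iff_surjective.1 ((injective_iff_map_eq_zero _).2 hL)
  refine key (mfderiv 𝓘(ℝ, EuclideanSpace ℝ (Fin (n + 1))) (𝓡∂ (n + 1)) P.toFun p).toLinearMap
    fun v hv ↦ ?_
  have h1 := P.lower_le p hp v
  have h2 : mfderiv 𝓘(ℝ, EuclideanSpace ℝ (Fin (n + 1))) (𝓡∂ (n + 1)) P.toFun p v = 0 := hv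
  rw [dotProduct_pullGram, h2, map_zero] at h1
  have h3 : 0 < P.lower * Real.exp (-p 0) ^ 2 := mul_pos P.lower_pos (by positivity)
  have h4 : ‖v‖ ^ 2 ≤ 0 := by
    by_contra! h
    exact absurd (mul_pos h3 h) (not_lt.2 h1)
  simpa using le_antisymm h4 (by positivity)

theorem gradInner_le {u : B → ℂ} (hu : ContMDiff (𝓡∂ (n + 1)) 𝓘(ℝ, ℂ) ∞ u)
    {p : EuclideanSpace ℝ (Fin (n + 1))} (hp : p ∈ P.dom) :
    P.lower * Real.exp (-p 0) ^ 2 * (𝔹.gradInner u u (P.toFun p)).re ≤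
      2 * ‖fderiv ℝ (u ∘ P.toFun) p‖ ^ 2 := by
  have h3 : 0 < P.lower * Real.exp (-p 0) ^ 2 := mul_pos P.lower_pos (by positivity)
  rw [← le_div_iff₀' h3, mul_div_assoc]
  refine 𝔹.gradInner_le u (P.mapsTo_interior hp) (by positivity) fun w ↦ ?_
  obtain ⟨v, rfl⟩ : ∃ v : EuclideanSpace ℝ (Fin (n + 1)),
      mfderiv 𝓘(ℝ, EuclideanSpace ℝ (Fin (n + 1))) (𝓡∂ (n + 1)) P.toFun p v = w :=
    P.surjective_mfderiv hp w
  refine ((congrArg Complex.normSq (P.fderiv_comp_apply hu hp v)).symm.trans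
    (Complex.sq_norm _).symm).trans_le ?_
  rw [div_mul_eq_mul_div, le_div_iff₀ h3, ← dotProduct_pullGram]
  calc _ ≤ (‖fderiv ℝ (u ∘ P.toFun) p‖ * ‖v‖) ^ 2 * (P.lower * Real.exp (-p 0) ^ 2) := by
        gcongr
        exact ContinuousLinearMap.le_opNorm _ _
    _ = ‖fderiv ℝ (u ∘ P.toFun) p‖ ^ 2 * (P.lower * Real.exp (-p 0) ^ 2 * ‖v‖ ^ 2) := by ring
    _ ≤ _ := by
        gcongr
        exact P.lower_le p hp v

section Measure

variable [MeasurableSpace B] [BorelSpace B]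

theorem setLIntegral_image {f : B → ℝ≥0∞} (hf : Measurable f) :
    ∫⁻ z in P.toFun '' P.dom, f z ∂𝔹.vol =
      ∫⁻ p in P.dom, f (P.toFun p) * ENNReal.ofReal √(𝔹.pullGram P.toFun p).det :=
  𝔹.setLIntegral_image P.isOpen_dom (fun _ ↦ P.mdifferentiableAt) P.injOn P.mapsTo_source
    P.mapsTo_interior hf

theorem lintegral_comp_le : ∃ C : NNReal, ∀ f : B → ℝ≥0∞, Measurable f →
    ∫⁻ p in P.dom, f (P.toFun p) * ENNReal.ofReal (Real.exp (-((n : ℝ) + 1) * p 0)) ≤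
      C * ∫⁻ z, f z ∂𝔹.vol := by
  refine ⟨((√P.lower ^ (n + 1))⁻¹).toNNReal, fun f hf ↦ ?_⟩
  have hpos : 0 < √P.lower ^ (n + 1) := pow_pos (Real.sqrt_pos.2 P.lower_pos) _
  calc _ ≤ ∫⁻ p in P.dom, ENNReal.ofReal (√P.lower ^ (n + 1))⁻¹ *
        (f (P.toFun p) * ENNReal.ofReal √(𝔹.pullGram P.toFun p).det) := by
        refine setLIntegral_mono' P.isOpen_dom.measurableSet fun p hp ↦ ?_
        rw [mul_left_comm, ← ENNReal.ofReal_mul (by positivity)]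
        gcongr
        rw [inv_mul_eq_div, le_div_iff₀' hpos]
        exact (P.sqrt_det_bounds hp).1
    _ = ENNReal.ofReal (√P.lower ^ (n + 1))⁻¹ * ∫⁻ z in P.toFun '' P.dom, f z ∂𝔹.vol := by
        rw [lintegral_const_mul' _ _ ENNReal.ofReal_ne_top, P.setLIntegral_image hf]
    _ ≤ _ := by
        gcongr
        · exact le_rfl
        · exact Measure.restrict_le_self

theorem lintegral_le_comp : ∃ C : NNReal, ∀ f : B → ℝ≥0∞, Measurable f →
    ∫⁻ z in P.toFun '' P.dom, f z ∂𝔹.vol ≤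
      C * ∫⁻ p in P.dom, f (P.toFun p) * ENNReal.ofReal (Real.exp (-((n : ℝ) + 1) * p 0)) := by
  refine ⟨(√P.upper ^ (n + 1)).toNNReal, fun f hf ↦ ?_⟩
  rw [P.setLIntegral_image hf, ← lintegral_const_mul' _ _ ENNReal.coe_ne_top]
  refine setLIntegral_mono' P.isOpen_dom.measurableSet fun p hp ↦ ?_
  change _ ≤ ENNReal.ofReal _ * _
  rw [mul_left_comm, ← ENNReal.ofReal_mul (by positivity)]
  gcongr
  exact (P.sqrt_det_bounds hp).2

/-- The weight is the square root of `exp (-(n+1)t)`, the size of the volume density. -/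
theorem exists_eLpNorm_comp_le : ∃ C : NNReal, ∀ u : 𝔹.TestFunction,
    eLpNorm (fun p ↦ Real.exp (-(((n : ℝ) + 1) / 2) * p 0) • u.1 (P.toFun p)) 2
      (volume.restrict P.dom) ≤ C * ‖u‖ₑ := by
  obtain ⟨C, hC⟩ := P.lintegral_comp_le
  refine ⟨C + 1, fun u ↦ ?_⟩
  rw [← ENNReal.pow_le_pow_left_iff (n := 2) two_ne_zero]
  refine (eLpNorm_pow_eq_lintegral _ two_ne_zero).trans_le ?_
  have h := hC (fun z ↦ ‖u.1 z‖ₑ ^ 2) (u.2.1.continuous.enorm.measurable.pow_const 2)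
  refine (lintegral_mono fun p ↦ ?_).trans (h.trans ?_)
  · rw [enorm_smul, mul_pow, mul_comm, Real.enorm_of_nonneg (by positivity),
      ← ENNReal.ofReal_pow (by positivity), ← Real.exp_nat_mul]
    refine le_of_eq ?_
    congr 3
    push_cast
    ring
  · exact mul_le_succ_mul_sq (le_self_add.trans (𝔹.lintegral_sq_add_lintegral_grad u).le)

/-- The squared weight `exp (-(n-1)t)` is the volume density `exp (-(n+1)t)` times the factor `exp
(2t)` that relates the squared gradient of the metric to the Euclidean one. -/
theorem exists_eLpNorm_fderiv_comp_le : ∃ C : NNReal, ∀ u : 𝔹.TestFunction,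
    eLpNorm (fun p ↦ Real.exp (-(((n : ℝ) - 1) / 2) * p 0) • fderiv ℝ (u.1 ∘ P.toFun) p) 2
      (volume.restrict P.dom) ≤ C * ‖u‖ₑ := by
  obtain ⟨C, hC⟩ := P.lintegral_comp_le
  refine ⟨C * P.upper.toNNReal + 1, fun u ↦ ?_⟩
  rw [← ENNReal.pow_le_pow_left_iff (n := 2) two_ne_zero]
  refine (eLpNorm_pow_eq_lintegral _ two_ne_zero).trans_le ?_
  have h := hC (fun z ↦ ENNReal.ofReal P.upper * ENNReal.ofReal (𝔹.gradInner u.1 u.1 z).re)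
    ((Complex.continuous_re.comp (𝔹.continuous_gradInner u u)).measurable.ennreal_ofReal.const_mul
      _)
  refine (setLIntegral_mono' P.isOpen_dom.measurableSet fun p hp ↦ ?_).trans (h.trans ?_)
  · have hU := P.upper_pos
    have hg := 𝔹.gradInner_self_re_nonneg u.1 (P.mapsTo_interior hp)
    rw [← ofReal_norm, ← ENNReal.ofReal_pow (by positivity), ← ENNReal.ofReal_mul hU.le,
      ← ENNReal.ofReal_mul (by positivity), norm_smul, mul_pow, Real.norm_of_nonneg (by positivity)]
    refine ENNReal.ofReal_le_ofReal ?_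
    refine (mul_le_mul_of_nonneg_left (P.norm_fderiv_comp_le u.2.1 hp) (by positivity)).trans_eq ?_
    have e : Real.exp (-((n : ℝ) + 1) * p 0) =
        Real.exp (-(((n : ℝ) - 1) / 2) * p 0) ^ 2 * Real.exp (-p 0) ^ 2 := by
      rw [← Real.exp_nat_mul, ← Real.exp_nat_mul, ← Real.exp_add]
      congr 1
      push_cast
      ring
    rw [e]
    ring
  · rw [lintegral_const_mul' _ _ ENNReal.ofReal_ne_top, ← mul_assoc]
    exact mul_le_succ_mul_sq (C := C * P.upper.toNNReal) (𝔹.lintegral_grad_le u)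

end Measure

end Patch

end ConicManifold

/-! ### Products with cutoff functions -/

section Cutoff

variable {E G : Type*} [NormedAddCommGroup E] [NormedSpace ℝ E] [NormedAddCommGroup G]
  [NormedSpace ℝ G] {O : Set E} {η : E → ℝ} {f : E → G}

theorem contDiff_smul_of_tsupport_subset {k : ℕ∞} (hη : ContDiff ℝ k η)
    (hs : tsupport η ⊆ O) (hf : ∀ p ∈ O, ContDiffAt ℝ k f p) : ContDiff ℝ k fun p ↦ η p • f p := by
  refine contDiff_iff_contDiffAt.2 fun p ↦ ?_
  by_cases hp : p ∈ tsupport η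
  · exact hη.contDiffAt.smul (hf p (hs hp))
  · refine (contDiffAt_const (c := (0 : G))).congr_of_eventuallyEq ?_
    filter_upwards [notMem_tsupport_iff_eventuallyEq.1 hp] with q hq
    simp [hq]

theorem fderiv_smul_apply_eq {p : E} (hη : DifferentiableAt ℝ η p) (hf : DifferentiableAt ℝ f p)
    (v : E) : fderiv ℝ (fun p ↦ η p • f p) p v = η p • fderiv ℝ f p v + fderiv ℝ η p v • f p := by
  rw [fderiv_fun_smul hη hf]
  simp

theorem norm_fderiv_smul_le {p : E} (hη : DifferentiableAt ℝ η p) (hf : DifferentiableAt ℝ f p) :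
    ‖fderiv ℝ (fun p ↦ η p • f p) p‖ ≤ |η p| * ‖fderiv ℝ f p‖ + ‖fderiv ℝ η p‖ * ‖f p‖ := by
  rw [fderiv_fun_smul hη hf]
  refine (norm_add_le _ _).trans ?_
  rw [norm_smul, ContinuousLinearMap.norm_smulRight_apply, Real.norm_eq_abs]

theorem fderiv_smul_eq_zero_of_notMem {p : E} (hs : tsupport η ⊆ O) (hp : p ∉ O) :
    fderiv ℝ (fun p ↦ η p • f p) p = 0 := by
  have : (fun p ↦ η p • f p) =ᶠ[𝓝 p] fun _ ↦ 0 := by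
    filter_upwards [notMem_tsupport_iff_eventuallyEq.1 fun h ↦ hp (hs h)] with q hq
    simp [hq]
  rw [this.fderiv_eq]
  simp

end Cutoff

/-! ### Exponential weights in the first coordinate -/

section ExpWeight

variable {m : ℕ}

theorem contDiff_exp_coord (β : ℝ) :
    ContDiff ℝ ∞ fun p : EuclideanSpace ℝ (Fin (m + 1)) ↦ Real.exp (-β * p 0) := by
  refine Real.contDiff_exp.comp (contDiff_const.mul ?_)
  exact (EuclideanSpace.proj (0 : Fin (m + 1)) : EuclideanSpace ℝ (Fin (m + 1)) →L[ℝ] ℝ).contDiff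

theorem fderiv_exp_coord (β : ℝ) (p : EuclideanSpace ℝ (Fin (m + 1))) :
    fderiv ℝ (fun p : EuclideanSpace ℝ (Fin (m + 1)) ↦ Real.exp (-β * p 0)) p =
      (-β * Real.exp (-β * p 0)) •
        (EuclideanSpace.proj (0 : Fin (m + 1)) : EuclideanSpace ℝ (Fin (m + 1)) →L[ℝ] ℝ) := by
  have h := ((((EuclideanSpace.proj (0 : Fin (m + 1)) :
    EuclideanSpace ℝ (Fin (m + 1)) →L[ℝ] ℝ).hasFDerivAt (x := p)).const_mul (-β)).exp).fderiv
  refine h.trans ?_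
  rw [smul_smul, mul_comm]
  rfl

theorem norm_fderiv_exp_coord_le (β : ℝ) (p : EuclideanSpace ℝ (Fin (m + 1))) :
    ‖fderiv ℝ (fun p : EuclideanSpace ℝ (Fin (m + 1)) ↦ Real.exp (-β * p 0)) p‖ ≤
      |β| * Real.exp (-β * p 0) := by
  rw [fderiv_exp_coord, norm_smul]
  refine mul_le_of_le_one_right (norm_nonneg _) ?_ |>.trans_eq ?_
  · refine ContinuousLinearMap.opNorm_le_bound _ zero_le_one fun v ↦ ?_
    rw [one_mul]
    exact PiLp.norm_apply_le v 0
  · rw [norm_mul, norm_neg, Real.norm_eq_abs, Real.norm_of_nonneg (Real.exp_pos _).le]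

end ExpWeight

/-! ### Cutoff functions on patches and the weighted `L²` estimate -/

namespace ConicManifold

variable {n : ℕ} {Y B : Type*}
  [TopologicalSpace Y] [ChartedSpace (EuclideanSpace ℝ (Fin n)) Y] [IsManifold (𝓡 n) ∞ Y]
  [TopologicalSpace B] [ChartedSpace (EuclideanHalfSpace (n + 1)) B]
  [IsManifold (𝓡∂ (n + 1)) ∞ B]

namespace Patch

variable {𝔹 : ConicManifold n Y B} (P : 𝔹.Patch)

/-- A smooth bounded function supported in the domain of a patch such that its derivative in the
first coordinate direction has bounded support in that direction and its product with every
test function has compact support. -/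
structure IsCutoff (χ : EuclideanSpace ℝ (Fin (n + 1)) → ℝ) : Prop where
  contDiff : ContDiff ℝ ∞ χ
  tsupport_subset : tsupport χ ⊆ P.dom
  hasCompactSupport : ∀ u : 𝔹.TestFunction, HasCompactSupport fun p ↦ χ p • u.1 (P.toFun p)
  exists_bound : ∃ M : ℝ, ∀ p, |χ p| ≤ M ∧ ‖fderiv ℝ χ p‖ ≤ M
  exists_bound_coord : ∃ T : ℝ, ∀ p, T ≤ p 0 → fderiv ℝ χ p (EuclideanSpace.single 0 1) = 0

variable {P} {χ χ₁ : EuclideanSpace ℝ (Fin (n + 1)) → ℝ}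

theorem IsCutoff.contDiff_smul (h : P.IsCutoff χ) (u : 𝔹.TestFunction) :
    ContDiff ℝ ∞ fun p ↦ χ p • u.1 (P.toFun p) :=
  contDiff_smul_of_tsupport_subset h.contDiff h.tsupport_subset
    fun _ hp ↦ P.contDiffAt_comp u.2.1 hp

section Measure

variable [MeasurableSpace B] [BorelSpace B]

variable (P) in
theorem aestronglyMeasurable_comp (u : 𝔹.TestFunction) (β : ℝ) :
    AEStronglyMeasurable (fun p ↦ Real.exp (-β * p 0) • u.1 (P.toFun p))
      (volume.restrict P.dom) :=
  ContinuousOn.aestronglyMeasurable ((contDiff_exp_coord β).continuous.continuousOn.smul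
    fun _ hp ↦ (P.contDiffAt_comp u.2.1 hp).continuousAt.continuousWithinAt)
    P.isOpen_dom.measurableSet

variable (P) in
theorem aestronglyMeasurable_fderiv_comp (u : 𝔹.TestFunction) (β : ℝ) :
    AEStronglyMeasurable (fun p ↦ Real.exp (-β * p 0) • fderiv ℝ (u.1 ∘ P.toFun) p)
      (volume.restrict P.dom) :=
  ContinuousOn.aestronglyMeasurable ((contDiff_exp_coord β).continuous.continuousOn.smul
    fun p hp ↦ ((P.contDiffAt_comp u.2.1 hp).continuousAt_fderiv (by simp)).continuousWithinAt)
    P.isOpen_dom.measurableSet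

/-- The product rule leaves two terms. In the one with `∂u`, the weight `exp (-βt)` is dominated by
`exp (-(n-1)t/2)` because `t` is bounded below on the patch. In the one with `∂ₜχ`, only `t ≤ T`
matters, and there `exp (-βt)` is dominated by `exp (-(n+1)t/2)`. The two inequalities on `β` are
what these comparisons need. -/
theorem IsCutoff.exists_norm_fderiv_coord_le (h : P.IsCutoff χ) {β : ℝ}
    (hβ₁ : ((n : ℝ) - 1) / 2 ≤ β) (hβ₂ : β ≤ ((n : ℝ) + 1) / 2) :
    ∃ c₁ c₂ : ℝ, 0 ≤ c₁ ∧ 0 ≤ c₂ ∧ ∀ u : 𝔹.TestFunction, ∀ p ∈ P.dom,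
      Real.exp (-β * p 0) *
        ‖fderiv ℝ (fun p ↦ χ p • u.1 (P.toFun p)) p (EuclideanSpace.single 0 1)‖ ≤
      c₁ * (Real.exp (-(((n : ℝ) + 1) / 2) * p 0) * ‖u.1 (P.toFun p)‖) +
      c₂ * (Real.exp (-(((n : ℝ) - 1) / 2) * p 0) * ‖fderiv ℝ (u.1 ∘ P.toFun) p‖) := by
  obtain ⟨M, hM⟩ := h.exists_bound
  obtain ⟨T, hT⟩ := h.exists_bound_coord
  have hM0 : 0 ≤ M := (abs_nonneg _).trans (hM 0).1
  refine ⟨M * Real.exp ((((n : ℝ) + 1) / 2 - β) * T),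
    M * Real.exp (-(β - ((n : ℝ) - 1) / 2) * P.inf), by positivity, by positivity, fun u p hp ↦ ?_⟩
  set e : EuclideanSpace ℝ (Fin (n + 1)) := EuclideanSpace.single 0 1 with he
  have hen : ‖e‖ = 1 := by simp [he]
  have hd := fderiv_smul_apply_eq (h.contDiff.differentiable (by simp) p)
    ((P.contDiffAt_comp u.2.1 hp).differentiableAt (by simp)) e
  have h1 : ‖fderiv ℝ (fun p ↦ χ p • u.1 (P.toFun p)) p e‖ ≤
      ‖fderiv ℝ χ p e‖ * ‖u.1 (P.toFun p)‖ + M * ‖fderiv ℝ (u.1 ∘ P.toFun) p‖ := by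
    rw [show fderiv ℝ (fun p ↦ χ p • u.1 (P.toFun p)) p e = _ from hd, add_comm]
    refine (norm_add_le _ _).trans ?_
    rw [norm_smul, norm_smul]
    have := (fderiv ℝ (u.1 ∘ P.toFun) p).le_opNorm e
    rw [hen, mul_one] at this
    exact add_le_add le_rfl (mul_le_mul (hM p).1 this (norm_nonneg _) hM0)
  have h2 : Real.exp (-β * p 0) * ‖fderiv ℝ χ p e‖ ≤
      M * Real.exp ((((n : ℝ) + 1) / 2 - β) * T) * Real.exp (-(((n : ℝ) + 1) / 2) * p 0) := by
    by_cases hpT : T ≤ p 0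
    · rw [hT p hpT, norm_zero, mul_zero]
      positivity
    · have h3 : ‖fderiv ℝ χ p e‖ ≤ M := by
        refine ((fderiv ℝ χ p).le_opNorm e).trans ?_
        rw [hen, mul_one]
        exact (hM p).2
      rw [mul_assoc, mul_comm, ← Real.exp_add]
      refine mul_le_mul h3 (Real.exp_le_exp.2 ?_) (by positivity) hM0
      nlinarith
  have h3 : Real.exp (-β * p 0) * M ≤
      M * Real.exp (-(β - ((n : ℝ) - 1) / 2) * P.inf) * Real.exp (-(((n : ℝ) - 1) / 2) * p 0) := by
    rw [mul_assoc, mul_comm, ← Real.exp_add]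
    refine mul_le_mul_of_nonneg_left (Real.exp_le_exp.2 ?_) hM0
    nlinarith [P.inf_le p hp]
  calc _ ≤ Real.exp (-β * p 0) * (‖fderiv ℝ χ p e‖ * ‖u.1 (P.toFun p)‖ +
        M * ‖fderiv ℝ (u.1 ∘ P.toFun) p‖) := mul_le_mul_of_nonneg_left h1 (Real.exp_pos _).le
    _ = (Real.exp (-β * p 0) * ‖fderiv ℝ χ p e‖) * ‖u.1 (P.toFun p)‖ +
        (Real.exp (-β * p 0) * M) * ‖fderiv ℝ (u.1 ∘ P.toFun) p‖ := by ring
    _ ≤ _ := by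
      rw [← mul_assoc, ← mul_assoc]
      exact add_le_add (mul_le_mul_of_nonneg_right h2 (norm_nonneg _))
        (mul_le_mul_of_nonneg_right h3 (norm_nonneg _))

theorem hasCompactSupport_exp_smul {F : EuclideanSpace ℝ (Fin (n + 1)) → ℂ}
    (hF : HasCompactSupport F) (β : ℝ) :
    HasCompactSupport fun p : EuclideanSpace ℝ (Fin (n + 1)) ↦ Real.exp (-β * p 0) • F p :=
  HasCompactSupport.smul_left (f := fun p : EuclideanSpace ℝ (Fin (n + 1)) ↦ Real.exp (-β * p 0)) hF

/-- For `v = exp (-βt) F` the expression `∂ₜv + βv` in `hardy_inequality` collapses to `exp (-βt)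
∂ₜF`. -/
theorem hardy_inequality_exp {F : EuclideanSpace ℝ (Fin (n + 1)) → ℂ} (hF : ContDiff ℝ ∞ F)
    (hc : HasCompactSupport F) {β : ℝ} (hβ : 0 ≤ β) :
    ENNReal.ofReal β * eLpNorm (fun p ↦ Real.exp (-β * p 0) • F p) 2 volume ≤
      eLpNorm (fun p ↦ Real.exp (-β * p 0) • fderiv ℝ F p (EuclideanSpace.single 0 1)) 2 volume := by
  have hv : ContDiff ℝ 1 fun p ↦ Real.exp (-β * p 0) • F p :=
    ((contDiff_exp_coord β).smul hF).of_le (by norm_cast)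
  refine (hardy_inequality volume hv (hasCompactSupport_exp_smul hc β) (EuclideanSpace.single 0 1)
    hβ).trans_eq ?_
  refine eLpNorm_congr_ae (ae_of_all _ fun p ↦ ?_)
  beta_reduce
  rw [fderiv_smul_apply_eq ((contDiff_exp_coord β).differentiable (by simp) p)
    (hF.differentiable (by simp) p), fderiv_exp_coord]
  simp
  ring

/-- The weighted `L²` norm is controlled by the `H¹` norm. -/
theorem IsCutoff.exists_eLpNorm_two_le (h : P.IsCutoff χ) {β : ℝ} (hβ : 0 < β)
    (hβ₁ : ((n : ℝ) - 1) / 2 ≤ β) (hβ₂ : β ≤ ((n : ℝ) + 1) / 2) :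
    ∃ C : NNReal, ∀ u : 𝔹.TestFunction,
      eLpNorm (fun p ↦ Real.exp (-β * p 0) • (χ p • u.1 (P.toFun p))) 2 volume ≤ C * ‖u‖ₑ := by
  obtain ⟨c₁, c₂, hc₁, hc₂, hpt⟩ := h.exists_norm_fderiv_coord_le hβ₁ hβ₂
  obtain ⟨C₁, hC₁⟩ := P.exists_eLpNorm_comp_le
  obtain ⟨C₂, hC₂⟩ := P.exists_eLpNorm_fderiv_comp_le
  refine ⟨(β⁻¹).toNNReal * (c₁.toNNReal * C₁ + c₂.toNNReal * C₂), fun u ↦ ?_⟩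
  -- Hardy's inequality trades `u` with the weight `β`, too large for the `L²` part of the norm, for
  -- a derivative in `t`, which the `H¹` norm controls.
  have hardy := hardy_inequality_exp (h.contDiff_smul u) (h.hasCompactSupport u) hβ.le
  have hsupp : Function.support (fun p ↦ Real.exp (-β * p 0) •
      fderiv ℝ (fun p ↦ χ p • u.1 (P.toFun p)) p (EuclideanSpace.single 0 1)) ⊆ P.dom := by
    intro p hp
    by_contra hpO
    refine hp ?_
    beta_reduce
    rw [fderiv_smul_eq_zero_of_notMem h.tsupport_subset hpO, zero_apply, smul_zero]
  rw [← eLpNorm_restrict_eq_of_support_subset hsupp] at hardy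
  have hbound := hardy.trans (eLpNorm_le_add_of_norm_le one_le_two
    (P.aestronglyMeasurable_comp u (((n : ℝ) + 1) / 2))
    (P.aestronglyMeasurable_fderiv_comp u (((n : ℝ) - 1) / 2)) hc₁ hc₂ (by
      filter_upwards [self_mem_ae_restrict P.isOpen_dom.measurableSet] with p hp
      rw [norm_smul, norm_smul, norm_smul, Real.norm_of_nonneg (Real.exp_pos _).le,
        Real.norm_of_nonneg (Real.exp_pos _).le, Real.norm_of_nonneg (Real.exp_pos _).le]
      exact hpt u p hp))
  have hfin := hbound.trans (add_le_add (mul_le_mul' le_rfl (hC₁ u)) (mul_le_mul' le_rfl (hC₂ u)))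
  have hβ' : ENNReal.ofReal β⁻¹ * ENNReal.ofReal β = 1 := by
    rw [← ENNReal.ofReal_mul (by positivity), inv_mul_cancel₀ hβ.ne', ENNReal.ofReal_one]
  calc _ = ENNReal.ofReal β⁻¹ * (ENNReal.ofReal β * _) := by
        rw [← mul_assoc, hβ', one_mul]
    _ ≤ ENNReal.ofReal β⁻¹ * _ := mul_le_mul' le_rfl hfin
    _ = _ := by
        push_cast
        simp only [ENNReal.ofReal]
        ring

end Measure

end Patch

end ConicManifold

/-! ### The local Sobolev inequality -/

namespace ConicManifold

variable {n : ℕ} {Y B : Type*}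
  [TopologicalSpace Y] [ChartedSpace (EuclideanSpace ℝ (Fin n)) Y] [IsManifold (𝓡 n) ∞ Y]
  [TopologicalSpace B] [ChartedSpace (EuclideanHalfSpace (n + 1)) B]
  [IsManifold (𝓡∂ (n + 1)) ∞ B]

namespace Patch

variable {𝔹 : ConicManifold n Y B} {P : 𝔹.Patch} {χ χ₁ : EuclideanSpace ℝ (Fin (n + 1)) → ℝ}

section Measure

variable [MeasurableSpace B] [BorelSpace B]

/-- Unlike `∂ₜχ`, the tangential derivatives of `χ` need not vanish for large `t`, so the terms
without a derivative of `u` cannot be bounded by the `L²` part of the norm. They are absorbed into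
`χ₁ u` with a larger cutoff `χ₁`, to which the weighted `L²` estimate applies. -/
theorem IsCutoff.exists_norm_fderiv_le (h : P.IsCutoff χ) {M : ℝ}
    (hM : ∀ p, |χ p| ≤ M * |χ₁ p| ∧ ‖fderiv ℝ χ p‖ ≤ M * |χ₁ p|) {β : ℝ} (hβ : 0 ≤ β)
    (hβ₁ : ((n : ℝ) - 1) / 2 ≤ β) :
    ∃ c₁ c₂ : ℝ, 0 ≤ c₁ ∧ 0 ≤ c₂ ∧ ∀ u : 𝔹.TestFunction, ∀ p ∈ P.dom,
      ‖fderiv ℝ (fun p ↦ Real.exp (-β * p 0) • (χ p • u.1 (P.toFun p))) p‖ ≤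
      c₁ * ‖Real.exp (-β * p 0) • (χ₁ p • u.1 (P.toFun p))‖ +
      c₂ * ‖Real.exp (-(((n : ℝ) - 1) / 2) * p 0) • fderiv ℝ (u.1 ∘ P.toFun) p‖ := by
  obtain ⟨K, hK⟩ := h.exists_bound
  have hK0 : 0 ≤ K := (abs_nonneg _).trans (hK 0).1
  refine ⟨|M| * (1 + β), K * Real.exp (-(β - ((n : ℝ) - 1) / 2) * P.inf), by positivity,
    by positivity, fun u p hp ↦ ?_⟩
  have hM' : ∀ p, |χ p| ≤ |M| * |χ₁ p| ∧ ‖fderiv ℝ χ p‖ ≤ |M| * |χ₁ p| := fun p ↦ by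
    have := mul_le_mul_of_nonneg_right (le_abs_self M) (abs_nonneg (χ₁ p))
    exact ⟨(hM p).1.trans this, (hM p).2.trans this⟩
  have hsm := h.contDiff_smul u
  have h1 := norm_fderiv_smul_le (p := p)
    ((contDiff_exp_coord (m := n) β).differentiable (by simp) p)
    (hsm.differentiable (by simp) p)
  have h2 := norm_fderiv_smul_le (h.contDiff.differentiable (by simp) p)
    ((P.contDiffAt_comp u.2.1 hp).differentiableAt (by simp))
  have h3 := norm_fderiv_exp_coord_le β p
  rw [abs_of_nonneg (Real.exp_pos _).le] at h1
  rw [abs_of_nonneg hβ] at h3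
  set w := Real.exp (-β * p 0) with hw
  have hw0 : 0 < w := Real.exp_pos _
  set a := ‖u.1 (P.toFun p)‖ with ha
  set d := ‖fderiv ℝ (u.1 ∘ P.toFun) p‖ with hd
  have h4 : w * K ≤
      K * Real.exp (-(β - ((n : ℝ) - 1) / 2) * P.inf) * Real.exp (-(((n : ℝ) - 1) / 2) * p 0) := by
    rw [mul_assoc, mul_comm, ← Real.exp_add, hw]
    refine mul_le_mul_of_nonneg_left (Real.exp_le_exp.2 ?_) hK0
    nlinarith [P.inf_le p hp]
  rw [norm_smul, norm_smul, norm_smul, Real.norm_of_nonneg hw0.le,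
    Real.norm_of_nonneg (Real.exp_pos _).le,
    Real.norm_eq_abs]
  have h5 : ‖χ p • u.1 (P.toFun p)‖ ≤ |M| * |χ₁ p| * a := by
    rw [norm_smul, Real.norm_eq_abs]
    exact mul_le_mul_of_nonneg_right (hM' p).1 (norm_nonneg _)
  have h6 : ‖fderiv ℝ (fun p ↦ χ p • u.1 (P.toFun p)) p‖ ≤ K * d + |M| * |χ₁ p| * a :=
    h2.trans (add_le_add (mul_le_mul_of_nonneg_right (hK p).1 (norm_nonneg _))
      (mul_le_mul_of_nonneg_right (hM' p).2 (norm_nonneg _)))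
  refine h1.trans ?_
  calc _ ≤ w * (K * d + |M| * |χ₁ p| * a) + β * w * (|M| * |χ₁ p| * a) :=
        add_le_add (mul_le_mul_of_nonneg_left h6 hw0.le)
          (mul_le_mul h3 h5 (norm_nonneg _) (by positivity))
    _ = |M| * (1 + β) * (w * (|χ₁ p| * a)) + w * K * d := by ring
    _ ≤ _ := by
      rw [← mul_assoc _ _ d]
      exact add_le_add le_rfl (mul_le_mul_of_nonneg_right h4 (norm_nonneg _))

theorem IsCutoff.exists_eLpNorm_six_le_aux (h : P.IsCutoff χ) (h₁ : P.IsCutoff χ₁) {M : ℝ}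
    (hM : ∀ p, |χ p| ≤ M * |χ₁ p| ∧ ‖fderiv ℝ χ p‖ ≤ M * |χ₁ p|) (hn : n = 1 ∨ n = 2) :
    ∃ C : NNReal, ∀ u : 𝔹.TestFunction,
      eLpNorm (fun p ↦ Real.exp (-(((n : ℝ) + 1) / 6) * p 0) • (χ p • u.1 (P.toFun p))) 6 volume ≤
        C * ‖u‖ₑ := by
  have hn2 : (n : ℝ) ≤ 2 := by
    rcases hn with rfl | rfl <;> norm_num
  set β : ℝ := ((n : ℝ) + 1) / 6 with hβ
  have hβ0 : 0 < β := by positivity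
  -- This is equivalent to `n ≤ 2`, with equality for `n = 2`: the restriction on the dimension.
  have hβ₁ : ((n : ℝ) - 1) / 2 ≤ β := by rw [hβ]; linarith
  have hβ₂ : β ≤ ((n : ℝ) + 1) / 2 := by rw [hβ]; linarith
  obtain ⟨C, hC⟩ := exists_eLpNorm_six_le
    (volume : Measure (EuclideanSpace ℝ (Fin (n + 1)))) (by
      rw [finrank_euclideanSpace_fin]
      omega)
  obtain ⟨A, hA⟩ := h.exists_eLpNorm_two_le hβ0 hβ₁ hβ₂
  obtain ⟨A₁, hA₁⟩ := h₁.exists_eLpNorm_two_le hβ0 hβ₁ hβ₂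
  obtain ⟨A₂, hA₂⟩ := P.exists_eLpNorm_fderiv_comp_le
  obtain ⟨c₁, c₂, hc₁, hc₂, hpt⟩ := h.exists_norm_fderiv_le hM hβ0.le hβ₁
  refine ⟨C * (A + (c₁.toNNReal * A₁ + c₂.toNNReal * A₂)), fun u ↦ ?_⟩
  have hsm : ContDiff ℝ ∞ fun p ↦ Real.exp (-β * p 0) • (χ p • u.1 (P.toFun p)) :=
    (contDiff_exp_coord β).smul (h.contDiff_smul u)
  have hsm₁ : ContDiff ℝ ∞ fun p ↦ Real.exp (-β * p 0) • (χ₁ p • u.1 (P.toFun p)) :=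
    (contDiff_exp_coord β).smul (h₁.contDiff_smul u)
  have hsob := hC _ (hsm.of_le (by norm_cast))
    (hasCompactSupport_exp_smul (h.hasCompactSupport u) β)
  have hsupp : Function.support
      (fderiv ℝ fun p ↦ Real.exp (-β * p 0) • (χ p • u.1 (P.toFun p))) ⊆ P.dom := by
    intro p hp
    by_contra hpO
    refine hp ?_
    have : (fun p ↦ Real.exp (-β * p 0) • (χ p • u.1 (P.toFun p))) =ᶠ[𝓝 p] fun _ ↦ 0 := by
      filter_upwards [notMem_tsupport_iff_eventuallyEq.1 fun hh ↦ hpO (h.tsupport_subset hh)]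
        with q hq
      simp [hq]
    rw [this.fderiv_eq]
    simp
  have hbound := eLpNorm_le_add_of_norm_le (p := 2) one_le_two
    (hsm₁.continuous.aestronglyMeasurable (μ := volume.restrict P.dom))
    (P.aestronglyMeasurable_fderiv_comp u (((n : ℝ) - 1) / 2)) hc₁ hc₂
    (by
      filter_upwards [self_mem_ae_restrict P.isOpen_dom.measurableSet] with p hp
      exact hpt u p hp)
  rw [eLpNorm_restrict_eq_of_support_subset hsupp] at hbound
  have hres : eLpNorm (fun p ↦ Real.exp (-β * p 0) • (χ₁ p • u.1 (P.toFun p))) 2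
      (volume.restrict P.dom) ≤ A₁ * ‖u‖ₑ :=
    (eLpNorm_mono_measure _ Measure.restrict_le_self).trans (hA₁ u)
  have hfin := hbound.trans (add_le_add (mul_le_mul' le_rfl hres) (mul_le_mul' le_rfl (hA₂ u)))
  refine hsob.trans ((mul_le_mul' le_rfl (add_le_add (hA u) hfin)).trans_eq ?_)
  push_cast
  simp only [ENNReal.ofReal]
  ring

/-- The local Sobolev inequality. -/
theorem IsCutoff.exists_eLpNorm_six_le (h : P.IsCutoff χ) (h₁ : P.IsCutoff χ₁) {M : ℝ}
    (hM : ∀ p, |χ p| ≤ M * |χ₁ p| ∧ ‖fderiv ℝ χ p‖ ≤ M * |χ₁ p|) (hn : n = 1 ∨ n = 2)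
    {N : Set B} (hN : MeasurableSet N)
    (hsub : N ∩ (𝓡∂ (n + 1)).interior B ⊆ P.toFun '' {p ∈ P.dom | χ p = 1}) :
    ∃ C : NNReal, ∀ u : 𝔹.TestFunction, eLpNorm u.1 6 (𝔹.vol.restrict N) ≤ C * ‖u‖ₑ := by
  obtain ⟨C, hC⟩ := h.exists_eLpNorm_six_le_aux h₁ hM hn
  obtain ⟨K, hK⟩ := P.lintegral_le_comp
  refine ⟨(K + 1) * C, fun u ↦ ?_⟩
  have hf : Measurable (N.indicator fun z ↦ ‖u.1 z‖ₑ ^ 6) :=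
    (u.2.1.continuous.enorm.measurable.pow_const 6).indicator hN
  have h1 : ∫⁻ z in N, ‖u.1 z‖ₑ ^ 6 ∂𝔹.vol ≤
      ∫⁻ z in P.toFun '' P.dom, N.indicator (fun z ↦ ‖u.1 z‖ₑ ^ 6) z ∂𝔹.vol := by
    rw [setLIntegral_indicator hN]
    refine lintegral_mono_set' ?_
    have hb : ∀ᵐ z ∂𝔹.vol, z ∈ (𝓡∂ (n + 1)).interior B := by
      rw [ae_iff]
      exact measure_mono_null (fun z hz ↦ by rwa [← ModelWithCorners.compl_interior]) 𝔹.vol_boundary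
    filter_upwards [hb] with z hz hzN
    obtain ⟨p, hp, rfl⟩ := hsub ⟨hzN, hz⟩
    exact ⟨hzN, p, hp.1, rfl⟩
  -- The exponent `(n+1)/6` is chosen so that the sixth power of the weight is `exp (-(n+1)t)`.
  -- Injectivity of the parametrization ensures that the cutoff is one at every point over `N`.
  have h2 : ∫⁻ p in P.dom, N.indicator (fun z ↦ ‖u.1 z‖ₑ ^ 6) (P.toFun p) *
      ENNReal.ofReal (Real.exp (-((n : ℝ) + 1) * p 0)) ≤
      ∫⁻ p, ‖Real.exp (-(((n : ℝ) + 1) / 6) * p 0) • (χ p • u.1 (P.toFun p))‖ₑ ^ 6 := by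
    refine (setLIntegral_mono' P.isOpen_dom.measurableSet fun p hp ↦ ?_).trans
      (setLIntegral_le_lintegral P.dom _)
    by_cases hpN : P.toFun p ∈ N
    · obtain ⟨q, hq, hqp⟩ := hsub ⟨hpN, P.mapsTo_interior hp⟩
      have hpq : q = p := P.injOn hq.1 hp hqp
      subst hpq
      rw [indicator_of_mem hpN, hq.2, one_smul, enorm_smul, mul_pow, mul_comm,
        Real.enorm_of_nonneg (Real.exp_pos _).le, ← ENNReal.ofReal_pow (Real.exp_pos _).le,
        ← Real.exp_nat_mul]
      refine le_of_eq ?_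
      congr 3
      push_cast
      ring
    · simp [indicator_of_notMem hpN]
  rw [← ENNReal.pow_le_pow_left_iff (n := 6) (by norm_num)]
  calc eLpNorm u.1 6 (𝔹.vol.restrict N) ^ 6 = ∫⁻ z in N, ‖u.1 z‖ₑ ^ 6 ∂𝔹.vol :=
        eLpNorm_pow_eq_lintegral u.1 (k := 6) (by norm_num)
    _ ≤ K * ∫⁻ p, ‖Real.exp (-(((n : ℝ) + 1) / 6) * p 0) • (χ p • u.1 (P.toFun p))‖ₑ ^ 6 :=
        h1.trans ((hK _ hf).trans (mul_le_mul' le_rfl h2))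
    _ = K * eLpNorm (fun p ↦ Real.exp (-(((n : ℝ) + 1) / 6) * p 0) • (χ p • u.1 (P.toFun p))) 6
          volume ^ 6 := by
        rw [← eLpNorm_pow_eq_lintegral _ (k := 6) (by norm_num)]
        rfl
    _ ≤ (K + 1) ^ 6 * (C * ‖u‖ₑ) ^ 6 := by
        refine mul_le_mul' ?_ (pow_le_pow_left' (hC u) 6)
        exact le_self_add.trans (le_self_pow₀ (le_add_self) (by norm_num))
    _ = _ := by
        push_cast
        ring

end Measure

end Patch

end ConicManifold

namespace ConicManifold

variable {n : ℕ} {Y B : Type*}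
  [TopologicalSpace Y] [ChartedSpace (EuclideanSpace ℝ (Fin n)) Y] [IsManifold (𝓡 n) ∞ Y]
  [TopologicalSpace B] [ChartedSpace (EuclideanHalfSpace (n + 1)) B]
  [IsManifold (𝓡∂ (n + 1)) ∞ B]

/-! ### Patches around interior points -/

theorem abs_coord_le {m : ℕ} (p : EuclideanSpace ℝ (Fin m)) (i : Fin m) : |p i| ≤ ‖p‖ :=
  PiLp.norm_apply_le p i

theorem gram_pos (𝔹 : ConicManifold n Y B) {c z : B}
    (hc : z ∈ (extChartAt (𝓡∂ (n + 1)) c).source) (hz : z ∈ (𝓡∂ (n + 1)).interior B)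
    {v : EuclideanSpace ℝ (Fin (n + 1))} (hv : v ≠ 0) : 0 < ⇑v ⬝ᵥ (𝔹.gram c z *ᵥ ⇑v) := by
  have hb : z ∈ (trivializationAt (EuclideanSpace ℝ (Fin (n + 1)))
      (TangentSpace (𝓡∂ (n + 1)) : B → Type _) c).baseSet := by
    simpa [TangentBundle.trivializationAt_baseSet] using hc
  rw [← g_sum_coordVec, ← symmL_eq_sum_coordVec]
  refine 𝔹.g_pos z hz _ fun h ↦ hv ?_
  have := (trivializationAt (EuclideanSpace ℝ (Fin (n + 1)))
      (TangentSpace (𝓡∂ (n + 1)) : B → Type _) c).continuousLinearMapAt_symmL (R := ℝ) hb v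
  rw [← this, h, map_zero]

/-- In the inverse of a chart, the metric is given by its coefficients. -/
theorem dotProduct_pullGram_extChartAt_symm (𝔹 : ConicManifold n Y B) (c : B)
    {p : EuclideanSpace ℝ (Fin (n + 1))}
    (hp : p ∈ interior (extChartAt (𝓡∂ (n + 1)) c).target) (v : EuclideanSpace ℝ (Fin (n + 1))) :
    ⇑v ⬝ᵥ (𝔹.pullGram (extChartAt (𝓡∂ (n + 1)) c).symm p *ᵥ ⇑v) =
      ⇑v ⬝ᵥ (𝔹.gram c ((extChartAt (𝓡∂ (n + 1)) c).symm p) *ᵥ ⇑v) := by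
  have hnhds : (extChartAt (𝓡∂ (n + 1)) c).target ∈ 𝓝 p := mem_interior_iff_mem_nhds.1 hp
  have hd : MDifferentiableAt 𝓘(ℝ, EuclideanSpace ℝ (Fin (n + 1))) (𝓡∂ (n + 1))
      (extChartAt (𝓡∂ (n + 1)) c).symm p :=
    ((contMDiffOn_extChartAt_symm (n := ∞) c).contMDiffAt hnhds).mdifferentiableAt (by simp)
  have hid : fderiv ℝ (extChartAt (𝓡∂ (n + 1)) c ∘ (extChartAt (𝓡∂ (n + 1)) c).symm) p =
      ContinuousLinearMap.id ℝ _ := by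
    have : extChartAt (𝓡∂ (n + 1)) c ∘ (extChartAt (𝓡∂ (n + 1)) c).symm =ᶠ[𝓝 p] id := by
      filter_upwards [hnhds] with q hq
      exact (extChartAt (𝓡∂ (n + 1)) c).right_inv hq
    rw [this.fderiv_eq, fderiv_id]
  rw [dotProduct_pullGram, mfderiv_eq_sum_coordVec hd
    ((extChartAt (𝓡∂ (n + 1)) c).map_target (interior_subset hp)), hid, g_sum_coordVec]
  rfl

/-- On a small ball the first coordinate is bounded, so the factor `exp (-2t)` is harmless and the
inverse of any chart serves as a patch. -/
theorem exists_interior_patch (𝔹 : ConicManifold n Y B) {b : B}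
    (hb : b ∈ (𝓡∂ (n + 1)).interior B) :
    ∃ (P : 𝔹.Patch) (r : ℝ), 0 < r ∧ P.toFun = (extChartAt (𝓡∂ (n + 1)) b).symm ∧
      P.dom = Metric.ball (extChartAt (𝓡∂ (n + 1)) b b) r ∧
      Metric.ball (extChartAt (𝓡∂ (n + 1)) b b) r ⊆ (extChartAt (𝓡∂ (n + 1)) b).target := by
  set φ := extChartAt (𝓡∂ (n + 1)) b with hφ
  have hφb : φ.symm (φ b) = b := φ.left_inv (mem_extChartAt_source b)
  have h1 : interior φ.target ∈ 𝓝 (φ b) :=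
    isOpen_interior.mem_nhds (ModelWithCorners.isInteriorPoint_iff.1 hb)
  have h2 : φ.symm ⁻¹' (𝓡∂ (n + 1)).interior B ∈ 𝓝 (φ b) := by
    have hcont : ContinuousAt φ.symm (φ b) :=
      (continuousOn_extChartAt_symm b).continuousAt (mem_interior_iff_mem_nhds.1
        (ModelWithCorners.isInteriorPoint_iff.1 hb))
    refine hcont.preimage_mem_nhds ?_
    rw [hφb]
    exact (ModelWithCorners.isOpen_interior (n := ∞) (by simp)).mem_nhds hb
  obtain ⟨r, hr, hsub⟩ := Metric.nhds_basis_closedBall.mem_iff.1 (inter_mem h1 h2)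
  have hbs : Metric.ball (φ b) r ⊆ Metric.closedBall (φ b) r := Metric.ball_subset_closedBall
  have hQ : ContinuousOn (fun q ↦ 𝔹.gram b (φ.symm q)) (Metric.closedBall (φ b) r) :=
    (𝔹.continuousOn_gram b).comp
      ((continuousOn_extChartAt_symm b).mono fun q hq ↦ interior_subset (hsub hq).1)
      fun q hq ↦ ⟨φ.map_target (interior_subset (hsub hq).1), (hsub hq).2⟩
  obtain ⟨a, A, ha, hA, hbd⟩ := exists_quadratic_bounds (isCompact_closedBall (φ b) r) hQ
    fun q hq v hv ↦ 𝔹.gram_pos (φ.map_target (interior_subset (hsub hq).1)) (hsub hq).2 hv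
  have hcoord : ∀ p ∈ Metric.ball (φ b) r, φ b 0 - r ≤ p 0 ∧ p 0 ≤ φ b 0 + r := fun p hp ↦ by
    have h := abs_coord_le (p - φ b) 0
    rw [mem_ball_iff_norm] at hp
    have h' := abs_le.1 (h.trans hp.le)
    simp only [PiLp.sub_apply] at h'
    constructor <;> linarith
  refine ⟨{
    toFun := φ.symm
    dom := Metric.ball (φ b) r
    center := b
    isOpen_dom := Metric.isOpen_ball
    contMDiffOn := (contMDiffOn_extChartAt_symm b).mono fun q hq ↦
      interior_subset (hsub (hbs hq)).1
    injOn := φ.symm.injOn.mono fun q hq ↦ interior_subset (hsub (hbs hq)).1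
    mapsTo_source := fun q hq ↦ φ.map_target (interior_subset (hsub (hbs hq)).1)
    mapsTo_interior := fun q hq ↦ (hsub (hbs hq)).2
    -- The first coordinate lies within `r` of `φ b 0`; the exponential factors in `lower` and
    -- `upper` compensate for `exp (-p 0) ^ 2` in the worst case.
    lower := a * Real.exp (φ b 0 - r) ^ 2
    upper := A * Real.exp (φ b 0 + r) ^ 2
    lower_pos := by positivity
    upper_pos := by positivity
    lower_le := fun p hp v ↦ ?_
    le_upper := fun p hp v ↦ ?_
    inf := φ b 0 - r
    inf_le := fun p hp ↦ (hcoord p hp).1 }, r, hr, rfl, rfl,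
    fun q hq ↦ interior_subset (hsub (hbs hq)).1⟩
  · rw [𝔹.dotProduct_pullGram_extChartAt_symm b (hsub (hbs hp)).1]
    refine le_trans ?_ (hbd p (hbs hp) v).1
    rw [mul_assoc a, ← mul_pow, ← Real.exp_add]
    refine mul_le_mul_of_nonneg_right (mul_le_of_le_one_right ha.le ?_) (by positivity)
    refine pow_le_one₀ (Real.exp_pos _).le (Real.exp_le_one_iff.2 ?_)
    linarith [(hcoord p hp).1]
  · rw [𝔹.dotProduct_pullGram_extChartAt_symm b (hsub (hbs hp)).1]
    refine (hbd p (hbs hp) v).2.trans ?_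
    rw [mul_assoc A, ← mul_pow, ← Real.exp_add]
    refine mul_le_mul_of_nonneg_right (le_mul_of_one_le_right hA.le ?_) (by positivity)
    refine one_le_pow₀ (Real.one_le_exp_iff.2 ?_)
    linarith [(hcoord p hp).2]

theorem Patch.isCutoff_of_hasCompactSupport {𝔹 : ConicManifold n Y B} (P : 𝔹.Patch)
    {χ : EuclideanSpace ℝ (Fin (n + 1)) → ℝ} (h : ContDiff ℝ ∞ χ) (hc : HasCompactSupport χ)
    (hs : tsupport χ ⊆ P.dom) : P.IsCutoff χ where
  contDiff := h
  tsupport_subset := hs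
  hasCompactSupport _ := hc.smul_right
  exists_bound := by
    obtain ⟨M₁, h₁⟩ := hc.exists_bound_of_continuous h.continuous
    obtain ⟨M₂, h₂⟩ := (hc.fderiv ℝ).exists_bound_of_continuous (h.continuous_fderiv (by simp))
    exact ⟨max M₁ M₂, fun p ↦ ⟨(h₁ p).trans (le_max_left _ _), (h₂ p).trans (le_max_right _ _)⟩⟩
  exists_bound_coord := by
    obtain ⟨R, hR⟩ := hc.isCompact.isBounded.subset_closedBall 0
    refine ⟨R + 1, fun p hp ↦ ?_⟩
    have : p ∉ tsupport χ := fun hpt ↦ by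
      have h1 := hR hpt
      rw [mem_closedBall_zero_iff] at h1
      linarith [le_abs_self (p 0), abs_coord_le p 0]
    rw [image_eq_zero_of_notMem_tsupport fun h' ↦ this (tsupport_fderiv_subset ℝ h')]
    rfl

/-- A cutoff function is controlled by a second one that is equal to one on its support. -/
theorem Patch.IsCutoff.exists_le_mul {𝔹 : ConicManifold n Y B} {P : 𝔹.Patch}
    {χ χ₁ : EuclideanSpace ℝ (Fin (n + 1)) → ℝ} (h : P.IsCutoff χ)
    (h₁ : ∀ p ∈ tsupport χ, χ₁ p = 1) :
    ∃ M : ℝ, ∀ p, |χ p| ≤ M * |χ₁ p| ∧ ‖fderiv ℝ χ p‖ ≤ M * |χ₁ p| := by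
  obtain ⟨M, hM⟩ := h.exists_bound
  have hM0 : 0 ≤ M := (abs_nonneg _).trans (hM 0).1
  refine ⟨M, fun p ↦ ?_⟩
  by_cases hp : p ∈ tsupport χ
  · simpa [h₁ p hp] using hM p
  · rw [image_eq_zero_of_notMem_tsupport hp,
      image_eq_zero_of_notMem_tsupport fun h' ↦ hp (tsupport_fderiv_subset ℝ h'), abs_zero,
      norm_zero]
    exact ⟨by positivity, by positivity⟩

theorem exists_bump {E : Type*} [NormedAddCommGroup E] [InnerProductSpace ℝ E]
    [FiniteDimensional ℝ E] (c : E) {r : ℝ} (hr : 0 < r) :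
    ∃ χ : E → ℝ, ContDiff ℝ ∞ χ ∧ HasCompactSupport χ ∧ tsupport χ = Metric.closedBall c (2 * r) ∧
      ∀ p ∈ Metric.closedBall c r, χ p = 1 := by
  let f : ContDiffBump c := ⟨r, 2 * r, hr, by linarith⟩
  exact ⟨f, f.contDiff, f.hasCompactSupport, f.tsupport_eq, fun p hp ↦ f.one_of_mem_closedBall hp⟩

section Measure

variable [MeasurableSpace B] [BorelSpace B]

theorem exists_eLpNorm_six_le_of_mem_interior (𝔹 : ConicManifold n Y B) (hn : n = 1 ∨ n = 2) {b : B}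
    (hb : b ∈ (𝓡∂ (n + 1)).interior B) : ∃ N ∈ 𝓝 b, ∃ C : NNReal, ∀ u : 𝔹.TestFunction,
      eLpNorm u.1 6 (𝔹.vol.restrict N) ≤ C * ‖u‖ₑ := by
  obtain ⟨P, r, hr, hP, hdom, htar⟩ := 𝔹.exists_interior_patch hb
  set φ := extChartAt (𝓡∂ (n + 1)) b with hφ
  -- The support of `χ` is the ball of radius `r / 4`, on which `χ₁` is one; the support of `χ₁` has
  -- radius `r / 2` and stays inside the patch.
  obtain ⟨χ, hχ, hχc, hχs, hχ1⟩ := exists_bump (φ b) (r := r / 8) (by positivity)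
  obtain ⟨χ₁, hχ₁, hχc₁, hχs₁, hχ₁1⟩ := exists_bump (φ b) (r := r / 4) (by positivity)
  have h : P.IsCutoff χ := P.isCutoff_of_hasCompactSupport hχ hχc (by
    rw [hχs, hdom]
    exact Metric.closedBall_subset_ball (by linarith))
  have h₁ : P.IsCutoff χ₁ := P.isCutoff_of_hasCompactSupport hχ₁ hχc₁ (by
    rw [hχs₁, hdom]
    exact Metric.closedBall_subset_ball (by linarith))
  obtain ⟨M, hM⟩ := h.exists_le_mul (χ₁ := χ₁) fun p hp ↦ hχ₁1 p (by
    rw [hχs] at hp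
    exact Metric.closedBall_subset_closedBall (by linarith) hp)
  have hopen : IsOpen (φ.source ∩ φ ⁻¹' Metric.ball (φ b) (r / 8)) :=
    (continuousOn_extChartAt b).isOpen_inter_preimage (isOpen_extChartAt_source b)
      Metric.isOpen_ball
  refine ⟨_, hopen.mem_nhds ⟨mem_extChartAt_source b, Metric.mem_ball_self (by positivity)⟩, ?_⟩
  refine h.exists_eLpNorm_six_le h₁ hM hn hopen.measurableSet ?_
  rintro z ⟨⟨hz, hzb⟩, -⟩
  refine ⟨φ z, ⟨?_, hχ1 _ (Metric.ball_subset_closedBall hzb)⟩, ?_⟩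
  · rw [hdom]
    exact Metric.ball_subset_ball (by linarith) hzb
  · rw [hP]
    exact φ.left_inv hz

end Measure

end ConicManifold

/-- The projection that forgets the first coordinate. -/
noncomputable def tailL (n : ℕ) : EuclideanSpace ℝ (Fin (n + 1)) →L[ℝ] EuclideanSpace ℝ (Fin n) :=
  (EuclideanSpace.equiv (Fin n) ℝ).symm.toContinuousLinearMap ∘L
    ContinuousLinearMap.pi fun i ↦ EuclideanSpace.proj i.succ

@[simp] theorem tailL_apply {n : ℕ} (p : EuclideanSpace ℝ (Fin (n + 1))) (i : Fin n) :
    tailL n p i = p i.succ := rfl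

theorem norm_sq_eq_tailL {n : ℕ} (p : EuclideanSpace ℝ (Fin (n + 1))) :
    ‖p‖ ^ 2 = p 0 ^ 2 + ‖tailL n p‖ ^ 2 := by
  simp [EuclideanSpace.norm_sq_eq, Fin.sum_univ_succ]

/-- The point with a given first coordinate and given remaining coordinates. -/
noncomputable def consPoint {n : ℕ} (t : ℝ) (q : EuclideanSpace ℝ (Fin n)) :
    EuclideanSpace ℝ (Fin (n + 1)) :=
  WithLp.toLp 2 (Fin.cons t ⇑q)

@[simp] theorem consPoint_zero {n : ℕ} (t : ℝ) (q : EuclideanSpace ℝ (Fin n)) :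
    consPoint t q 0 = t := rfl

@[simp] theorem tailL_consPoint {n : ℕ} (t : ℝ) (q : EuclideanSpace ℝ (Fin n)) :
    tailL n (consPoint t q) = q := by
  ext i
  rfl

namespace ConicManifold

variable {n : ℕ} {Y B : Type*}
  [TopologicalSpace Y] [ChartedSpace (EuclideanSpace ℝ (Fin n)) Y] [IsManifold (𝓡 n) ∞ Y]
  [TopologicalSpace B] [ChartedSpace (EuclideanHalfSpace (n + 1)) B]
  [IsManifold (𝓡∂ (n + 1)) ∞ B]

/-! ### The collar -/

theorem collar_mem_interior (𝔹 : ConicManifold n Y B) {x : ℝ} (hx : x ∈ Ioo (0 : ℝ) 1) (y : Y) :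
    𝔹.collar (x, y) ∈ (𝓡∂ (n + 1)).interior B := by
  rw [← ModelWithCorners.compl_boundary, mem_compl_iff, ← 𝔹.collar_image_zero]
  rintro ⟨⟨x', y'⟩, ⟨hx', -⟩, h⟩
  have h1 : (x', y') ∈ 𝔹.collar.source := by
    rw [𝔹.collar_source]
    rw [show x' = 0 from hx']
    exact ⟨left_mem_Ico.2 one_pos, mem_univ _⟩
  have h2 : (x, y) ∈ 𝔹.collar.source := by
    rw [𝔹.collar_source]
    exact ⟨⟨hx.1.le, hx.2⟩, mem_univ _⟩
  have h3 := congrArg Prod.fst (𝔹.collar.injOn h1 h2 h)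
  exact hx.1.ne' (h3.symm.trans hx')

theorem mdifferentiableAt_collar (𝔹 : ConicManifold n Y B) {x : ℝ} (hx : x ∈ Ioo (0 : ℝ) 1)
    (y : Y) : MDifferentiableAt (𝓘(ℝ, ℝ).prod (𝓡 n)) (𝓡∂ (n + 1)) 𝔹.collar (x, y) := by
  refine (𝔹.contMDiffOn_collar.contMDiffAt ?_).mdifferentiableAt (by simp)
  rw [𝔹.collar_source]
  exact prod_mem_nhds (Ico_mem_nhds hx.1 hx.2) univ_mem

/-- The coordinate vector fields of a chart of `Y`. -/
noncomputable def coordVecY (c z : Y) (i : Fin n) : TangentSpace (𝓡 n) z :=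
  (trivializationAt (EuclideanSpace ℝ (Fin n)) (TangentSpace (𝓡 n)) c).symmL ℝ z
    (EuclideanSpace.single i 1)

theorem symmL_eq_sum_coordVecY (c z : Y) (a : EuclideanSpace ℝ (Fin n)) :
    (trivializationAt (EuclideanSpace ℝ (Fin n)) (TangentSpace (𝓡 n)) c).symmL ℝ z a =
      ∑ i, a i • coordVecY c z i := by
  have e : a = ∑ i, a i • (EuclideanSpace.single i 1 : EuclideanSpace ℝ (Fin n)) := by
    ext k
    simp [Finset.sum_apply, Pi.single_apply]
  conv_lhs => rw [e]
  simp only [map_sum, map_smul, coordVecY]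

theorem contMDiffOn_coordVecY (c : Y) (i : Fin n) :
    ContMDiffOn (𝓡 n) (𝓡 n).tangent ∞
      (fun z ↦ (⟨z, coordVecY c z i⟩ : TangentBundle (𝓡 n) Y)) (extChartAt (𝓡 n) c).source := by
  have h := (trivializationAt (EuclideanSpace ℝ (Fin n))
    (TangentSpace (𝓡 n) : Y → Type _) c).contMDiffOn_localFrame_baseSet
    (I := 𝓡 n) (n := ∞) (EuclideanSpace.basisFun (Fin n) ℝ).toBasis i
  rw [TangentBundle.trivializationAt_baseSet, ← extChartAt_source (𝓡 n)] at h
  refine h.congr fun z hz ↦ ?_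
  have hz' : z ∈ (trivializationAt (EuclideanSpace ℝ (Fin n))
    (TangentSpace (𝓡 n) : Y → Type _) c).baseSet := by
    rw [TangentBundle.trivializationAt_baseSet, ← extChartAt_source (𝓡 n)]
    exact hz
  simp only [Trivialization.localFrame_apply_of_mem_baseSet _ _ hz', coordVecY,
    Trivialization.basisAt]
  simp
  exact Trivialization.symmL_apply _ hz' _

/-- The coefficients of `h(x)` in a chart of `Y`. -/
noncomputable def hMatrix (𝔹 : ConicManifold n Y B) (c : Y) (q : ℝ × Y) :
    Matrix (Fin n) (Fin n) ℝ :=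
  Matrix.of fun i j ↦ 𝔹.h q.1 q.2 (coordVecY c q.2 i) (coordVecY c q.2 j)

theorem continuousOn_hMatrix (𝔹 : ConicManifold n Y B) (c : Y) :
    ContinuousOn (𝔹.hMatrix c) (Ico 0 1 ×ˢ (extChartAt (𝓡 n) c).source) := by
  refine continuousOn_pi.2 fun i ↦ continuousOn_pi.2 fun j ↦ ?_
  have hs : MapsTo (Prod.snd : ℝ × Y → Y) (Ico (0 : ℝ) 1 ×ˢ (extChartAt (𝓡 n) c).source)
    (extChartAt (𝓡 n) c).source := fun q hq ↦ hq.2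
  have h := ContMDiffOn.clm_bundle_apply₂ (𝕜 := ℝ)
    (E₃ := fun _ : Y ↦ ℝ) (F₃ := ℝ)
    (𝔹.contMDiffOn_h.mono (prod_mono_right (subset_univ (extChartAt (𝓡 n) c).source)))
    ((contMDiffOn_coordVecY c i).comp (contMDiffOn_snd (I := 𝓘(ℝ, ℝ))) hs)
    ((contMDiffOn_coordVecY c j).comp (contMDiffOn_snd (I := 𝓘(ℝ, ℝ))) hs)
  intro z hz
  have h' := h z hz
  simp only [contMDiffWithinAt_totalSpace] at h'
  exact h'.2.continuousWithinAt

theorem h_sum_coordVecY (𝔹 : ConicManifold n Y B) (c : Y) (q : ℝ × Y) (a b : Fin n → ℝ) :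
    𝔹.h q.1 q.2 (∑ i, a i • coordVecY c q.2 i) (∑ i, b i • coordVecY c q.2 i) =
      a ⬝ᵥ (𝔹.hMatrix c q *ᵥ b) := by
  simp only [dotProduct, Matrix.mulVec, hMatrix, Matrix.of_apply, map_sum, map_smul, sum_apply,
    smul_apply, smul_eq_mul, Finset.mul_sum]
  rw [Finset.sum_comm]
  refine Finset.sum_congr rfl fun i _ ↦ Finset.sum_congr rfl fun j _ ↦ ?_
  ring

theorem hMatrix_pos (𝔹 : ConicManifold n Y B) {c : Y} {q : ℝ × Y}
    (hq : q ∈ Ico (0 : ℝ) 1 ×ˢ (extChartAt (𝓡 n) c).source)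
    {v : EuclideanSpace ℝ (Fin n)} (hv : v ≠ 0) : 0 < ⇑v ⬝ᵥ (𝔹.hMatrix c q *ᵥ ⇑v) := by
  have hb : q.2 ∈ (trivializationAt (EuclideanSpace ℝ (Fin n))
      (TangentSpace (𝓡 n) : Y → Type _) c).baseSet := by
    simpa [TangentBundle.trivializationAt_baseSet] using hq.2
  rw [← h_sum_coordVecY, ← symmL_eq_sum_coordVecY]
  refine 𝔹.h_pos q.1 hq.1 _ _ fun h ↦ hv ?_
  have := (trivializationAt (EuclideanSpace ℝ (Fin n))
      (TangentSpace (𝓡 n) : Y → Type _) c).continuousLinearMapAt_symmL (R := ℝ) hb v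
  rw [← this, h, map_zero]

/-- The collar in exponential coordinates. -/
noncomputable def collarMap (𝔹 : ConicManifold n Y B) (c : Y)
    (p : EuclideanSpace ℝ (Fin (n + 1))) : B :=
  𝔹.collar (Real.exp (-p 0), (extChartAt (𝓡 n) c).symm (tailL n p))

theorem exp_neg_mem_Ioo {t : ℝ} (ht : 0 < t) : Real.exp (-t) ∈ Ioo (0 : ℝ) 1 :=
  ⟨Real.exp_pos _, by rw [Real.exp_lt_one_iff]; linarith⟩

theorem contMDiffOn_collarMap_aux (c : Y) :
    ContMDiffOn 𝓘(ℝ, EuclideanSpace ℝ (Fin (n + 1))) (𝓘(ℝ, ℝ).prod (𝓡 n)) ∞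
      (fun p : EuclideanSpace ℝ (Fin (n + 1)) ↦
        (Real.exp (-p 0), (extChartAt (𝓡 n) c).symm (tailL n p)))
      {p | 0 < p 0 ∧ tailL n p ∈ (extChartAt (𝓡 n) c).target} := by
  have h0 : ContDiff ℝ ∞ fun p : EuclideanSpace ℝ (Fin (n + 1)) ↦ Real.exp (-p 0) := by
    have := contDiff_exp_coord (m := n) 1
    simpa using this
  refine ContMDiffOn.prodMk h0.contMDiff.contMDiffOn ?_
  exact (contMDiffOn_extChartAt_symm c).comp (tailL n).contDiff.contMDiff.contMDiffOn
    fun p hp ↦ hp.2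

theorem contMDiffOn_collarMap (𝔹 : ConicManifold n Y B) (c : Y) :
    ContMDiffOn 𝓘(ℝ, EuclideanSpace ℝ (Fin (n + 1))) (𝓡∂ (n + 1)) ∞ (𝔹.collarMap c)
      {p | 0 < p 0 ∧ tailL n p ∈ (extChartAt (𝓡 n) c).target} := by
  refine 𝔹.contMDiffOn_collar.comp (contMDiffOn_collarMap_aux c) fun p hp ↦ ?_
  rw [mem_preimage, 𝔹.collar_source]
  exact ⟨Ioo_subset_Ico_self (exp_neg_mem_Ioo hp.1), mem_univ _⟩

/-- The metric in exponential coordinates on the collar. -/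
theorem dotProduct_pullGram_collarMap (𝔹 : ConicManifold n Y B) (c : Y)
    {p : EuclideanSpace ℝ (Fin (n + 1))} (hp0 : 0 < p 0)
    (hp : tailL n p ∈ (extChartAt (𝓡 n) c).target) (v : EuclideanSpace ℝ (Fin (n + 1))) :
    ⇑v ⬝ᵥ (𝔹.pullGram (𝔹.collarMap c) p *ᵥ ⇑v) =
      Real.exp (-p 0) ^ 2 * (v 0 ^ 2 + ⇑(tailL n v) ⬝ᵥ
        (𝔹.hMatrix c (Real.exp (-p 0), (extChartAt (𝓡 n) c).symm (tailL n p)) *ᵥ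
          ⇑(tailL n v))) := by
  set κ := extChartAt (𝓡 n) c with hκ
  set x := Real.exp (-p 0) with hx
  set y := κ.symm (tailL n p) with hy
  have hxI : x ∈ Ioo (0 : ℝ) 1 := exp_neg_mem_Ioo hp0
  have h1 : HasMFDerivAt 𝓘(ℝ, EuclideanSpace ℝ (Fin (n + 1))) 𝓘(ℝ, ℝ)
      (fun p : EuclideanSpace ℝ (Fin (n + 1)) ↦ Real.exp (-p 0)) p
      ((-x) • (EuclideanSpace.proj (0 : Fin (n + 1)) : EuclideanSpace ℝ (Fin (n + 1)) →L[ℝ] ℝ)) := by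
    have h := ((contDiff_exp_coord (m := n) 1).differentiable (by simp) p).hasFDerivAt
    rw [fderiv_exp_coord] at h
    simp only [neg_mul, one_mul] at h
    exact h.hasMFDerivAt
  have hyκ : y ∈ κ.source := κ.map_target hp
  have h2 : HasMFDerivAt (𝓡 n) (𝓡 n) κ.symm (tailL n p)
      ((trivializationAt (EuclideanSpace ℝ (Fin n)) (TangentSpace (𝓡 n)) c).symmL ℝ y) := by
    have hc : y ∈ (chartAt (EuclideanSpace ℝ (Fin n)) c).source := by
      simpa [hκ] using! hyκ
    rw [TangentBundle.symmL_trivializationAt hc]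
    have e : extChartAt (𝓡 n) c y = tailL n p := κ.right_inv hp
    have hr : range (𝓡 n) = univ := by simp
    rw [e, hr, mfderivWithin_univ]
    exact ((contMDiffOn_extChartAt_symm (n := ∞) c).contMDiffAt
      ((isOpen_extChartAt_target c).mem_nhds hp)).mdifferentiableAt (by simp) |>.hasMFDerivAt
  have h3 : HasMFDerivAt 𝓘(ℝ, EuclideanSpace ℝ (Fin (n + 1))) (𝓡 n) (tailL n) p (tailL n) :=
    (tailL n).hasFDerivAt.hasMFDerivAt
  -- Since `dx = -x dt`, the radial part `dx²` becomes `x² dt²`, so that `x²` is a common factor of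
  -- the whole metric.
  have h4 := h1.prodMk (h2.comp p h3)
  have h5 := (𝔹.mdifferentiableAt_collar hxI y).hasMFDerivAt.comp p h4
  have h6 : mfderiv 𝓘(ℝ, EuclideanSpace ℝ (Fin (n + 1))) (𝓡∂ (n + 1)) (𝔹.collarMap c) p v =
      mfderiv (𝓘(ℝ, ℝ).prod (𝓡 n)) (𝓡∂ (n + 1)) 𝔹.collar (x, y)
        (-x * v 0, (trivializationAt (EuclideanSpace ℝ (Fin n)) (TangentSpace (𝓡 n)) c).symmL ℝ y
          (tailL n v)) := by
    have h7 := h5.mfderiv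
    exact congrArg (fun L ↦ L v) h7
  rw [dotProduct_pullGram, h6]
  refine (𝔹.g_collar x hxI y _ _ _ _).trans ?_
  rw [symmL_eq_sum_coordVecY]
  have := 𝔹.h_sum_coordVecY c (x, y) (tailL n v) (tailL n v)
  rw [← this]
  ring

end ConicManifold

namespace ConicManifold

variable {n : ℕ} {Y B : Type*}
  [TopologicalSpace Y] [ChartedSpace (EuclideanSpace ℝ (Fin n)) Y] [IsManifold (𝓡 n) ∞ Y]
  [TopologicalSpace B] [ChartedSpace (EuclideanHalfSpace (n + 1)) B]
  [IsManifold (𝓡∂ (n + 1)) ∞ B]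

/-! ### Patches around boundary points -/

theorem continuousOn_collar_chart (𝔹 : ConicManifold n Y B) (c : Y) :
    ContinuousOn (fun q : ℝ × EuclideanSpace ℝ (Fin n) ↦
      𝔹.collar (q.1, (extChartAt (𝓡 n) c).symm q.2))
      (Ico 0 1 ×ˢ (extChartAt (𝓡 n) c).target) := by
  refine 𝔹.contMDiffOn_collar.continuousOn.comp (continuousOn_fst.prodMk
    ((continuousOn_extChartAt_symm c).comp continuousOn_snd fun q hq ↦ hq.2)) fun q hq ↦ ?_
  rw [𝔹.collar_source]
  exact ⟨hq.1, mem_univ _⟩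

/-- Because `h` is continuous up to `x = 0`, it has uniform bounds on the compact set `[0, ε]` times
a closed ball, tip included. These bounds hold on the whole half-cylinder `t > -log ε`, which is
unbounded in `t`. -/
theorem exists_collar_patch (𝔹 : ConicManifold n Y B) (y : Y) :
    ∃ (P : 𝔹.Patch) (r T : ℝ), 0 < r ∧ 0 < T ∧ P.toFun = 𝔹.collarMap y ∧
      P.dom = {p | T < p 0 ∧ tailL n p ∈ Metric.ball (extChartAt (𝓡 n) y y) r} ∧
      Metric.closedBall (extChartAt (𝓡 n) y y) r ⊆ (extChartAt (𝓡 n) y).target := by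
  set κ := extChartAt (𝓡 n) y with hκ
  set b := 𝔹.collar (0, y) with hb
  have hy : κ.symm (κ y) = y := κ.left_inv (mem_extChartAt_source y)
  have hmem : ((0 : ℝ), κ y) ∈ Ico (0 : ℝ) 1 ×ˢ κ.target :=
    ⟨left_mem_Ico.2 one_pos, mem_extChartAt_target y⟩
  have h1 := (𝔹.continuousOn_collar_chart y) (0, κ y) hmem
  have h2 := h1.preimage_mem_nhdsWithin (t := (extChartAt (𝓡∂ (n + 1)) b).source) (by
    change (extChartAt (𝓡∂ (n + 1)) b).source ∈ 𝓝 (𝔹.collar (0, κ.symm (κ y)))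
    rw [hy]
    exact extChartAt_source_mem_nhds b)
  -- A patch must lie in a single chart of `B`. By continuity of the collar at `(0, y)` a small box
  -- around it maps into the chart at the boundary point `b`; `ε` and `r` are then taken below `ρ`.
  obtain ⟨ρ, hρ, hρsub⟩ := Metric.mem_nhdsWithin_iff.1 h2
  obtain ⟨r₀, hr₀, hr₀sub⟩ := Metric.nhds_basis_closedBall.mem_iff.1
    (extChartAt_target_mem_nhds (I := 𝓡 n) y)
  set ε := min ρ 1 / 2 with hε
  have hε0 : 0 < ε := by positivity
  have hε1 : ε ≤ 1 / 2 := by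
    have := min_le_right ρ 1
    linarith
  have hερ : ε < ρ := by
    have := min_le_left ρ 1
    linarith
  set r := min r₀ (ρ / 2) with hr
  have hr0 : 0 < r := by positivity
  have hrρ : r < ρ := (min_le_right _ _).trans_lt (by linarith)
  have hrsub : Metric.closedBall (κ y) r ⊆ κ.target :=
    (Metric.closedBall_subset_closedBall (min_le_left _ _)).trans hr₀sub
  have hbs : Metric.ball (κ y) r ⊆ Metric.closedBall (κ y) r := Metric.ball_subset_closedBall
  have hQ : ContinuousOn (fun q : ℝ × EuclideanSpace ℝ (Fin n) ↦ 𝔹.hMatrix y (q.1, κ.symm q.2))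
      (Icc 0 ε ×ˢ Metric.closedBall (κ y) r) := by
    refine (𝔹.continuousOn_hMatrix y).comp (continuousOn_fst.prodMk
      ((continuousOn_extChartAt_symm y).comp continuousOn_snd fun q hq ↦ hrsub hq.2)) ?_
    exact fun q hq ↦ ⟨⟨hq.1.1, hq.1.2.trans_lt (by linarith)⟩, κ.map_target (hrsub hq.2)⟩
  obtain ⟨a, A, ha, hA, hbd⟩ := exists_quadratic_bounds
    (isCompact_Icc.prod (isCompact_closedBall (κ y) r)) hQ fun q hq v hv ↦
      𝔹.hMatrix_pos ⟨⟨hq.1.1, hq.1.2.trans_lt (by linarith)⟩, κ.map_target (hrsub hq.2)⟩ hv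
  have hT : 0 < -Real.log ε := by
    rw [Left.neg_pos_iff]
    exact Real.log_neg hε0 (by linarith)
  have hexp : ∀ t, -Real.log ε < t → Real.exp (-t) < ε := fun t ht ↦ by
    rw [← Real.lt_log_iff_exp_lt hε0]
    linarith
  have hIcc : ∀ p : EuclideanSpace ℝ (Fin (n + 1)),
      -Real.log ε < p 0 ∧ tailL n p ∈ Metric.ball (κ y) r →
      (Real.exp (-p 0), tailL n p) ∈ Icc 0 ε ×ˢ Metric.closedBall (κ y) r := fun p hp ↦
    ⟨⟨(Real.exp_pos _).le, (hexp _ hp.1).le⟩, hbs hp.2⟩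
  refine ⟨{
    toFun := 𝔹.collarMap y
    dom := {p | -Real.log ε < p 0 ∧ tailL n p ∈ Metric.ball (κ y) r}
    center := b
    isOpen_dom := ?_
    contMDiffOn := (𝔹.contMDiffOn_collarMap y).mono fun p hp ↦
      ⟨hT.trans hp.1, hrsub (hbs hp.2)⟩
    injOn := ?_
    mapsTo_source := ?_
    mapsTo_interior := fun p hp ↦ 𝔹.collar_mem_interior (exp_neg_mem_Ioo (hT.trans hp.1)) _
    -- The value `1` is the coefficient of `dt²`, and `a` and `A` bound `h`.
    lower := min a 1
    upper := max A 1
    lower_pos := by positivity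
    upper_pos := by positivity
    lower_le := fun p hp v ↦ ?_
    le_upper := fun p hp v ↦ ?_
    inf := -Real.log ε
    inf_le := fun p hp ↦ hp.1.le }, r, -Real.log ε, hr0, hT, rfl, rfl, hrsub⟩
  · refine IsOpen.inter ?_ (Metric.isOpen_ball.preimage (tailL n).continuous)
    exact isOpen_lt continuous_const (EuclideanSpace.proj (0 : Fin (n + 1)) :
      EuclideanSpace ℝ (Fin (n + 1)) →L[ℝ] ℝ).continuous
  · intro p hp q hq hpq
    have hs : ∀ p : EuclideanSpace ℝ (Fin (n + 1)), -Real.log ε < p 0 →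
        ∀ y, (Real.exp (-p 0), y) ∈ 𝔹.collar.source := fun p hp y ↦ by
      rw [𝔹.collar_source]
      exact ⟨Ioo_subset_Ico_self (exp_neg_mem_Ioo (hT.trans hp)), mem_univ _⟩
    have h := 𝔹.collar.injOn (hs p hp.1 _) (hs q hq.1 _) hpq
    have h0 : p 0 = q 0 := by simpa using congrArg Prod.fst h
    have h1 : tailL n p = tailL n q :=
      κ.symm.injOn (hrsub (hbs hp.2)) (hrsub (hbs hq.2)) (congrArg Prod.snd h)
    ext i
    refine Fin.cases h0 (fun j ↦ ?_) i
    exact congrArg (fun w : EuclideanSpace ℝ (Fin n) ↦ w j) h1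
  · intro p hp
    refine hρsub (a := (Real.exp (-p 0), tailL n p)) ⟨?_, ?_, hrsub (hbs hp.2)⟩
    · rw [mem_ball_iff_norm, Prod.norm_def]
      refine max_lt ?_ ((mem_ball_iff_norm.1 hp.2).trans hrρ)
      simp only [Prod.fst_sub, sub_zero, Real.norm_of_nonneg (Real.exp_pos _).le]
      exact (hexp _ hp.1).trans hερ
    · exact Ioo_subset_Ico_self (exp_neg_mem_Ioo (hT.trans hp.1))
  · rw [𝔹.dotProduct_pullGram_collarMap y (hT.trans hp.1) (hrsub (hbs hp.2)), norm_sq_eq_tailL,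
      mul_comm (min a 1), mul_assoc]
    refine mul_le_mul_of_nonneg_left ?_ (by positivity)
    have h := (hbd _ (hIcc p hp) (tailL n v)).1
    have e1 : min a 1 * ‖tailL n v‖ ^ 2 ≤ a * ‖tailL n v‖ ^ 2 :=
      mul_le_mul_of_nonneg_right (min_le_left _ _) (by positivity)
    have e2 : min a 1 * v 0 ^ 2 ≤ 1 * v 0 ^ 2 :=
      mul_le_mul_of_nonneg_right (min_le_right _ _) (by positivity)
    rw [mul_add]
    linarith
  · rw [𝔹.dotProduct_pullGram_collarMap y (hT.trans hp.1) (hrsub (hbs hp.2)), norm_sq_eq_tailL,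
      mul_comm (max A 1), mul_assoc]
    refine mul_le_mul_of_nonneg_left ?_ (by positivity)
    have h := (hbd _ (hIcc p hp) (tailL n v)).2
    have e1 : A * ‖tailL n v‖ ^ 2 ≤ max A 1 * ‖tailL n v‖ ^ 2 :=
      mul_le_mul_of_nonneg_right (le_max_left _ _) (by positivity)
    have e2 : 1 * v 0 ^ 2 ≤ max A 1 * v 0 ^ 2 :=
      mul_le_mul_of_nonneg_right (le_max_right _ _) (by positivity)
    rw [mul_add]
    linarith

end ConicManifold

/-! ### Cutoff functions on half-cylinders -/

theorem exists_abs_deriv_smoothTransition_le : ∃ K : ℝ, ∀ t, |deriv Real.smoothTransition t| ≤ K := by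
  have hc : HasCompactSupport (deriv Real.smoothTransition) := by
    refine HasCompactSupport.intro (isCompact_Icc (a := 0) (b := 1)) fun t ht ↦ ?_
    rw [mem_Icc, not_and_or, not_le, not_le] at ht
    rcases ht with ht | ht
    · have : Real.smoothTransition =ᶠ[𝓝 t] fun _ ↦ 0 := by
        filter_upwards [Iio_mem_nhds ht] with q hq
        exact Real.smoothTransition.zero_of_nonpos hq.le
      rw [this.deriv_eq, deriv_const]
    · have : Real.smoothTransition =ᶠ[𝓝 t] fun _ ↦ 1 := by
        filter_upwards [Ioi_mem_nhds ht] with q hq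
        exact Real.smoothTransition.one_of_one_le hq.le
      rw [this.deriv_eq, deriv_const]
  exact hc.exists_bound_of_continuous
    ((Real.smoothTransition.contDiff (n := 1)).continuous_deriv le_rfl)

/-- A cutoff function on a half-cylinder. -/
noncomputable def collarCutoff {n : ℕ} (s : ℝ) (ζ : EuclideanSpace ℝ (Fin n) → ℝ)
    (p : EuclideanSpace ℝ (Fin (n + 1))) : ℝ :=
  Real.smoothTransition (p 0 - s) • ζ (tailL n p)

section CollarCutoff

variable {n : ℕ} {s : ℝ} {ζ : EuclideanSpace ℝ (Fin n) → ℝ}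

theorem contDiff_smoothTransition_coord :
    ContDiff ℝ ∞ fun p : EuclideanSpace ℝ (Fin (n + 1)) ↦ Real.smoothTransition (p 0 - s) :=
  Real.smoothTransition.contDiff.comp ((EuclideanSpace.proj (0 : Fin (n + 1)) :
    EuclideanSpace ℝ (Fin (n + 1)) →L[ℝ] ℝ).contDiff.sub contDiff_const)

theorem contDiff_collarCutoff (hζ : ContDiff ℝ ∞ ζ) : ContDiff ℝ ∞ (collarCutoff s ζ) :=
  contDiff_smoothTransition_coord.smul (hζ.comp (tailL n).contDiff)

theorem tsupport_collarCutoff_subset :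
    tsupport (collarCutoff s ζ) ⊆ {p | s ≤ p 0 ∧ tailL n p ∈ tsupport ζ} := by
  refine closure_minimal (fun p hp ↦ ?_) ?_
  · have hp' : Real.smoothTransition (p 0 - s) • ζ (tailL n p) ≠ 0 := hp
    refine ⟨?_, subset_tsupport _ fun h ↦ hp' (by simp [h])⟩
    by_contra! h
    exact hp' (by rw [Real.smoothTransition.zero_of_nonpos (by linarith), zero_smul])
  · refine IsClosed.inter ?_ ((isClosed_tsupport ζ).preimage (tailL n).continuous)
    exact isClosed_le continuous_const (EuclideanSpace.proj (0 : Fin (n + 1)) :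
      EuclideanSpace ℝ (Fin (n + 1)) →L[ℝ] ℝ).continuous

theorem collarCutoff_of_le {p : EuclideanSpace ℝ (Fin (n + 1))} (hp : s + 1 ≤ p 0) :
    collarCutoff s ζ p = ζ (tailL n p) := by
  rw [collarCutoff, Real.smoothTransition.one_of_one_le (by linarith), one_smul]

theorem exists_bound_collarCutoff (hζ : ContDiff ℝ ∞ ζ) (hc : HasCompactSupport ζ) :
    ∃ M : ℝ, ∀ p, |collarCutoff s ζ p| ≤ M ∧ ‖fderiv ℝ (collarCutoff s ζ) p‖ ≤ M := by
  obtain ⟨K, hK⟩ := exists_abs_deriv_smoothTransition_le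
  obtain ⟨M₁, h₁⟩ := hc.exists_bound_of_continuous hζ.continuous
  obtain ⟨M₂, h₂⟩ := (hc.fderiv ℝ).exists_bound_of_continuous (hζ.continuous_fderiv (by simp))
  have hK0 : 0 ≤ K := (abs_nonneg _).trans (hK 0)
  have hM₂ : 0 ≤ M₂ := (norm_nonneg _).trans (h₂ 0)
  have hη : ∀ t, |Real.smoothTransition t| ≤ 1 := fun t ↦ by
    rw [abs_of_nonneg (Real.smoothTransition.nonneg t)]
    exact Real.smoothTransition.le_one t
  have hproj : ‖(EuclideanSpace.proj (0 : Fin (n + 1)) :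
      EuclideanSpace ℝ (Fin (n + 1)) →L[ℝ] ℝ)‖ ≤ 1 :=
    ContinuousLinearMap.opNorm_le_bound _ zero_le_one fun v ↦ by
      rw [one_mul]
      exact PiLp.norm_apply_le v 0
  have hdη : ∀ p : EuclideanSpace ℝ (Fin (n + 1)),
      ‖fderiv ℝ (fun p : EuclideanSpace ℝ (Fin (n + 1)) ↦ Real.smoothTransition (p 0 - s)) p‖ ≤
        K := fun p ↦ by
    have h1 : HasDerivAt Real.smoothTransition (deriv Real.smoothTransition (p 0 - s)) (p 0 - s) :=
      ((Real.smoothTransition.contDiff (n := 1)).differentiable one_ne_zero _).hasDerivAt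
    have h2 := h1.comp_hasFDerivAt p (((EuclideanSpace.proj (0 : Fin (n + 1)) :
      EuclideanSpace ℝ (Fin (n + 1)) →L[ℝ] ℝ).hasFDerivAt (x := p)).sub_const s)
    refine (congrArg norm h2.fderiv).trans_le ?_
    rw [norm_smul]
    exact (mul_le_mul (hK _) hproj (norm_nonneg _) hK0).trans_eq (mul_one _)
  have hdζ : ∀ p : EuclideanSpace ℝ (Fin (n + 1)),
      ‖fderiv ℝ (fun p ↦ ζ (tailL n p)) p‖ ≤ M₂ * ‖tailL n‖ := fun p ↦ by
    have h2 := ((hζ.differentiable (by simp) (tailL n p)).hasFDerivAt.comp p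
      (tailL n).hasFDerivAt)
    refine (congrArg norm h2.fderiv).trans_le ?_
    refine (ContinuousLinearMap.opNorm_comp_le _ _).trans ?_
    exact mul_le_mul_of_nonneg_right (h₂ _) (norm_nonneg _)
  refine ⟨max M₁ (1 * (M₂ * ‖tailL n‖) + K * M₁), fun p ↦ ⟨le_max_of_le_left ?_,
    le_max_of_le_right ?_⟩⟩
  · rw [collarCutoff, smul_eq_mul, abs_mul]
    exact (mul_le_of_le_one_left (abs_nonneg _) (hη _)).trans (h₁ _)
  · refine (norm_fderiv_smul_le (contDiff_smoothTransition_coord.differentiable (by simp) p)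
      ((hζ.comp (tailL n).contDiff).differentiable (by simp) p)).trans ?_
    exact add_le_add (mul_le_mul (hη _) (hdζ p) (norm_nonneg _) zero_le_one)
      (mul_le_mul (hdη p) (h₁ _) (norm_nonneg _) hK0)

theorem fderiv_collarCutoff_single (hζ : ContDiff ℝ ∞ ζ) {p : EuclideanSpace ℝ (Fin (n + 1))}
    (hp : s + 2 ≤ p 0) :
    fderiv ℝ (collarCutoff s ζ) p (EuclideanSpace.single 0 1) = 0 := by
  have h1 : collarCutoff s ζ =ᶠ[𝓝 p] fun p ↦ ζ (tailL n p) := by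
    -- The cutoff is independent of `t` from `s + 1` on; asking for `s + 2` leaves room for a whole
    -- neighbourhood of `p`.
    have : {q : EuclideanSpace ℝ (Fin (n + 1)) | s + 1 < q 0} ∈ 𝓝 p :=
      (isOpen_lt continuous_const (EuclideanSpace.proj (0 : Fin (n + 1)) :
        EuclideanSpace ℝ (Fin (n + 1)) →L[ℝ] ℝ).continuous).mem_nhds
        (show s + 1 < p 0 by linarith)
    filter_upwards [this] with q hq
    exact collarCutoff_of_le (le_of_lt hq)
  have h2 := (hζ.differentiable (by simp) (tailL n p)).hasFDerivAt.comp p (tailL n).hasFDerivAt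
  have h3 : tailL n (EuclideanSpace.single 0 1) = 0 := by
    ext i
    simp
  rw [h1.fderiv_eq, show fderiv ℝ (fun p ↦ ζ (tailL n p)) p = _ from h2.fderiv,
    ContinuousLinearMap.comp_apply, h3, map_zero]

end CollarCutoff

/-! ### The Sobolev estimate near the boundary -/

namespace ConicManifold

variable {n : ℕ} {Y B : Type*}
  [TopologicalSpace Y] [ChartedSpace (EuclideanSpace ℝ (Fin n)) Y] [IsManifold (𝓡 n) ∞ Y]
  [TopologicalSpace B] [ChartedSpace (EuclideanHalfSpace (n + 1)) B]
  [IsManifold (𝓡∂ (n + 1)) ∞ B]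

/-- In exponential coordinates, test functions vanish near infinity. -/
theorem hasCompactSupport_collarCutoff (𝔹 : ConicManifold n Y B) (y : Y) {s : ℝ} (hs : 0 < s)
    {ζ : EuclideanSpace ℝ (Fin n) → ℝ} (hc : HasCompactSupport ζ)
    (hζ : tsupport ζ ⊆ (extChartAt (𝓡 n) y).target) (u : 𝔹.TestFunction) :
    HasCompactSupport fun p ↦ collarCutoff s ζ p • u.1 (𝔹.collarMap y p) := by
  set κ := extChartAt (𝓡 n) y with hκ
  set F := fun q : ℝ × EuclideanSpace ℝ (Fin n) ↦ 𝔹.collar (q.1, κ.symm q.2) with hF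
  set K := Icc 0 (Real.exp (-s)) ×ˢ tsupport ζ with hK
  have hs1 : Real.exp (-s) < 1 := (exp_neg_mem_Ioo hs).2
  have hKc : IsCompact K := isCompact_Icc.prod hc
  have hFK : ContinuousOn F K := (𝔹.continuousOn_collar_chart y).mono fun q hq ↦
    ⟨⟨hq.1.1, hq.1.2.trans_lt hs1⟩, hζ hq.2⟩
  have hL : IsCompact (K ∩ F ⁻¹' tsupport u.1) :=
    hKc.of_isClosed_subset (hFK.preimage_isClosed_of_isClosed hKc.isClosed (isClosed_tsupport _))
      inter_subset_left
  -- Points with `x = 0` lie on the boundary, which the support of a test function avoids. By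
  -- compactness `x` has a positive lower bound `x₀` there, and therefore `t ≤ -log x₀`.
  have hpos : ∀ q ∈ K ∩ F ⁻¹' tsupport u.1, 0 < q.1 := by
    rintro ⟨x, q⟩ ⟨hq, hqu⟩
    refine lt_of_le_of_ne hq.1.1 fun h0 ↦ ?_
    have h1 : F (x, q) ∈ (𝓡∂ (n + 1)).boundary B := by
      rw [← 𝔹.collar_image_zero]
      exact ⟨(x, κ.symm q), ⟨h0.symm, mem_univ _⟩, rfl⟩
    rw [← ModelWithCorners.compl_interior] at h1
    exact h1 (u.2.2.2 hqu)
  obtain ⟨x₀, hx₀, hmin⟩ : ∃ x₀ : ℝ, 0 < x₀ ∧ ∀ q ∈ K ∩ F ⁻¹' tsupport u.1, x₀ ≤ q.1 := by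
    rcases (K ∩ F ⁻¹' tsupport u.1).eq_empty_or_nonempty with h | h
    · exact ⟨1, one_pos, fun q hq ↦ by simp [h] at hq⟩
    · obtain ⟨q, hq, hqm⟩ := hL.exists_isMinOn h continuousOn_fst
      exact ⟨q.1, hpos q hq, fun q' hq' ↦ hqm hq'⟩
  obtain ⟨R, hR⟩ := hc.isCompact.isBounded.subset_closedBall 0
  refine HasCompactSupport.intro (isCompact_closedBall (0 : EuclideanSpace ℝ (Fin (n + 1)))
    (√((-Real.log x₀) ^ 2 + R ^ 2))) fun p hp ↦ ?_
  by_contra hne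
  refine hp ?_
  have h1 : p ∈ tsupport (collarCutoff s ζ) := subset_tsupport _ fun h ↦ hne (by simp [h])
  have h2 := tsupport_collarCutoff_subset h1
  have h3 : u.1 (𝔹.collarMap y p) ≠ 0 := fun h ↦ hne (by simp [h])
  have h4 : x₀ ≤ Real.exp (-p 0) := hmin (Real.exp (-p 0), tailL n p)
    ⟨⟨⟨(Real.exp_pos _).le, Real.exp_le_exp.2 (neg_le_neg h2.1)⟩, h2.2⟩, subset_tsupport _ h3⟩
  have h5 : p 0 ≤ -Real.log x₀ := by
    have := (Real.log_le_iff_le_exp hx₀).2 h4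
    linarith
  have h6 : 0 ≤ p 0 := hs.le.trans h2.1
  have h7 : ‖tailL n p‖ ≤ R := by simpa using hR h2.2
  rw [mem_closedBall_zero_iff]
  refine Real.le_sqrt_of_sq_le ?_
  rw [norm_sq_eq_tailL]
  exact add_le_add (pow_le_pow_left₀ h6 h5 2) (pow_le_pow_left₀ (norm_nonneg _) h7 2)

section Measure

variable [MeasurableSpace B] [BorelSpace B]

theorem exists_eLpNorm_six_le_of_mem_boundary (𝔹 : ConicManifold n Y B) (hn : n = 1 ∨ n = 2) {b : B}
    (hb : b ∈ (𝓡∂ (n + 1)).boundary B) : ∃ N ∈ 𝓝 b, ∃ C : NNReal, ∀ u : 𝔹.TestFunction,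
      eLpNorm u.1 6 (𝔹.vol.restrict N) ≤ C * ‖u‖ₑ := by
  rw [← 𝔹.collar_image_zero] at hb
  obtain ⟨⟨x, y⟩, ⟨hx, -⟩, rfl⟩ := hb
  obtain rfl : x = 0 := hx
  obtain ⟨P, r, T, hr, hT, hP, hdom, htar⟩ := 𝔹.exists_collar_patch y
  set κ := extChartAt (𝓡 n) y with hκ
  obtain ⟨ζ, hζ, hζc, hζs, hζ1⟩ := exists_bump (κ y) (r := r / 8) (by positivity)
  obtain ⟨ζ₁, hζ₁, hζc₁, hζs₁, hζ₁1⟩ := exists_bump (κ y) (r := r / 4) (by positivity)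
  have key : ∀ (s : ℝ) (ζ : EuclideanSpace ℝ (Fin n) → ℝ), T < s → ContDiff ℝ ∞ ζ →
      HasCompactSupport ζ → tsupport ζ ⊆ Metric.ball (κ y) r → P.IsCutoff (collarCutoff s ζ) :=
    fun s ζ hs hζ hζc hζs ↦ {
      contDiff := contDiff_collarCutoff hζ
      tsupport_subset := fun p hp ↦ by
        have := tsupport_collarCutoff_subset hp
        rw [hdom]
        exact ⟨hs.trans_le this.1, hζs this.2⟩
      hasCompactSupport := fun u ↦ by
        rw [hP]
        exact 𝔹.hasCompactSupport_collarCutoff y (hT.trans hs) hζc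
          (hζs.trans (Metric.ball_subset_closedBall.trans htar)) u
      exists_bound := exists_bound_collarCutoff hζ hζc
      exists_bound_coord := ⟨s + 2, fun p hp ↦ fderiv_collarCutoff_single hζ hp⟩ }
  -- The offsets are staggered by one, the width of the transition: `χ₁` starts at `T + 1` and no
  -- longer varies in `t` from `T + 2` on, where `χ` starts; `χ` in turn no longer varies in `t`
  -- from `T + 3` on. This is why the neighbourhood below is cut at `x < exp (-(T + 3))`.
  have h := key (T + 2) ζ (by linarith) hζ hζc (by
    rw [hζs]
    exact Metric.closedBall_subset_ball (by linarith))
  have h₁ := key (T + 1) ζ₁ (by linarith) hζ₁ hζc₁ (by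
    rw [hζs₁]
    exact Metric.closedBall_subset_ball (by linarith))
  obtain ⟨M, hM⟩ := h.exists_le_mul (χ₁ := collarCutoff (T + 1) ζ₁) fun p hp ↦ by
    have h2 := tsupport_collarCutoff_subset hp
    rw [collarCutoff_of_le (by linarith [h2.1])]
    refine hζ₁1 _ ?_
    have h3 := h2.2
    rw [hζs] at h3
    exact Metric.closedBall_subset_closedBall (by linarith) h3
  have hUo : IsOpen (Iio (Real.exp (-(T + 3))) ×ˢ
      (κ.source ∩ κ ⁻¹' Metric.ball (κ y) (r / 8))) :=
    isOpen_Iio.prod ((continuousOn_extChartAt y).isOpen_inter_preimage (isOpen_extChartAt_source y)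
      Metric.isOpen_ball)
  have hopen := 𝔹.contMDiffOn_collar_symm.continuousOn.isOpen_inter_preimage
    𝔹.isOpen_collar_target hUo
  have hsrc : ((0 : ℝ), y) ∈ 𝔹.collar.source := by
    rw [𝔹.collar_source]
    exact ⟨left_mem_Ico.2 one_pos, mem_univ _⟩
  refine ⟨_, hopen.mem_nhds ⟨𝔹.collar.map_source hsrc, ?_⟩, ?_⟩
  · rw [mem_preimage, 𝔹.collar.left_inv hsrc]
    exact ⟨Real.exp_pos _, mem_extChartAt_source y, Metric.mem_ball_self (by positivity)⟩
  refine h.exists_eLpNorm_six_le h₁ hM hn hopen.measurableSet ?_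
  rintro z ⟨⟨hz, hzU⟩, hzi⟩
  obtain ⟨q, hq, rfl⟩ : ∃ q ∈ 𝔹.collar.source, 𝔹.collar q = z :=
    ⟨_, 𝔹.collar.map_target hz, 𝔹.collar.right_inv hz⟩
  rw [mem_preimage, 𝔹.collar.left_inv hq] at hzU
  obtain ⟨x, w⟩ := q
  have hq' := hq
  rw [𝔹.collar_source] at hq'
  have hx0 : 0 < x := by
    refine lt_of_le_of_ne hq'.1.1 fun h0 ↦ ?_
    have h1 : 𝔹.collar (x, w) ∈ (𝓡∂ (n + 1)).boundary B := by
      rw [← 𝔹.collar_image_zero]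
      exact ⟨(x, w), ⟨h0.symm, mem_univ _⟩, rfl⟩
    rw [← ModelWithCorners.compl_interior] at h1
    exact h1 hzi
  have hxT : T + 3 < -Real.log x := by
    have h1 : x < Real.exp (-(T + 3)) := hzU.1
    have := (Real.log_lt_iff_lt_exp hx0).2 h1
    linarith
  have hw : κ w ∈ Metric.ball (κ y) (r / 8) := hzU.2.2
  refine ⟨consPoint (-Real.log x) (κ w), ⟨?_, ?_⟩, ?_⟩
  · rw [hdom]
    refine ⟨?_, ?_⟩
    · rw [consPoint_zero]
      linarith
    · rw [tailL_consPoint]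
      exact Metric.ball_subset_ball (by linarith) hw
  · rw [collarCutoff_of_le (by rw [consPoint_zero]; linarith), tailL_consPoint]
    exact hζ1 _ (Metric.ball_subset_closedBall hw)
  · rw [hP, collarMap, consPoint_zero, tailL_consPoint, neg_neg, Real.exp_log hx0,
      ← hκ, κ.left_inv hzU.2.1]

end Measure

end ConicManifold

namespace ConicManifold

variable {n : ℕ} {Y B : Type*}
  [TopologicalSpace Y] [ChartedSpace (EuclideanSpace ℝ (Fin n)) Y] [IsManifold (𝓡 n) ∞ Y]
  [TopologicalSpace B] [ChartedSpace (EuclideanHalfSpace (n + 1)) B]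
  [IsManifold (𝓡∂ (n + 1)) ∞ B]

/-! ### The global estimates -/

section Measure

variable [MeasurableSpace B] [BorelSpace B]

/-- Having a bound on a set passes to subsets and finite unions, so by compactness the local bounds
at interior and boundary points are enough. -/
theorem exists_eLpNorm_vol_six_le [CompactSpace B] (𝔹 : ConicManifold n Y B)
    (hn : n = 1 ∨ n = 2) : ∃ C : NNReal, ∀ u : 𝔹.TestFunction, eLpNorm u.1 6 𝔹.vol ≤ C * ‖u‖ₑ := by
  suffices h : ∃ C : NNReal, ∀ u : 𝔹.TestFunction,
      eLpNorm u.1 6 (𝔹.vol.restrict univ) ≤ C * ‖u‖ₑ by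
    simpa only [Measure.restrict_univ] using h
  refine isCompact_univ.induction_on (p := fun S ↦ ∃ C : NNReal, ∀ u : 𝔹.TestFunction,
      eLpNorm u.1 6 (𝔹.vol.restrict S) ≤ C * ‖u‖ₑ) ⟨0, fun u ↦ by simp⟩ ?_ ?_ ?_
  · rintro S T hST ⟨C, hC⟩
    exact ⟨C, fun u ↦ (eLpNorm_mono_measure _ (Measure.restrict_mono_set _ hST)).trans (hC u)⟩
  · rintro S T ⟨C, hC⟩ ⟨D, hD⟩
    refine ⟨C + D, fun u ↦ ?_⟩
    have key : eLpNorm u.1 6 (𝔹.vol.restrict (S ∪ T)) ≤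
        eLpNorm u.1 6 (𝔹.vol.restrict S) + eLpNorm u.1 6 (𝔹.vol.restrict T) := by
      rw [← ENNReal.pow_le_pow_left_iff (n := 6) (by norm_num)]
      have e : ∀ ν : Measure B, eLpNorm u.1 6 ν ^ 6 = ∫⁻ z, ‖u.1 z‖ₑ ^ 6 ∂ν := fun ν ↦
        eLpNorm_pow_eq_lintegral (k := 6) u.1 (by norm_num)
      calc _ ≤ ∫⁻ z, ‖u.1 z‖ₑ ^ 6 ∂(𝔹.vol.restrict S + 𝔹.vol.restrict T) := by
            rw [e]
            exact lintegral_mono' (Measure.restrict_union_le S T) le_rfl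
        _ ≤ _ := by
            rw [lintegral_add_measure, ← e, ← e]
            -- This is `a ^ 6 + b ^ 6 ≤ (a + b) ^ 6`.
            exact pow_add_pow_le zero_le zero_le (by norm_num)
    refine key.trans ((add_le_add (hC u) (hD u)).trans_eq ?_)
    push_cast
    ring
  · intro b _
    rw [nhdsWithin_univ]
    rcases ModelWithCorners.isInteriorPoint_or_isBoundaryPoint (I := 𝓡∂ (n + 1)) b with hb | hb
    · exact 𝔹.exists_eLpNorm_six_le_of_mem_interior hn hb
    · exact 𝔹.exists_eLpNorm_six_le_of_mem_boundary hn hb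

/-- Cauchy–Schwarz for `|v|⁴ = |v| |v|³`, where the `L²` norm of `v ^ 3` is the cube of the `L⁶`
norm of `v`. -/
theorem eLpNorm_four_pow_le {X : Type*} [MeasurableSpace X] (ν : Measure X) {v : X → ℂ}
    (hv : AEStronglyMeasurable v ν) :
    eLpNorm v 4 ν ^ 4 ≤ eLpNorm v 2 ν * eLpNorm v 6 ν ^ 3 := by
  have h := eLpNorm_le_eLpNorm_mul_eLpNorm'_of_norm (μ := ν) (p := 2) (q := 2) (r := 1)
    (f := v) (g := fun x ↦ v x ^ 3) hv (hv.pow 3) (fun z w ↦ z * w) 1 (ae_of_all _ fun x ↦ by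
      rw [norm_mul, NNReal.coe_one, one_mul])
  rw [eLpNorm_pow_natCast ν 3 (by norm_num) 2 6 (by norm_num), ENNReal.coe_one, one_mul] at h
  rw [← eLpNorm_pow_natCast ν 4 (by norm_num) 1 4 (by norm_num)]
  refine (eLpNorm_congr_ae (ae_of_all _ fun x ↦ ?_)).trans_le h
  ring

theorem exists_eLpNorm_vol_four_le [CompactSpace B] (𝔹 : ConicManifold n Y B)
    (hn : n = 1 ∨ n = 2) : ∃ C : NNReal, ∀ u : 𝔹.TestFunction, eLpNorm u.1 4 𝔹.vol ≤ C * ‖u‖ₑ := by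
  obtain ⟨C, hC⟩ := 𝔹.exists_eLpNorm_vol_six_le hn
  refine ⟨C + 1, fun u ↦ ?_⟩
  rw [← ENNReal.pow_le_pow_left_iff (n := 4) (by norm_num)]
  have h1 : (1 : ℝ≥0∞) ≤ ((C + 1 : NNReal) : ℝ≥0∞) := ENNReal.coe_le_coe.2 le_add_self
  have h2 : (C : ℝ≥0∞) ≤ ((C + 1 : NNReal) : ℝ≥0∞) := ENNReal.coe_le_coe.2 le_self_add
  calc _ ≤ eLpNorm u.1 2 𝔹.vol * eLpNorm u.1 6 𝔹.vol ^ 3 :=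
        eLpNorm_four_pow_le _ u.2.1.continuous.aestronglyMeasurable
    _ ≤ (1 * ‖u‖ₑ) * (C * ‖u‖ₑ) ^ 3 := by
        gcongr
        · rw [one_mul]
          exact 𝔹.eLpNorm_two_le_enorm u
        · exact hC u
    _ ≤ (((C + 1 : NNReal) : ℝ≥0∞) * ‖u‖ₑ) * (((C + 1 : NNReal) : ℝ≥0∞) * ‖u‖ₑ) ^ 3 := by
        gcongr
    _ = _ := by ring

end Measure

end ConicManifold

/-! ### Closability of the gradient -/

theorem ContinuousLinearMap.norm_le_sum_norm_apply_single {m : ℕ}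
    (L : EuclideanSpace ℝ (Fin m) →L[ℝ] ℂ) : ‖L‖ ≤ ∑ i, ‖L (EuclideanSpace.single i 1)‖ := by
  refine L.opNorm_le_bound (by positivity) fun v ↦ ?_
  have h : v = ∑ i, v i • EuclideanSpace.single i (1 : ℝ) := by
    ext j
    simp [Finset.sum_apply, Pi.single_apply]
  conv_lhs => rw [h]
  rw [map_sum, Finset.sum_mul]
  refine (norm_sum_le _ _).trans (Finset.sum_le_sum fun i _ ↦ ?_)
  rw [map_smul, norm_smul, mul_comm]
  gcongr
  exact PiLp.norm_apply_le v i

theorem eLpNorm_le_sum_of_norm_le {X ι F G : Type*} [MeasurableSpace X] [NormedAddCommGroup F]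
    [NormedAddCommGroup G] {μ : Measure X} {f : X → F} {g : ι → X → G} {p : ℝ≥0∞} (s : Finset ι)
    (hp : 1 ≤ p) (hg : ∀ i ∈ s, AEStronglyMeasurable (g i) μ)
    (h : ∀ x, ‖f x‖ ≤ ∑ i ∈ s, ‖g i x‖) : eLpNorm f p μ ≤ ∑ i ∈ s, eLpNorm (g i) p μ := by
  calc eLpNorm f p μ ≤ eLpNorm (∑ i ∈ s, fun x ↦ ‖g i x‖) p μ := eLpNorm_mono fun x ↦ by
        rw [Finset.sum_apply]
        exact (h x).trans (le_abs_self _)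
    _ ≤ ∑ i ∈ s, eLpNorm (fun x ↦ ‖g i x‖) p μ := eLpNorm_sum_le (fun i hi ↦ (hg i hi).norm) hp
    _ = _ := by simp only [eLpNorm_norm]

/-- The closability of each directional derivative is applied to the coordinate directions, whose
sum controls the operator norm. -/
theorem tendsto_eLpNorm_fderiv {m : ℕ} {v : ℕ → EuclideanSpace ℝ (Fin m) → ℂ}
    (hv : ∀ k, ContDiff ℝ ∞ (v k)) (hc : ∀ k, HasCompactSupport (v k))
    (h0 : Tendsto (fun k ↦ eLpNorm (v k) 2) atTop (𝓝 0))
    (hC : ∀ ε : ℝ, 0 < ε → ∃ N, ∀ k ≥ N, ∀ l ≥ N,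
      eLpNorm (fun p ↦ fderiv ℝ (v k) p - fderiv ℝ (v l) p) 2 ≤ ENNReal.ofReal ε) :
    Tendsto (fun k ↦ eLpNorm (fderiv ℝ (v k)) 2) atTop (𝓝 0) := by
  have h1 : ∀ i : Fin m, Tendsto
      (fun k ↦ eLpNorm (fun p ↦ fderiv ℝ (v k) p (EuclideanSpace.single i 1)) 2) atTop (𝓝 0) := by
    intro i
    refine tendsto_eLpNorm_fderiv_apply volume hv hc _ h0 fun ε hε ↦ ?_
    obtain ⟨N, hN⟩ := hC ε hε
    refine ⟨N, fun k hk l hl ↦ (eLpNorm_mono fun p ↦ ?_).trans (hN k hk l hl)⟩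
    rw [← sub_apply]
    exact (ContinuousLinearMap.le_opNorm _ _).trans_eq (by simp)
  have h2 := tendsto_finsetSum Finset.univ fun i _ ↦ h1 i
  rw [Finset.sum_const_zero] at h2
  refine tendsto_of_tendsto_of_tendsto_of_le_of_le tendsto_const_nhds h2
    (fun _ ↦ zero_le) fun k ↦ ?_
  have hm : ∀ i ∈ Finset.univ, AEStronglyMeasurable
      (fun p ↦ fderiv ℝ (v k) p (EuclideanSpace.single i 1)) volume := fun i _ ↦
    (((hv k).continuous_fderiv (by simp)).clm_apply continuous_const).aestronglyMeasurable
  exact eLpNorm_le_sum_of_norm_le Finset.univ (by norm_num) hm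
    fun p ↦ ContinuousLinearMap.norm_le_sum_norm_apply_single _

namespace ConicManifold

variable {n : ℕ} {Y B : Type*}
  [TopologicalSpace Y] [ChartedSpace (EuclideanSpace ℝ (Fin n)) Y] [IsManifold (𝓡 n) ∞ Y]
  [TopologicalSpace B] [ChartedSpace (EuclideanHalfSpace (n + 1)) B]
  [IsManifold (𝓡∂ (n + 1)) ∞ B]

section Measure

variable [MeasurableSpace B] [BorelSpace B]

namespace Patch

variable {𝔹 : ConicManifold n Y B} {P : 𝔹.Patch} {χ : EuclideanSpace ℝ (Fin (n + 1)) → ℝ}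

/-- Closability is local in the interior, and on patches with bounded first coordinate all
exponential weights are bounded below and may be dropped. -/
theorem eLpNorm_le_of_exp_smul {F : Type*} [NormedAddCommGroup F] [NormedSpace ℝ F]
    {f : EuclideanSpace ℝ (Fin (n + 1)) → F} {R : ℝ} (hR : ∀ p ∈ P.dom, |p 0| ≤ R) (β : ℝ) :
    eLpNorm f 2 (volume.restrict P.dom) ≤ ENNReal.ofReal (Real.exp (|β| * R)) *
      eLpNorm (fun p ↦ Real.exp (-β * p 0) • f p) 2 (volume.restrict P.dom) := by
  refine eLpNorm_le_mul_eLpNorm_of_ae_le_mul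
    ((ae_restrict_iff' P.isOpen_dom.measurableSet).2 (ae_of_all _ fun p hp ↦ ?_)) 2
  rw [norm_smul, Real.norm_of_nonneg (Real.exp_pos _).le, ← mul_assoc, ← Real.exp_add]
  refine le_mul_of_one_le_left (norm_nonneg _) (Real.one_le_exp_iff.2 ?_)
  have h1 : |β * p 0| ≤ |β| * R := by
    rw [abs_mul]
    gcongr
    exact hR p hp
  linarith [le_abs_self (β * p 0)]

theorem exists_eLpNorm_comp_le_eLpNorm {R : ℝ} (hR : ∀ p ∈ P.dom, |p 0| ≤ R) :
    ∃ C : NNReal, ∀ u : 𝔹.TestFunction,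
      eLpNorm (u.1 ∘ P.toFun) 2 (volume.restrict P.dom) ≤ C * eLpNorm u.1 2 𝔹.vol := by
  obtain ⟨C, hC⟩ := P.lintegral_comp_le
  refine ⟨(Real.exp (|((n : ℝ) + 1) / 2| * R)).toNNReal * (C + 1), fun u ↦ ?_⟩
  refine (eLpNorm_le_of_exp_smul hR (((n : ℝ) + 1) / 2)).trans ?_
  rw [ENNReal.coe_mul, mul_assoc]
  refine mul_le_mul' le_rfl ?_
  rw [← ENNReal.pow_le_pow_left_iff (n := 2) two_ne_zero]
  refine (eLpNorm_pow_eq_lintegral _ two_ne_zero).trans_le ?_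
  have h := hC (fun z ↦ ‖u.1 z‖ₑ ^ 2) (u.2.1.continuous.enorm.measurable.pow_const 2)
  refine (lintegral_mono fun p ↦ ?_).trans (h.trans ?_)
  · rw [enorm_smul, mul_pow, mul_comm, Real.enorm_of_nonneg (by positivity),
      ← ENNReal.ofReal_pow (by positivity), ← Real.exp_nat_mul]
    refine le_of_eq ?_
    simp only [Function.comp_apply]
    congr 3
    push_cast
    ring
  · exact mul_le_succ_mul_sq (eLpNorm_pow_eq_lintegral u.1 two_ne_zero).ge

theorem exists_eLpNorm_fderiv_le_enorm {R : ℝ} (hR : ∀ p ∈ P.dom, |p 0| ≤ R) :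
    ∃ C : NNReal, ∀ u : 𝔹.TestFunction,
      eLpNorm (fderiv ℝ (u.1 ∘ P.toFun)) 2 (volume.restrict P.dom) ≤ C * ‖u‖ₑ := by
  obtain ⟨C, hC⟩ := P.exists_eLpNorm_fderiv_comp_le
  refine ⟨(Real.exp (|((n : ℝ) - 1) / 2| * R)).toNNReal * C, fun u ↦ ?_⟩
  refine (eLpNorm_le_of_exp_smul hR (((n : ℝ) - 1) / 2)).trans ?_
  rw [ENNReal.coe_mul, mul_assoc]
  exact mul_le_mul' le_rfl (hC u)

theorem IsCutoff.exists_eLpNorm_smul_le (h : P.IsCutoff χ) {R : ℝ}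
    (hR : ∀ p ∈ P.dom, |p 0| ≤ R) : ∃ C : NNReal, ∀ u : 𝔹.TestFunction,
      eLpNorm (fun p ↦ χ p • u.1 (P.toFun p)) 2 ≤ C * eLpNorm u.1 2 𝔹.vol := by
  obtain ⟨C, hC⟩ := exists_eLpNorm_comp_le_eLpNorm hR
  obtain ⟨M, hM⟩ := h.exists_bound
  refine ⟨M.toNNReal * C, fun u ↦ ?_⟩
  rw [← eLpNorm_restrict_eq_of_support_subset (s := P.dom) (fun p hp ↦ h.tsupport_subset
    (subset_tsupport _ fun h0 ↦ hp (by simp [h0]))), ENNReal.coe_mul, mul_assoc]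
  refine (eLpNorm_le_mul_eLpNorm_of_ae_le_mul (c := M) (g := u.1 ∘ P.toFun)
    (ae_of_all _ fun p ↦ ?_) 2).trans (mul_le_mul' le_rfl (hC u))
  rw [norm_smul]
  exact mul_le_mul_of_nonneg_right (hM p).1 (norm_nonneg _)

theorem IsCutoff.exists_eLpNorm_fderiv_smul_le (h : P.IsCutoff χ) {R : ℝ}
    (hR : ∀ p ∈ P.dom, |p 0| ≤ R) : ∃ C : NNReal, ∀ u : 𝔹.TestFunction,
      eLpNorm (fderiv ℝ fun p ↦ χ p • u.1 (P.toFun p)) 2 ≤ C * ‖u‖ₑ := by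
  obtain ⟨C, hC⟩ := exists_eLpNorm_comp_le_eLpNorm hR
  obtain ⟨D, hD⟩ := exists_eLpNorm_fderiv_le_enorm hR
  obtain ⟨M, hM⟩ := h.exists_bound
  have hM0 : 0 ≤ M := (abs_nonneg _).trans (hM 0).1
  refine ⟨M.toNNReal * D + M.toNNReal * C, fun u ↦ ?_⟩
  have hsupp : Function.support (fderiv ℝ fun p ↦ χ p • u.1 (P.toFun p)) ⊆ P.dom := fun p hp ↦ by
    by_contra hpd
    exact hp (fderiv_smul_eq_zero_of_notMem h.tsupport_subset hpd)
  have hm₁ : AEStronglyMeasurable (fderiv ℝ (u.1 ∘ P.toFun)) (volume.restrict P.dom) := by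
    simpa using P.aestronglyMeasurable_fderiv_comp u 0
  have hm₂ : AEStronglyMeasurable (u.1 ∘ P.toFun) (volume.restrict P.dom) := by
    simpa [Function.comp_def] using P.aestronglyMeasurable_comp u 0
  have hle : ∀ p ∈ P.dom, ‖fderiv ℝ (fun p ↦ χ p • u.1 (P.toFun p)) p‖ ≤
      M * ‖fderiv ℝ (u.1 ∘ P.toFun) p‖ + M * ‖(u.1 ∘ P.toFun) p‖ := fun p hp ↦ by
    refine (norm_fderiv_smul_le (f := u.1 ∘ P.toFun) (h.contDiff.differentiable (by simp) p)
      ((P.contDiffAt_comp u.2.1 hp).differentiableAt (by simp))).trans ?_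
    exact add_le_add (mul_le_mul_of_nonneg_right (hM p).1 (norm_nonneg _))
      (mul_le_mul_of_nonneg_right (hM p).2 (norm_nonneg _))
  have key := eLpNorm_le_add_of_norm_le (p := 2) (by norm_num) hm₁ hm₂ hM0 hM0
    ((ae_restrict_iff' P.isOpen_dom.measurableSet).2 (ae_of_all _ hle))
  rw [eLpNorm_restrict_eq_of_support_subset hsupp] at key
  refine key.trans ?_
  rw [ENNReal.coe_add, add_mul, ENNReal.coe_mul, ENNReal.coe_mul, mul_assoc, mul_assoc]
  exact add_le_add (mul_le_mul' le_rfl (hD u)) (mul_le_mul' le_rfl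
    ((hC u).trans (mul_le_mul' le_rfl (𝔹.eLpNorm_two_le_enorm u))))

end Patch

end Measure

end ConicManifold

namespace ConicManifold

variable {n : ℕ} {Y B : Type*}
  [TopologicalSpace Y] [ChartedSpace (EuclideanSpace ℝ (Fin n)) Y] [IsManifold (𝓡 n) ∞ Y]
  [TopologicalSpace B] [ChartedSpace (EuclideanHalfSpace (n + 1)) B]
  [IsManifold (𝓡∂ (n + 1)) ∞ B]

section Measure

variable [MeasurableSpace B] [BorelSpace B]

theorem measurable_gradInner_self (𝔹 : ConicManifold n Y B) (u : 𝔹.TestFunction) :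
    Measurable fun z ↦ ENNReal.ofReal (𝔹.gradInner u.1 u.1 z).re :=
  (Complex.continuous_re.comp (𝔹.continuous_gradInner u u)).measurable.ennreal_ofReal

namespace Patch

variable {𝔹 : ConicManifold n Y B} {P : 𝔹.Patch} {χ : EuclideanSpace ℝ (Fin (n + 1)) → ℝ}

theorem IsCutoff.tendsto_eLpNorm_fderiv (h : P.IsCutoff χ) {R : ℝ} (hR : ∀ p ∈ P.dom, |p 0| ≤ R)
    {u : ℕ → 𝔹.TestFunction} (hu : CauchySeq u)
    (h0 : Tendsto (fun k ↦ eLpNorm (u k).1 2 𝔹.vol) atTop (𝓝 0)) :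
    Tendsto (fun k ↦ eLpNorm (fderiv ℝ fun p ↦ χ p • (u k).1 (P.toFun p)) 2) atTop (𝓝 0) := by
  obtain ⟨C, hC⟩ := h.exists_eLpNorm_smul_le hR
  obtain ⟨D, hD⟩ := h.exists_eLpNorm_fderiv_smul_le hR
  refine _root_.tendsto_eLpNorm_fderiv (v := fun k p ↦ χ p • (u k).1 (P.toFun p))
    (fun k ↦ h.contDiff_smul (u k)) (fun k ↦ h.hasCompactSupport (u k)) ?_ fun ε hε ↦ ?_
  · have := ENNReal.Tendsto.const_mul h0 (Or.inr (ENNReal.coe_ne_top (r := C)))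
    rw [mul_zero] at this
    exact tendsto_of_tendsto_of_tendsto_of_le_of_le tendsto_const_nhds this (fun _ ↦ zero_le)
      fun k ↦ hC (u k)
  · obtain ⟨N, hN⟩ := Metric.cauchySeq_iff.1 hu (ε / (D + 1)) (by positivity)
    refine ⟨N, fun k hk l hl ↦ ?_⟩
    have e : (fun p ↦ fderiv ℝ (fun p ↦ χ p • (u k).1 (P.toFun p)) p -
        fderiv ℝ (fun p ↦ χ p • (u l).1 (P.toFun p)) p) =
        fderiv ℝ fun p ↦ χ p • (u k - u l).1 (P.toFun p) := by
      funext p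
      rw [← fderiv_fun_sub ((h.contDiff_smul (u k)).differentiable (by simp) p)
        ((h.contDiff_smul (u l)).differentiable (by simp) p)]
      congr 1
      funext q
      exact (smul_sub _ _ _).symm
    rw [e]
    refine (hD _).trans ?_
    have hN' := (hN k hk l hl).le
    rw [dist_eq_norm] at hN'
    rw [← ofReal_norm, ← ENNReal.ofReal_coe_nnreal, ← ENNReal.ofReal_mul D.coe_nonneg]
    refine ENNReal.ofReal_le_ofReal ?_
    calc (D : ℝ) * ‖u k - u l‖ ≤ (D + 1) * (ε / (D + 1)) := by
          gcongr
          linarith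
      _ = ε := by field_simp

/-- The integral of `|∇u|²` over an open set on which the cutoff function is equal to one. -/
theorem exists_lintegral_grad_le {R : ℝ} (hR : ∀ p ∈ P.dom, |p 0| ≤ R) {N : Set B}
    (hN : MeasurableSet N) (hNP : N ⊆ P.toFun '' P.dom)
    (hχ : ∀ p ∈ P.dom, P.toFun p ∈ N → χ =ᶠ[𝓝 p] 1) : ∃ C : NNReal, ∀ u : 𝔹.TestFunction,
      ∫⁻ z in N, ENNReal.ofReal (𝔹.gradInner u.1 u.1 z).re ∂𝔹.vol ≤
        C * eLpNorm (fderiv ℝ fun p ↦ χ p • u.1 (P.toFun p)) 2 ^ 2 := by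
  obtain ⟨C, hC⟩ := P.lintegral_le_comp
  have hl := P.lower_pos
  -- The factor `2 / P.lower` comes from `P.gradInner_le`; the exponential bounds the weight `exp
  -- (-(n-1)t)` that remains after `exp (-2t)` is taken from the volume density.
  set K : ℝ := 2 / P.lower * Real.exp (|(n : ℝ) - 1| * R)
  refine ⟨C * K.toNNReal, fun u ↦ ?_⟩
  have h1 := hC _ ((𝔹.measurable_gradInner_self u).indicator hN)
  rw [setLIntegral_indicator hN, inter_eq_left.2 hNP] at h1
  refine h1.trans ?_
  rw [ENNReal.coe_mul, mul_assoc]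
  refine mul_le_mul' le_rfl ?_
  have h2 : eLpNorm (fderiv ℝ fun p ↦ χ p • u.1 (P.toFun p)) 2 ^ 2 =
      ∫⁻ p, ‖fderiv ℝ (fun p ↦ χ p • u.1 (P.toFun p)) p‖ₑ ^ 2 :=
    eLpNorm_pow_eq_lintegral _ two_ne_zero
  rw [h2, ← lintegral_const_mul' _ _ ENNReal.coe_ne_top]
  refine (setLIntegral_mono' P.isOpen_dom.measurableSet fun p hp ↦ ?_).trans
    (setLIntegral_le_lintegral P.dom _)
  by_cases hpN : P.toFun p ∈ N
  · have e : (fun p ↦ χ p • u.1 (P.toFun p)) =ᶠ[𝓝 p] u.1 ∘ P.toFun := by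
      filter_upwards [hχ p hp hpN] with q hq
      simp [hq]
    rw [indicator_of_mem hpN, e.fderiv_eq, ← ofReal_norm, ← ENNReal.ofReal_pow (norm_nonneg _),
      ← ENNReal.ofReal_mul (𝔹.gradInner_self_re_nonneg _ (P.mapsTo_interior hp))]
    change _ ≤ ENNReal.ofReal K * _
    rw [← ENNReal.ofReal_mul (by positivity)]
    refine ENNReal.ofReal_le_ofReal ?_
    have h3 := P.gradInner_le u.2.1 hp
    have h4 : Real.exp (-((n : ℝ) + 1) * p 0) =
        Real.exp (-p 0) ^ 2 * Real.exp (-((n : ℝ) - 1) * p 0) := by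
      rw [← Real.exp_nat_mul, ← Real.exp_add]
      congr 1
      push_cast
      ring
    have h5 : Real.exp (-((n : ℝ) - 1) * p 0) ≤ Real.exp (|(n : ℝ) - 1| * R) := by
      refine Real.exp_le_exp.2 ((le_abs_self _).trans ?_)
      rw [abs_mul, abs_neg]
      gcongr
      exact hR p hp
    calc _ = (P.lower * Real.exp (-p 0) ^ 2 * (𝔹.gradInner u.1 u.1 (P.toFun p)).re) *
          (Real.exp (-((n : ℝ) - 1) * p 0) / P.lower) := by
          rw [h4]
          field_simp
      _ ≤ (2 * ‖fderiv ℝ (u.1 ∘ P.toFun) p‖ ^ 2) *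
          (Real.exp (|(n : ℝ) - 1| * R) / P.lower) := by gcongr
      _ = _ := by
          simp only [K]
          ring
  · rw [indicator_of_notMem hpN, zero_mul]
    exact zero_le

end Patch

variable {𝔹 : ConicManifold n Y B} {u : ℕ → 𝔹.TestFunction}

theorem exists_tendsto_lintegral_grad (hu : CauchySeq u)
    (h0 : Tendsto (fun k ↦ eLpNorm (u k).1 2 𝔹.vol) atTop (𝓝 0)) {b : B}
    (hb : b ∈ (𝓡∂ (n + 1)).interior B) : ∃ N ∈ 𝓝 b, Tendsto
      (fun k ↦ ∫⁻ z in N, ENNReal.ofReal (𝔹.gradInner (u k).1 (u k).1 z).re ∂𝔹.vol)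
      atTop (𝓝 0) := by
  obtain ⟨P, r, hr, hP, hdom, htar⟩ := 𝔹.exists_interior_patch hb
  set φ := extChartAt (𝓡∂ (n + 1)) b with hφ
  obtain ⟨χ, hχ, hχc, hχs, hχ1⟩ := exists_bump (φ b) (r := r / 4) (by positivity)
  have h : P.IsCutoff χ := P.isCutoff_of_hasCompactSupport hχ hχc (by
    rw [hχs, hdom]
    exact Metric.closedBall_subset_ball (by linarith))
  have hR : ∀ p ∈ P.dom, |p 0| ≤ ‖φ b‖ + r := fun p hp ↦ by
    rw [hdom, mem_ball_iff_norm'] at hp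
    have := norm_le_norm_add_norm_sub (φ b) p
    linarith [abs_coord_le p 0]
  have hopen : IsOpen (φ.source ∩ φ ⁻¹' Metric.ball (φ b) (r / 4)) :=
    (continuousOn_extChartAt b).isOpen_inter_preimage (isOpen_extChartAt_source b)
      Metric.isOpen_ball
  obtain ⟨C, hC⟩ := Patch.exists_lintegral_grad_le (χ := χ) hR hopen.measurableSet (by
    rintro z ⟨hz, hzb⟩
    refine ⟨φ z, ?_, ?_⟩
    · rw [hdom]
      exact Metric.ball_subset_ball (by linarith) hzb
    · rw [hP]
      exact φ.left_inv hz) (by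
    rintro p hp ⟨-, hpb⟩
    rw [hdom] at hp
    rw [mem_preimage, hP, φ.right_inv (htar hp)] at hpb
    filter_upwards [Metric.isOpen_ball.mem_nhds hpb] with q hq
    exact hχ1 q (Metric.ball_subset_closedBall hq))
  refine ⟨_, hopen.mem_nhds ⟨mem_extChartAt_source b, Metric.mem_ball_self (by positivity)⟩, ?_⟩
  have h1 := ENNReal.Tendsto.const_mul
    (ENNReal.Tendsto.pow (n := 2) (h.tendsto_eLpNorm_fderiv hR hu h0))
    (Or.inr (ENNReal.coe_ne_top (r := C)))
  rw [zero_pow two_ne_zero, mul_zero] at h1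
  exact tendsto_of_tendsto_of_tendsto_of_le_of_le tendsto_const_nhds h1 (fun _ ↦ zero_le)
    fun k ↦ hC (u k)

theorem tendsto_lintegral_grad_of_isCompact (hu : CauchySeq u)
    (h0 : Tendsto (fun k ↦ eLpNorm (u k).1 2 𝔹.vol) atTop (𝓝 0)) {K : Set B} (hK : IsCompact K)
    (hKi : K ⊆ (𝓡∂ (n + 1)).interior B) : Tendsto
      (fun k ↦ ∫⁻ z in K, ENNReal.ofReal (𝔹.gradInner (u k).1 (u k).1 z).re ∂𝔹.vol)
      atTop (𝓝 0) := by
  refine hK.induction_on (p := fun S ↦ Tendsto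
      (fun k ↦ ∫⁻ z in S, ENNReal.ofReal (𝔹.gradInner (u k).1 (u k).1 z).re ∂𝔹.vol)
      atTop (𝓝 0)) (by simp) ?_ ?_ ?_
  · intro S T hST hT
    exact tendsto_of_tendsto_of_tendsto_of_le_of_le tendsto_const_nhds hT (fun _ ↦ zero_le)
      fun k ↦ lintegral_mono_set hST
  · intro S T hS hT
    have := hS.add hT
    rw [add_zero] at this
    exact tendsto_of_tendsto_of_tendsto_of_le_of_le tendsto_const_nhds this (fun _ ↦ zero_le)
      fun k ↦ lintegral_union_le _ _ _
  · intro b hb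
    obtain ⟨N, hN, h⟩ := exists_tendsto_lintegral_grad hu h0 (hKi hb)
    exact ⟨N, mem_nhdsWithin_of_mem_nhds hN, h⟩

theorem gradInner_congr (𝔹 : ConicManifold n Y B) {f g : B → ℂ} {z : B} (h : f =ᶠ[𝓝 z] g) :
    𝔹.gradInner f f z = 𝔹.gradInner g g z := by
  simp only [gradInner, partialDeriv, h.mfderiv_eq]
  rfl

/-- Off the support of `v` the functions `u` and `u - v` agree locally and have the same gradient.
With `v` a late member of a Cauchy sequence, no gradient of `u` can escape towards the boundary. -/
theorem enorm_sq_le_add_of_tsupport (u v : 𝔹.TestFunction) :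
    ‖u‖ₑ ^ 2 ≤ eLpNorm u.1 2 𝔹.vol ^ 2 +
      ∫⁻ z in tsupport v.1, ENNReal.ofReal (𝔹.gradInner u.1 u.1 z).re ∂𝔹.vol + ‖u - v‖ₑ ^ 2 := by
  have hm : MeasurableSet (tsupport v.1) := (isClosed_tsupport v.1).measurableSet
  rw [← lintegral_sq_add_lintegral_grad,
    ← lintegral_add_compl (fun z ↦ ENNReal.ofReal (𝔹.gradInner u.1 u.1 z).re) hm, add_assoc]
  refine add_le_add (eLpNorm_pow_eq_lintegral u.1 two_ne_zero).ge (add_le_add le_rfl ?_)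
  refine le_trans ?_ (𝔹.lintegral_grad_le (u - v))
  refine (setLIntegral_mono' hm.compl fun z hz ↦ ?_).trans (setLIntegral_le_lintegral _ _)
  rw [𝔹.gradInner_congr (g := (u - v).1)]
  filter_upwards [notMem_tsupport_iff_eventuallyEq.1 hz] with w hw
  change _ = u.1 w - v.1 w
  rw [hw]
  simp

/-- The gradient is closable: a Cauchy sequence in `H¹` that tends to zero in `L²` tends to
zero in `H¹`. -/
theorem tendsto_zero_of_tendsto_eLpNorm_two (hu : CauchySeq u)
    (h0 : Tendsto (fun k ↦ eLpNorm (u k).1 2 𝔹.vol) atTop (𝓝 0)) :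
    Tendsto (fun k ↦ ‖u k‖ₑ) atTop (𝓝 0) := by
  rw [ENNReal.tendsto_nhds_zero]
  intro ε hε
  obtain ⟨δ, hδ, hδε⟩ : ∃ δ : ℝ, 0 < δ ∧ ENNReal.ofReal δ ^ 2 + ENNReal.ofReal δ ^ 2 ≤ ε ^ 2 := by
    obtain ⟨e, he, he'⟩ := ENNReal.lt_iff_exists_nnreal_btwn.1 hε
    refine ⟨e / 2, by simpa using he, ?_⟩
    rw [← ENNReal.ofReal_pow (by positivity), ← ENNReal.ofReal_add (by positivity) (by positivity)]
    calc _ ≤ ENNReal.ofReal ((e : ℝ) ^ 2) := ENNReal.ofReal_le_ofReal (by nlinarith [e.coe_nonneg])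
      _ = (e : ℝ≥0∞) ^ 2 := by rw [ENNReal.ofReal_pow e.coe_nonneg, ENNReal.ofReal_coe_nnreal]
      _ ≤ ε ^ 2 := by gcongr
  -- The index `N` is fixed, so the support of `u N` is one compact subset of the interior on which
  -- the gradients of all `u k` tend to zero; the remainder is at most `‖u k - u N‖`.
  obtain ⟨N, hN⟩ := Metric.cauchySeq_iff'.1 hu δ hδ
  have h1 := (ENNReal.Tendsto.pow (n := 2) h0).add
    (tendsto_lintegral_grad_of_isCompact hu h0 (u N).2.2.1.isCompact (u N).2.2.2)
  rw [zero_pow two_ne_zero, add_zero] at h1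
  filter_upwards [ENNReal.tendsto_nhds_zero.1 h1 (ENNReal.ofReal δ ^ 2) (by positivity),
    eventually_ge_atTop N] with k hk hkN
  rw [← ENNReal.pow_le_pow_left_iff (n := 2) two_ne_zero]
  refine (enorm_sq_le_add_of_tsupport (u k) (u N)).trans ((add_le_add hk ?_).trans hδε)
  have h2 := (hN k hkN).le
  rw [dist_eq_norm] at h2
  rw [← ofReal_norm]
  gcongr

end Measure

end ConicManifold

namespace ConicManifold

variable {n : ℕ} {Y B : Type*}
  [TopologicalSpace Y] [ChartedSpace (EuclideanSpace ℝ (Fin n)) Y] [IsManifold (𝓡 n) ∞ Y]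
  [TopologicalSpace B] [ChartedSpace (EuclideanHalfSpace (n + 1)) B]
  [IsManifold (𝓡∂ (n + 1)) ∞ B]

/-! ### Embeddings of `H¹` -/

section Measure

variable [MeasurableSpace B] [BorelSpace B] {𝔹 : ConicManifold n Y B} {μ : Measure B} {p : ℝ≥0∞}

theorem memLp_of_eLpNorm_le {C : NNReal} (hC : ∀ u : 𝔹.TestFunction, eLpNorm u.1 p μ ≤ C * ‖u‖ₑ)
    (u : 𝔹.TestFunction) : MemLp u.1 p μ :=
  ⟨u.2.1.continuous.aestronglyMeasurable,
    (hC u).trans_lt (ENNReal.mul_lt_top ENNReal.coe_lt_top enorm_lt_top)⟩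

/-- A Cauchy sequence in `H¹` that tends to zero almost everywhere along a subsequence tends to
zero in `L²`. -/
theorem tendsto_eLpNorm_two_of_tendsto_ae {u : ℕ → 𝔹.TestFunction} (hu : CauchySeq u)
    {ns : ℕ → ℕ} (hns : StrictMono ns)
    (h : ∀ᵐ z ∂𝔹.vol, Tendsto (fun i ↦ (u (ns i)).1 z) atTop (𝓝 0)) :
    Tendsto (fun k ↦ eLpNorm (u k).1 2 𝔹.vol) atTop (𝓝 0) := by
  rw [ENNReal.tendsto_nhds_zero]
  intro ε hε
  obtain ⟨δ, hδ, hδε⟩ := ENNReal.lt_iff_exists_nnreal_btwn.1 hε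
  obtain ⟨N, hN⟩ := Metric.cauchySeq_iff.1 hu δ (by simpa using hδ)
  filter_upwards [eventually_ge_atTop N] with k hk
  -- Fatou's lemma: `u k` is the almost everywhere limit of `u k - u (ns i)`, whose `L²` norms are
  -- bounded by the Cauchy property in `H¹`.
  have h1 := Lp.eLpNorm_lim_le_liminf_eLpNorm (p := 2) (f := fun i ↦ (u k - u (ns i)).1)
    (fun i ↦ (u k - u (ns i)).2.1.continuous.aestronglyMeasurable) (u k).1 (h.mono fun z hz ↦ by
      have h2 := (tendsto_const_nhds (x := (u k).1 z)).sub hz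
      rw [sub_zero] at h2
      exact h2)
  refine h1.trans (liminf_le_of_le (by isBoundedDefault) fun b hb ↦ ?_)
  obtain ⟨i, hi, hiN⟩ := (hb.and (eventually_ge_atTop N)).exists
  refine hi.trans ((𝔹.eLpNorm_two_le_enorm _).trans (le_trans ?_ hδε.le))
  have h2 := (hN k hk (ns i) (hiN.trans (hns.id_le i))).le
  rw [dist_eq_norm] at h2
  rw [← ofReal_norm, ← ENNReal.ofReal_coe_nnreal]
  exact ENNReal.ofReal_le_ofReal h2

/-- If `L^p(μ)` norms of test functions are bounded by their norms in `H¹`, then `H¹` is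
continuously included in `L^p(μ)`. -/
theorem H1EmbedsIn.of_eLpNorm_le [Fact (1 ≤ p)] (hμ : 𝔹.vol ≪ μ) {C : NNReal}
    (hC : ∀ u : 𝔹.TestFunction, eLpNorm u.1 p μ ≤ C * ‖u‖ₑ) : 𝔹.H1EmbedsIn p μ := by
  have hmem := memLp_of_eLpNorm_le hC
  let T : 𝔹.TestFunction →ₗ[ℂ] Lp ℂ p μ :=
    { toFun := fun u ↦ (hmem u).toLp u.1
      map_add' := fun u v ↦ (hmem u).toLp_add (hmem v)
      map_smul' := fun a u ↦ (hmem u).toLp_const_smul a }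
  have hnorm : ∀ u, ‖T u‖ ≤ C * ‖(u : 𝔹.H1)‖ := fun u ↦ by
    rw [UniformSpace.Completion.norm_coe]
    refine (Lp.norm_toLp _ (hmem u)).trans_le
      (ENNReal.toReal_le_of_le_ofReal (by positivity) ((hC u).trans_eq ?_))
    rw [ENNReal.ofReal_mul C.coe_nonneg, ENNReal.ofReal_coe_nnreal, ofReal_norm]
  have hdense : DenseRange ((↑) : 𝔹.TestFunction → 𝔹.H1) :=
    UniformSpace.Completion.denseRange_coe
  let e : 𝔹.TestFunction →ₗ[ℂ] 𝔹.H1 :=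
    (UniformSpace.Completion.toComplL : 𝔹.TestFunction →L[ℂ] 𝔹.H1).toLinearMap
  have hι : ∀ u : 𝔹.TestFunction, T.extendOfNorm e (u : 𝔹.H1) = (hmem u).toLp u.1 := fun u ↦
    LinearMap.extendOfNorm_eq (f := T) (e := e) hdense ⟨C, hnorm⟩ u
  refine ⟨T.extendOfNorm e, (injective_iff_map_eq_zero _).2 fun ξ hξ ↦ ?_, fun u ↦ ?_⟩
  -- An element `ξ` of the kernel is a limit of test functions whose images tend to zero in
  -- `L^p(μ)`, hence almost everywhere along a subsequence. Absolute continuity carries this over to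
  -- `𝔹.vol`, and closability gives `ξ = 0`.
  · obtain ⟨w, hw, hwξ⟩ := mem_closure_iff_seq_limit.1 (hdense ξ)
    choose u hu using hw
    have huξ : Tendsto (fun k ↦ (u k : 𝔹.H1)) atTop (𝓝 ξ) := by simpa only [hu] using hwξ
    have hcau : CauchySeq u :=
      (UniformSpace.Completion.isUniformInducing_coe 𝔹.TestFunction).cauchy_map_iff.1
        huξ.cauchySeq
    have hT : Tendsto (fun k ↦ (hmem (u k)).toLp (u k).1) atTop (𝓝 0) := by
      rw [← hξ]
      simpa only [hι, Function.comp_def] using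
        ((T.extendOfNorm e).continuous.tendsto ξ).comp huξ
    obtain ⟨ns, hns, hae⟩ := (tendstoInMeasure_of_tendsto_Lp hT).exists_seq_tendsto_ae
    have hae' : ∀ᵐ z ∂𝔹.vol, Tendsto (fun i ↦ (u (ns i)).1 z) atTop (𝓝 0) := by
      refine hμ.ae_le ?_
      filter_upwards [hae, Lp.coeFn_zero ℂ p μ, ae_all_iff.2 fun k ↦ (hmem (u k)).coeFn_toLp]
        with z h1 h2 h3
      simpa only [h2, h3, Pi.zero_apply] using h1
    have h0 := tendsto_zero_of_tendsto_eLpNorm_two hcau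
      (tendsto_eLpNorm_two_of_tendsto_ae hcau hns hae')
    refine tendsto_nhds_unique huξ ?_
    rw [tendsto_zero_iff_norm_tendsto_zero]
    simp only [UniformSpace.Completion.norm_coe]
    simpa [Function.comp_def] using (ENNReal.tendsto_toReal ENNReal.zero_ne_top).comp h0
  · rw [hι]
    exact (hmem u).coeFn_toLp

/-! ### Weighted spaces -/

/-- The boundary function takes values in `[0, 1]` and the exponent `α` is nonnegative, so the
density of the weighted measure is at most one. -/
theorem weightedVol_le (𝔹 : ConicManifold n Y B) {x : B → ℝ} (hx : 𝔹.IsBoundaryFunction x)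
    {α q : ℝ} (hα : 0 ≤ α) (hq : 0 ≤ q) : 𝔹.weightedVol x (-α) q ≤ 𝔹.vol := by
  refine (withDensity_mono (ae_of_all _ fun z ↦ ?_)).trans_eq withDensity_one
  have h := hx.mem_Icc z
  rw [neg_neg, Pi.one_apply]
  exact ENNReal.ofReal_le_one.2 (Real.rpow_le_one (Real.rpow_nonneg h.1 _)
    (Real.rpow_le_one h.1 h.2 hα) hq)

/-- The density is positive on the interior, and the boundary is a null set. Injectivity of the
embedding uses this to pass from the weighted measure back to `𝔹.vol`. -/
theorem vol_absolutelyContinuous_weightedVol (𝔹 : ConicManifold n Y B) {x : B → ℝ}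
    (hx : 𝔹.IsBoundaryFunction x) (a q : ℝ) : 𝔹.vol ≪ 𝔹.weightedVol x a q := by
  have hi : ∀ᵐ z ∂𝔹.vol, z ∈ (𝓡∂ (n + 1)).interior B := by
    refine measure_mono_null (fun z hz ↦ ?_) 𝔹.vol_boundary
    rw [← ModelWithCorners.compl_interior]
    exact hz
  refine withDensity_absolutelyContinuous' ?_ (hi.mono fun z hz ↦ ?_)
  · have hc : ContinuousOn (fun z ↦ ENNReal.ofReal ((x z ^ (-a)) ^ q))
        ((𝓡∂ (n + 1)).interior B) := by
      refine ENNReal.continuous_ofReal.comp_continuousOn ?_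
      refine (hx.contMDiffOn.continuousOn.rpow_const fun z hz ↦ Or.inl (hx.pos z hz).ne').rpow_const
        fun z hz ↦ Or.inl (Real.rpow_pos_of_pos (hx.pos z hz) _).ne'
    rw [← Measure.restrict_eq_self_of_ae_mem hi]
    exact hc.aemeasurable measurableSet_interior
  · exact (ENNReal.ofReal_pos.2
      (Real.rpow_pos_of_pos (Real.rpow_pos_of_pos (hx.pos z hz) _) _)).ne'

end Measure

end ConicManifold

/-! ### The three embeddings -/

theorem mainTheorem8 {n : ℕ} {Y B : Type*}
    [TopologicalSpace Y] [T2Space Y] [CompactSpace Y]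
    [ChartedSpace (EuclideanSpace ℝ (Fin n)) Y] [IsManifold (𝓡 n) ∞ Y]
    [TopologicalSpace B] [T2Space B] [CompactSpace B]
    [ChartedSpace (EuclideanHalfSpace (n + 1)) B] [IsManifold (𝓡∂ (n + 1)) ∞ B]
    [MeasurableSpace B] [BorelSpace B]
    (𝔹 : ConicManifold n Y B) :
    (n + 1 = 2 ∨ n + 1 = 3 → 𝔹.H1EmbedsIn 4 𝔹.vol) ∧
    (n + 1 = 2 → 𝔹.H1EmbedsIn 6 𝔹.vol) ∧
    (n + 1 = 3 → ∀ x : B → ℝ, 𝔹.IsBoundaryFunction x → ∀ α : ℝ, 0 < α →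
      𝔹.H1EmbedsIn 6 (𝔹.weightedVol x (-α) 6)) := by
  refine ⟨fun hn ↦ ?_, fun hn ↦ ?_, fun hn x hx α hα ↦ ?_⟩
  · obtain ⟨C, hC⟩ := 𝔹.exists_eLpNorm_vol_four_le (by omega)
    exact .of_eLpNorm_le .rfl hC
  · obtain ⟨C, hC⟩ := 𝔹.exists_eLpNorm_vol_six_le (by omega)
    exact .of_eLpNorm_le .rfl hC
  -- The unweighted `L⁶` bound holds in dimension three as well, and the weight only decreases the
  -- measure.
  · obtain ⟨C, hC⟩ := 𝔹.exists_eLpNorm_vol_six_le (by omega)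
    exact .of_eLpNorm_le (𝔹.vol_absolutelyContinuous_weightedVol hx _ _) fun u ↦
      (eLpNorm_mono_measure _ (𝔹.weightedVol_le hx hα.le (by norm_num))).trans (hC u)
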